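/- Let $n\in\{2,3\}$, $k>0$, and let $\Gamma$ be a bounded, non-empty, relatively open subset of $\Gamma_\infty=\{x\in\mathbb{R}^n: x_n=0\}$, identified with an open subset of $\mathbb{R}^{n-1}$. Put $D=\mathbb{R}^n\setminus\overline\Gamma$, $U^\pm=\{x\in\mathbb{R}^n:\pm x_n>0\}$, and write $x=(\tilde x,x_n)$ with $\tilde x\in\mathbb{R}^{n-1}$. For an open set $\Omega\subset\mathbb{R}^m$ let $\mathscr{D}(\Omega)$ be the space of complex-valued $C^\infty$ functions with compact support in $\Omega$, and let $\mathscr{D}(\overline\Omega)$ be the space of restrictions to $\Omega$ of functions in $\mathscr{D}(\mathbb{R}^m)$. Let $\Phi$ be the fundamental solution of the Helmholtz equation, $\Phi(x,y)=\frac{e^{ik|x-y|}}{4\pi|x-y|}$ if $n=3$ and $\Phi(x,y)=\frac{i}{4}H_0^{(1)}(k|x-y|)$ if $n=2$. For $\phi\in\mathscr{D}(\Gamma)$ and $x\in D$ let $$\mathcal{S}_k\phi(x)=\int_\Gamma\Phi(x,y)\phi(y)\,ds(y),\qquad \mathcal{D}_k\phi(x)=\int_\Gamma\frac{\partial\Phi(x,y)}{\partial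 y_n}\phi(y)\,ds(y).$$ For $u$ with $u|_{U^\pm}\in\mathscr{D}(\overline{U^\pm})$ let $\gamma^\pm u$ and $\partial_n^\pm u$ be the boundary values on $\Gamma_\infty$, from the side $U^\pm$, of $u$ and of $\partial u/\partial x_n$. Define $S_k\phi=\gamma^\pm(\chi\,\mathcal{S}_k\phi)|_\Gamma$ and $T_k\phi=\partial_n^\pm(\chi\,\mathcal{D}_k\phi)|_\Gamma$, where $\chi\in\mathscr{D}(\mathbb{R}^n)$ equals $1$ in a neighbourhood of $\Gamma$. Let $\hat\varphi(\xi)=(2\pi)^{-(n-1)/2}\int_{\mathbb{R}^{n-1}}e^{-i\xi\cdot\tilde x}\varphi(\tilde x)\,d\tilde x$, and, for $\xi\in\mathbb{R}^{n-1}$, let $Z(\xi)=\sqrt{k^2-|\xi|^2}$ if $|\xi|\le k$ and $Z(\xi)=i\sqrt{|\xi|^2-k^2}$ if $|\xi|>k$. For $\varphi\in\mathscr{D}(\mathbb{R}^{n-1})$ define $$S_k^\infty\varphi(\tilde x)=\frac{i}{2(2\pi)^{(n-1)/2}}\int_{\mathbb{R}^{n-1}}\frac{e^{i\xi\cdot\tilde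 x}}{Z(\xi)}\hat\varphi(\xi)\,d\xi,\qquad T_k^\infty\varphi(\tilde x)=\frac{i}{2(2\pi)^{(n-1)/2}}\int_{\mathbb{R}^{n-1}}Z(\xi)e^{i\xi\cdot\tilde x}\hat\varphi(\xi)\,d\xi .$$ All integrals in this statement converge absolutely, and the following hold. 1. $S_k^\infty$ and $T_k^\infty$ map $\mathscr{D}(\mathbb{R}^{n-1})$ into $C^\infty(\mathbb{R}^{n-1})$. 2. For all $\phi\in\mathscr{D}(\Gamma)$ and $x=(\tilde x,x_n)\in D$ (with $\operatorname{sign}0=0$), $$\mathcal{S}_k\phi(x)=\frac{i}{2(2\pi)^{(n-1)/2}}\int_{\mathbb{R}^{n-1}}\frac{e^{i(\xi\cdot\tilde x+|x_n|Z(\xi))}}{Z(\xi)}\hat\phi(\xi)\,d\xi,\qquad \mathcal{D}_k\phi(x)=\frac{\operatorname{sign}x_n}{2(2\pi)^{(n-1)/2}}\int_{\mathbb{R}^{n-1}}e^{i(\xi\cdot\tilde x+|x_n|Z(\xi))}\hat\phi(\xi)\,d\xi .$$ 3. For all $\phi\in\mathscr{D}(\Gamma)$, every cut-off function $\chi$ as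 above and either choice of the sign $\pm$, the restrictions of $\chi\mathcal{S}_k\phi$ and $\chi\mathcal{D}_k\phi$ to $U^\pm$ lie in $\mathscr{D}(\overline{U^\pm})$; moreover $S_k\phi,T_k\phi\in\mathscr{D}(\overline\Gamma)$, and $S_k\phi=(S_k^\infty\phi)|_\Gamma$, $T_k\phi=(T_k^\infty\phi)|_\Gamma$. In particular $S_k\phi$ and $T_k\phi$ do not depend on $\chi$ or on the sign. 4. For all $\phi,\psi\in\mathscr{D}(\Gamma)$, $$(S_k\phi,\psi)_{L^2(\Gamma)}=\frac{i}{2}\int_{\mathbb{R}^{n-1}}\frac{1}{Z(\xi)}\hat\phi(\xi)\overline{\hat\psi(\xi)}\,d\xi,\qquad (T_k\phi,\psi)_{L^2(\Gamma)}=\frac{i}{2}\int_{\mathbb{R}^{n-1}}Z(\xi)\hat\phi(\xi)\overline{\hat\psi(\xi)}\,d\xi .$$ -/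

import Mathlib

open MeasureTheory TopologicalSpace
open scoped ContDiff Distributions

noncomputable section

namespace Screen

/-- The space `ℝᵐ` with its Euclidean norm. Throughout `d = n - 1` is the dimension of the
hyperplane `Γ_∞ = {x ∈ ℝⁿ : x_n = 0}`, and `n = d + 1`. -/
abbrev E (m : ℕ) : Type := EuclideanSpace ℝ (Fin m)

/-- The point `(y, t) ∈ ℝⁿ` with `y ∈ ℝⁿ⁻¹` and last coordinate `t`. -/
def point {d : ℕ} (y : E d) (t : ℝ) : E (d + 1) :=
  WithLp.toLp 2 (Fin.snoc (α := fun _ => ℝ) (fun i => y i) t)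

/-- The last coordinate `x_n` of `x ∈ ℝⁿ`. -/
def height {d : ℕ} (x : E (d + 1)) : ℝ := x (Fin.last d)

/-- The first `n - 1` coordinates of `x ∈ ℝⁿ`. -/
def horiz {d : ℕ} (x : E (d + 1)) : E d :=
  WithLp.toLp 2 (fun i => x i.castSucc)

/-- The unit normal `e_n` of the hyperplane. -/
def normal (d : ℕ) : E (d + 1) := EuclideanSpace.single (Fin.last d) 1

/-- The partial derivative `∂u/∂x_n`. -/
def normalDeriv {d : ℕ} (u : E (d + 1) → ℂ) (x : E (d + 1)) : ℂ :=
  lineDeriv ℝ u x (normal d)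

/-- The screen `{(y, 0) : y ∈ Γ} ⊆ ℝⁿ`, for `Γ ⊆ ℝⁿ⁻¹`. -/
def screen {d : ℕ} (Γ : Set (E d)) : Set (E (d + 1)) := (fun y => point y 0) '' Γ

/-- The propagation domain `D`, the complement in `ℝⁿ` of the closure of the screen. -/
def domain {d : ℕ} (Γ : Set (E d)) : Set (E (d + 1)) := (closure (screen Γ))ᶜ

/-- The open half spaces `U⁺` (for `s = 1`) and `U⁻` (for `s = -1`). -/
def halfSpace (d : ℕ) (s : ℤˣ) : Set (E (d + 1)) := {x | 0 < ((s : ℤ) : ℝ) * height x}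

/-- The Bessel function `J₀` of the first kind (Bessel's integral). -/
def besselJ0 (z : ℝ) : ℝ :=
  (1 / Real.pi) * ∫ θ in (0 : ℝ)..Real.pi, Real.cos (z * Real.sin θ)

/-- The Bessel function `Y₀` of the second kind at `z > 0` (Schläfli's integral). -/
def besselY0 (z : ℝ) : ℝ :=
  (1 / Real.pi) * (∫ θ in (0 : ℝ)..Real.pi, Real.sin (z * Real.sin θ))
    - (2 / Real.pi) * ∫ t in Set.Ioi (0 : ℝ), Real.exp (-(z * Real.sinh t))

/-- The Hankel function `H₀⁽¹⁾ = J₀ + i Y₀` at `z > 0`. -/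
def hankel0 (z : ℝ) : ℂ := (besselJ0 z : ℂ) + Complex.I * (besselY0 z : ℂ)

/-- The (radiating) fundamental solution `Φ(x, y)` of the Helmholtz equation in `ℝⁿ`, `n = d + 1`,
for `n = 3` (first case) and `n = 2` (second case). Other dimensions are not used. -/
def fundSol {d : ℕ} (k : ℝ) (x y : E (d + 1)) : ℂ :=
  if d = 2 then
    Complex.exp (Complex.I * (k * ‖x - y‖ : ℝ)) / ((4 * Real.pi * ‖x - y‖ : ℝ) : ℂ)
  else
    Complex.I / 4 * hankel0 (k * ‖x - y‖)

/-- The single layer potential `∫_Γ Φ(x, y) φ(y) ds(y)`. -/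
def singleLayer {d : ℕ} (k : ℝ) (Γ : Set (E d)) (φ : E d → ℂ) (x : E (d + 1)) : ℂ :=
  ∫ y in Γ, fundSol k x (point y 0) * φ y

/-- The double layer potential `∫_Γ (∂Φ(x, y)/∂n(y)) φ(y) ds(y)`, with `n = e_n`. -/
def doubleLayer {d : ℕ} (k : ℝ) (Γ : Set (E d)) (φ : E d → ℂ) (x : E (d + 1)) : ℂ :=
  ∫ y in Γ, normalDeriv (fundSol k x) (point y 0) * φ y

/-- `u ∈ 𝒟(closure of U^±)`: on the open half space, `u` is the restriction of a
compactly supported smooth function on `ℝⁿ`. -/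
def SmoothUpToBoundary {d : ℕ} (s : ℤˣ) (u : E (d + 1) → ℂ) : Prop :=
  ∃ V : 𝓓((⊤ : Opens (E (d + 1))), ℂ), Set.EqOn u V (halfSpace d s)

/-- The Dirichlet trace `γ^± u = u|_{Γ_∞}`, taken from the side `U^±`, of a function `u` which is
smooth up to the boundary of `U^±`: the boundary values of its continuous extension. -/
def dirichletTrace {d : ℕ} (s : ℤˣ) (u : E (d + 1) → ℂ) (y : E d) : ℂ :=
  extendFrom (halfSpace d s) u (point y 0)

/-- The Neumann trace `∂_n^± u = (∂u/∂x_n)|_{Γ_∞}`, taken from the side `U^±`, of a function `u`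
which is smooth up to the boundary of `U^±`. -/
def neumannTrace {d : ℕ} (s : ℤˣ) (u : E (d + 1) → ℂ) (y : E d) : ℂ :=
  extendFrom (halfSpace d s) (normalDeriv u) (point y 0)

/-- The class `𝒟_{1,Γ}(ℝⁿ)` of cut-off functions: `χ` is smooth with compact support,
and `χ = 1` in a neighbourhood of the screen. -/
def IsCutoff {d : ℕ} (Γ : Set (E d)) (χ : 𝓓((⊤ : Opens (E (d + 1))), ℂ)) : Prop :=
  ∀ᶠ x in nhdsSet (screen Γ), χ x = 1

/-- The single layer boundary integral operator, `S_k φ = γ^±(χ 𝒮_k φ)` on `Γ`, for a cut-off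
function `χ` and a choice of sign. -/
def singleLayerOp {d : ℕ} (χ : E (d + 1) → ℂ) (s : ℤˣ) (k : ℝ) (Γ : Set (E d)) (φ : E d → ℂ) :
    E d → ℂ :=
  dirichletTrace s (fun x => χ x * singleLayer k Γ φ x)

/-- The hypersingular boundary integral operator, `T_k φ = ∂_n^±(χ 𝒟_k φ)` on `Γ`, for a cut-off
function `χ` and a choice of sign. -/
def hypersingularOp {d : ℕ} (χ : E (d + 1) → ℂ) (s : ℤˣ) (k : ℝ) (Γ : Set (E d)) (φ : E d → ℂ) :
    E d → ℂ :=
  neumannTrace s (fun x => χ x * doubleLayer k Γ φ x)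

/-- The phase `e^{i ξ·x}`. -/
def phase {d : ℕ} (ξ x : E d) : ℂ := Complex.exp (Complex.I * (inner ℝ ξ x : ℝ))

/-- The Fourier transform `(2π)^{-d/2} ∫ e^{-i ξ·x} φ(x) dx` on `ℝᵈ`. -/
def hat {d : ℕ} (φ : E d → ℂ) (ξ : E d) : ℂ :=
  1 / (((2 * Real.pi) ^ ((d : ℝ) / 2) : ℝ) : ℂ)
    * ∫ x, Complex.exp (-(Complex.I * (inner ℝ ξ x : ℝ))) * φ x

/-- The symbol `Z(ξ)`. -/
def Z {d : ℕ} (k : ℝ) (ξ : E d) : ℂ :=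
  if ‖ξ‖ ≤ k then (Real.sqrt (k ^ 2 - ‖ξ‖ ^ 2) : ℂ)
  else Complex.I * (Real.sqrt (‖ξ‖ ^ 2 - k ^ 2) : ℂ)

/-- `1 / (2 (2π)^{(n-1)/2})`. -/
def coeff (d : ℕ) : ℂ := 1 / (2 * (((2 * Real.pi) ^ ((d : ℝ) / 2) : ℝ) : ℂ))

/-- The operator `S_k^∞` with symbol `i / (2 Z)`. -/
def Sinf {d : ℕ} (k : ℝ) (φ : E d → ℂ) (x : E d) : ℂ :=
  Complex.I * coeff d * ∫ ξ, phase ξ x / Z k ξ * hat φ ξ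

/-- The operator `T_k^∞` with symbol `i Z / 2`. -/
def Tinf {d : ℕ} (k : ℝ) (φ : E d → ℂ) (x : E d) : ℂ :=
  Complex.I * coeff d * ∫ ξ, Z k ξ * phase ξ x * hat φ ξ

end Screen

end

/-!
Write `n = d + 1` and `x = (x̃, t)`. The heart of the matter is the spectral representation of the
single layer potential off the plane of the screen,
`∫ Φ(x, y) φ(y) dy = i coeff ∫ e^{i ξ·x̃} (e^{i t Z(ξ)} / Z(ξ)) φ̂(ξ) dξ` for `t > 0`; everything else
is read off from it.

For a wave number `k = iκ` with `κ > 0` the fundamental solution is the Laplace transform in time of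
the heat kernel, `Φ(r) = ∫_0^∞ e^{-κ² s} (4πs)^{-n/2} e^{-r²/4s} ds`. The heat kernel of `ℝⁿ` is the
product of those of `ℝ^{n-1}` and of `ℝ`. The former acts on the Fourier side as the multiplier
`e^{-s|ξ|²}`, and the Laplace transform of the latter at `κ² + |ξ|²` is `e^{-t√(κ²+|ξ|²)} /
(2√(κ²+|ξ|²))`; Fubini's theorem then gives the representation (`integral_heat_mul_eq_fourier`).
Both of its sides extend holomorphically to `Re κ > 0`, where they agree by the identity theorem, and
both converge as `κ = ε - ik` tends to `-ik`; on the Fourier side the limit of `√(κ²+|ξ|²)` is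
`-i Z(ξ)`, and `1 / |Z(ξ)|`, which is locally integrable, dominates (`integral_kernel_mul_eq_fourier`).
For `n = 3` the continued kernel is `e^{-κr} / (4πr)`. For `n = 2` it is `K₀(κr) / (2π)`, which has to
be continued to the imaginary axis and compared with the Hankel function there; both are done by
shifting the contour in `K₀(z) = ∫_0^∞ e^{-z cosh u} du` (`besselK0_eq_lower`,
`besselK0Lower_neg_I_mul`).

The representation extends to points of the plane off the closure of the screen by continuity
(`singleLayer_eq`), and differentiating it in the normal direction gives that of the double layer
potential (`doubleLayer_eq`), whose kernel vanishes in the plane itself.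

For the boundary values, the propagator `e^{i t Z(ξ)}`, `t ≥ 0`, is extended to all `t ∈ ℝ` so that
all `t`-derivatives grow at most polynomially in `ξ` (`propagatorJet`). Since `φ̂` decays rapidly, the
spectral integral with the extended propagator is a smooth function on the whole of `ℝⁿ`
(`contDiff_jetIntegral`) which agrees with the potential on the half space. Hence the potentials are
smooth up to the boundary, and their traces are the values at `t = 0` of this function and of its
normal derivative, that is, `S_k^∞ φ` and `T_k^∞ φ`. The sesquilinear forms follow from Fubini's
theorem (`sesquilinear_form_eq`).
-/

noncomputable section

namespace Screen

open Filter Topology Set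

/-! ### Holomorphic and smooth parametric integrals -/

/-- An integral of holomorphic functions with locally uniform integrable bounds is holomorphic. By
Cauchy's estimate the bound on the integrand is also one on its derivative. -/
theorem differentiableOn_integral_of_locally_dominated {α : Type*} [MeasurableSpace α]
    {μ : Measure α} {U : Set ℂ} (hU : IsOpen U) {F : ℂ → α → ℂ}
    (hm : ∀ z ∈ U, AEStronglyMeasurable (F z) μ)
    (hd : ∀ᵐ a ∂μ, DifferentiableOn ℂ (F · a) U)
    (hb : ∀ z ∈ U, ∃ V ∈ 𝓝 z, ∃ B : α → ℝ, Integrable B μ ∧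
      ∀ᵐ a ∂μ, ∀ w ∈ V, ‖F w a‖ ≤ B a) :
    DifferentiableOn ℂ (fun z => ∫ a, F z a ∂μ) U := by
  intro z hz
  obtain ⟨V, hV, B, hB, hFB⟩ := hb z hz
  obtain ⟨r, hr, hrV⟩ := Metric.nhds_basis_closedBall.mem_iff.1 (inter_mem hV (hU.mem_nhds hz))
  have hr2 : (0 : ℝ) < r / 2 := by positivity
  have hsub : ∀ w ∈ Metric.ball z (r / 2), Metric.closedBall w (r / 2) ⊆ V ∩ U := by
    intro w hw y hy
    apply hrV
    rw [Metric.mem_closedBall] at hy ⊢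
    have := Metric.mem_ball.1 hw
    linarith [dist_triangle y w z]
  have hzmem : z ∈ Metric.ball z (r / 2) := Metric.mem_ball_self hr2
  have hint : Integrable (F z) μ :=
    hB.mono' (hm z hz) (hFB.mono fun a ha => ha z (mem_of_mem_nhds hV))
  have hder : ∀ᵐ a ∂μ, ∀ w ∈ Metric.ball z (r / 2), HasDerivAt (F · a) (deriv (F · a) w) w := by
    filter_upwards [hd] with a ha w hw
    exact (ha.differentiableAt (hU.mem_nhds
      ((hsub w hw) (Metric.mem_closedBall_self hr2.le)).2)).hasDerivAt
  have hmeas : AEStronglyMeasurable (fun a => deriv (F · a) z) μ := by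
    -- the derivative is a limit of difference quotients along `z + r / (2 (n + 2))`
    set x : ℕ → ℂ := fun n => z + ((r / 2 / ((n : ℝ) + 2) : ℝ) : ℂ) with hx
    have hxU : ∀ n, x n ∈ U := by
      intro n
      refine (hrV ?_).2
      rw [Metric.mem_closedBall, hx, dist_eq_norm, add_sub_cancel_left, Complex.norm_real,
        Real.norm_eq_abs, abs_of_nonneg (div_nonneg hr2.le (by positivity))]
      have : r / 2 / ((n : ℝ) + 2) ≤ r / 2 :=
        div_le_self hr2.le (by linarith [n.cast_nonneg (α := ℝ)])
      linarith
    have hxlim : Tendsto x atTop (𝓝[≠] z) := by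
      refine tendsto_nhdsWithin_iff.2 ⟨?_, ?_⟩
      · have h1 : Tendsto (fun n : ℕ => r / 2 / ((n : ℝ) + 2)) atTop (𝓝 0) :=
          tendsto_const_nhds.div_atTop
            (tendsto_atTop_add_const_right _ _ tendsto_natCast_atTop_atTop)
        have h2 := (Complex.continuous_ofReal.tendsto 0).comp h1
        simpa [hx] using h2.const_add z
      · refine Eventually.of_forall fun n => ?_
        have : r / 2 / ((n : ℝ) + 2) ≠ 0 := by positivity
        rw [hx, mem_compl_iff, mem_singleton_iff, add_eq_left, Complex.ofReal_eq_zero]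
        exact this
    refine aestronglyMeasurable_of_tendsto_ae (u := atTop)
      (f := fun n a => slope (F · a) z (x n)) (fun n => ?_) ?_
    · simp only [slope_def_module]
      exact ((hm _ (hxU n)).sub (hm z hz)).const_smul ((x n - z)⁻¹)
    · filter_upwards [hder] with a ha
      exact (hasDerivAt_iff_tendsto_slope.1 (ha z hzmem)).comp hxlim
  have hbd : ∀ᵐ a ∂μ, ∀ w ∈ Metric.ball z (r / 2), ‖deriv (F · a) w‖ ≤ B a / (r / 2) := by
    filter_upwards [hFB, hd] with a ha hda w hw
    refine Complex.norm_deriv_le_of_forall_mem_sphere_norm_le hr2 ?_ fun y hy =>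
      ha y ((hsub w hw) (Metric.sphere_subset_closedBall hy)).1
    exact (hda.mono ((hsub w hw).trans inter_subset_right)).diffContOnCl_ball subset_rfl
  have key := hasDerivAt_integral_of_dominated_loc_of_deriv_le (Metric.ball_mem_nhds z hr2)
    (eventually_of_mem (hU.mem_nhds hz) hm) hint hmeas hbd (hB.div_const _) hder
  exact key.2.differentiableAt.differentiableWithinAt

/-! ### Smooth dependence of oscillatory integrals -/

theorem height_point {d : ℕ} (y : E d) (t : ℝ) : height (point y t) = t := by
  simp [height, point]

theorem horiz_point {d : ℕ} (y : E d) (t : ℝ) : horiz (point y t) = y := by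
  ext i; simp [horiz, point]

/-- The coordinate function `x ↦ xᵢ`, as a continuous linear form. -/
def coordL {m : ℕ} (i : Fin m) : E m →L[ℝ] ℝ := EuclideanSpace.proj i

theorem coordL_apply {m : ℕ} (i : Fin m) (x : E m) : coordL i x = x i := rfl

theorem contDiff_horiz {d : ℕ} : ContDiff ℝ ∞ (horiz : E (d + 1) → E d) := by
  rw [contDiff_euclidean]
  intro i
  exact (coordL (Fin.castSucc i)).contDiff

theorem contDiff_height {d : ℕ} : ContDiff ℝ ∞ (height : E (d + 1) → ℝ) :=
  (coordL (Fin.last d)).contDiff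

theorem contDiff_point {d : ℕ} : ContDiff ℝ ∞ (fun p : E d × ℝ => point p.1 p.2) := by
  rw [contDiff_euclidean]
  intro i
  refine Fin.lastCases ?_ (fun j => ?_) i
  · simpa [point] using contDiff_snd
  · simp only [point, Fin.snoc_castSucc]
    exact (coordL j).contDiff.comp (contDiff_fst (E := E d) (F := ℝ))

theorem norm_phase {d : ℕ} (ξ x : E d) : ‖phase ξ x‖ = 1 := by
  rw [phase, mul_comm]; exact Complex.norm_exp_ofReal_mul_I _

theorem continuous_phase {d : ℕ} : Continuous fun p : E d × E d => phase p.1 p.2 := by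
  unfold phase; fun_prop

/-- A density on `ℝᵈ` that is integrable against every power of `1 + |ξ|`. -/
def RapidlyIntegrable {d : ℕ} (c : E d → ℂ) : Prop :=
  ∀ N : ℕ, Integrable fun ξ => (((1 + ‖ξ‖) ^ N : ℝ) : ℂ) * c ξ

theorem RapidlyIntegrable.integrable {d : ℕ} {c : E d → ℂ} (hc : RapidlyIntegrable c) :
    Integrable c := by simpa using hc 0

theorem RapidlyIntegrable.mul_of_le {d : ℕ} {c : E d → ℂ} (hc : RapidlyIntegrable c)
    {g : E d → ℂ} (hg : Measurable g) {C : ℝ} {N : ℕ}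
    (hb : ∀ ξ, ‖g ξ‖ ≤ C * (1 + ‖ξ‖) ^ N) : RapidlyIntegrable fun ξ => g ξ * c ξ := by
  intro M
  refine ((hc (M + N)).norm.const_mul C).mono' ?_ (Eventually.of_forall fun ξ => ?_)
  · refine AEStronglyMeasurable.mul ?_ (hg.aestronglyMeasurable.mul hc.integrable.1)
    exact Continuous.aestronglyMeasurable (by fun_prop)
  · simp only [norm_mul, Complex.norm_real, norm_pow, pow_add]
    have h1 : ‖1 + ‖ξ‖‖ = 1 + ‖ξ‖ := Real.norm_of_nonneg (by positivity)
    rw [h1]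
    calc (1 + ‖ξ‖) ^ M * (‖g ξ‖ * ‖c ξ‖) ≤ (1 + ‖ξ‖) ^ M * (C * (1 + ‖ξ‖) ^ N * ‖c ξ‖) := by
          gcongr; exact hb ξ
      _ = _ := by ring

/-- A sequence of functions `h m ξ t`, each of which is the `t`-derivative of the one before,
measurable in `ξ` and of polynomial growth in `ξ`, uniformly in `t`. -/
structure IsJet {d : ℕ} (h : ℕ → E d → ℝ → ℂ) : Prop where
  hasDerivAt : ∀ m ξ t, HasDerivAt (h m ξ) (h (m + 1) ξ t) t
  measurable : ∀ m t, Measurable fun ξ => h m ξ t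
  bound : ∀ m, ∃ C : ℝ, ∃ N : ℕ, ∀ ξ t, ‖h m ξ t‖ ≤ C * (1 + ‖ξ‖) ^ N

theorem IsJet.shift {d : ℕ} {h : ℕ → E d → ℝ → ℂ} (hh : IsJet h) :
    IsJet fun m => h (m + 1) :=
  ⟨fun m => hh.hasDerivAt (m + 1), fun m => hh.measurable (m + 1), fun m => hh.bound (m + 1)⟩

/-- The integral `∫ e^{i ξ·x̃} h₀(ξ, xₙ) c(ξ) dξ`. -/
def jetIntegral {d : ℕ} (h : ℕ → E d → ℝ → ℂ) (c : E d → ℂ) (x : E (d + 1)) : ℂ :=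
  ∫ ξ, phase ξ (horiz x) * h 0 ξ (height x) * c ξ

theorem IsJet.integrable {d : ℕ} {h : ℕ → E d → ℝ → ℂ} (hh : IsJet h) {c : E d → ℂ}
    (hc : RapidlyIntegrable c) (x : E (d + 1)) :
    Integrable fun ξ => phase ξ (horiz x) * h 0 ξ (height x) * c ξ := by
  obtain ⟨C, N, hb⟩ := hh.bound 0
  refine (hc.mul_of_le (g := fun ξ => phase ξ (horiz x) * h 0 ξ (height x)) (C := C) (N := N)
    ?_ fun ξ => ?_).integrable
  · refine Measurable.mul ?_ (hh.measurable 0 _)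
    exact (continuous_phase.comp (by fun_prop : Continuous fun ξ : E d => (ξ, horiz x))).measurable
  · rw [norm_mul, norm_phase, one_mul]; exact hb ξ _

/-- The differential of a function of `x` from the partial derivatives `a j`, `b`. -/
def jetDifferential {d : ℕ} (a : Fin d → ℂ) (b : ℂ) : E (d + 1) →L[ℝ] ℂ :=
  (∑ j, (coordL (Fin.castSucc j)).smulRight (a j)) +
    (coordL (Fin.last d)).smulRight b

theorem jetDifferential_apply {d : ℕ} (a : Fin d → ℂ) (b : ℂ) (v : E (d + 1)) :
    jetDifferential a b v = (∑ j, (horiz v j : ℂ) * a j) + (height v : ℂ) * b := by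
  simp [jetDifferential, horiz, height, coordL_apply]

theorem norm_jetDifferential_le {d : ℕ} (a : Fin d → ℂ) (b : ℂ) :
    ‖jetDifferential a b‖ ≤ (∑ j, ‖a j‖) + ‖b‖ := by
  have hp : ∀ i : Fin (d + 1), ‖coordL i‖ ≤ 1 := fun i =>
    ContinuousLinearMap.opNorm_le_bound _ zero_le_one fun v => by
      rw [one_mul]; exact PiLp.norm_apply_le v i
  unfold jetDifferential
  refine (norm_add_le _ _).trans (add_le_add ((norm_sum_le _ _).trans ?_) ?_)
  · refine Finset.sum_le_sum fun j _ => ?_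
    rw [ContinuousLinearMap.norm_smulRight_apply]
    exact mul_le_of_le_one_left (norm_nonneg _) (hp _)
  · rw [ContinuousLinearMap.norm_smulRight_apply]
    exact mul_le_of_le_one_left (norm_nonneg _) (hp _)

theorem integral_jetDifferential {d : ℕ} {a : E d → Fin d → ℂ} {b : E d → ℂ}
    (ha : ∀ j, Integrable fun ξ => a ξ j) (hb : Integrable b) :
    Integrable (fun ξ => jetDifferential (a ξ) (b ξ)) ∧
    ∫ ξ, jetDifferential (a ξ) (b ξ) = jetDifferential (fun j => ∫ ξ, a ξ j) (∫ ξ, b ξ) := by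
  have hs : ∀ (p : E (d + 1) →L[ℝ] ℝ) (f : E d → ℂ), Integrable f →
      Integrable (fun ξ => p.smulRight (f ξ)) ∧
      ∫ ξ, p.smulRight (f ξ) = p.smulRight (∫ ξ, f ξ) := fun p f hf =>
    ⟨(ContinuousLinearMap.smulRightL ℝ (E (d + 1)) ℂ p).integrable_comp hf,
      (ContinuousLinearMap.smulRightL ℝ (E (d + 1)) ℂ p).integral_comp_comm hf⟩
  unfold jetDifferential
  have h0 : ∀ j ∈ (Finset.univ : Finset (Fin d)),
      Integrable fun ξ => (coordL (Fin.castSucc j)).smulRight (a ξ j) := fun j _ =>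
    (hs (coordL (Fin.castSucc j)) _ (ha j)).1
  have h1 : Integrable fun ξ => ∑ j, (coordL (Fin.castSucc j)).smulRight (a ξ j) := by
    exact integrable_finsetSum (ε' := E (d + 1) →L[ℝ] ℂ) Finset.univ h0
  have h2 := hs (coordL (Fin.last d)) _ hb
  have h3 : Integrable (fun ξ => (∑ j, (coordL (Fin.castSucc j)).smulRight (a ξ j)) +
      (coordL (Fin.last d)).smulRight (b ξ)) :=
    Integrable.add (ε' := E (d + 1) →L[ℝ] ℂ) h1 h2.1
  refine ⟨h3, ?_⟩
  rw [integral_add h1 h2.1, h2.2, integral_finsetSum _ h0]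
  simp_rw [fun j => (hs (coordL (Fin.castSucc j)) _ (ha j)).2]

theorem RapidlyIntegrable.coord_mul {d : ℕ} {c : E d → ℂ} (hc : RapidlyIntegrable c) (j : Fin d) :
    RapidlyIntegrable fun ξ => (Complex.I * (ξ j : ℂ)) * c ξ := by
  refine hc.mul_of_le (C := 1) (N := 1) ?_ fun ξ => ?_
  · exact Continuous.measurable (by fun_prop)
  · have := PiLp.norm_apply_le ξ j
    simp only [norm_mul, Complex.norm_I, Complex.norm_real, one_mul, pow_one]
    linarith

theorem hasFDerivAt_jetIntegral {d : ℕ} {h : ℕ → E d → ℝ → ℂ} (hh : IsJet h) {c : E d → ℂ}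
    (hc : RapidlyIntegrable c) (x : E (d + 1)) :
    HasFDerivAt (jetIntegral h c)
      (jetDifferential (fun j => jetIntegral h (fun ξ => (Complex.I * (ξ j : ℂ)) * c ξ) x)
        (jetIntegral (fun m => h (m + 1)) c x)) x := by
  have hint := integral_jetDifferential
    (a := fun ξ j => phase ξ (horiz x) * h 0 ξ (height x) * ((Complex.I * (ξ j : ℂ)) * c ξ))
    (b := fun ξ => phase ξ (horiz x) * h 1 ξ (height x) * c ξ)
    (fun j => hh.integrable (hc.coord_mul j) x) (hh.shift.integrable hc x)
  unfold jetIntegral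
  refine HasFDerivAt.congr_fderiv ?_ hint.2
  obtain ⟨C₀, N₀, hb₀⟩ := hh.bound 0
  obtain ⟨C₁, N₁, hb₁⟩ := hh.bound 1
  refine hasFDerivAt_integral_of_dominated_of_fderiv_le (s := univ)
    (F := fun x ξ => phase ξ (horiz x) * h 0 ξ (height x) * c ξ)
    (F' := fun x ξ => jetDifferential
      (fun j => phase ξ (horiz x) * h 0 ξ (height x) * ((Complex.I * (ξ j : ℂ)) * c ξ))
      (phase ξ (horiz x) * h 1 ξ (height x) * c ξ))
    (bound := fun ξ => (∑ j : Fin d, C₀ * ‖(((1 + ‖ξ‖) ^ N₀ : ℝ) : ℂ) *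
      ((Complex.I * (ξ j : ℂ)) * c ξ)‖) + C₁ * ‖(((1 + ‖ξ‖) ^ N₁ : ℝ) : ℂ) * c ξ‖)
    univ_mem (Eventually.of_forall fun y => (hh.integrable hc y).1) (hh.integrable hc x)
    hint.1.1 ?_ ?_ ?_
  · refine Eventually.of_forall fun ξ y _ => (norm_jetDifferential_le _ _).trans ?_
    have h1 : ‖1 + ‖ξ‖‖ = 1 + ‖ξ‖ := Real.norm_of_nonneg (by positivity)
    refine add_le_add (Finset.sum_le_sum fun j _ => ?_) ?_
    · rw [norm_mul, norm_mul, norm_phase, one_mul, norm_mul (((1 + ‖ξ‖) ^ N₀ : ℝ) : ℂ),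
        Complex.norm_real, norm_pow, h1, ← mul_assoc]
      gcongr
      exact hb₀ ξ _
    · rw [norm_mul, norm_mul, norm_phase, one_mul, norm_mul (((1 + ‖ξ‖) ^ N₁ : ℝ) : ℂ),
        Complex.norm_real, norm_pow, h1, ← mul_assoc]
      gcongr
      exact hb₁ ξ _
  · exact (integrable_finsetSum _ fun j _ => ((hc.coord_mul j) N₀).norm.const_mul C₀).add
      ((hc N₁).norm.const_mul C₁)
  · refine Eventually.of_forall fun ξ y _ => ?_
    have hp : HasFDerivAt (fun x : E (d + 1) => phase ξ (horiz x))
        (jetDifferential (fun j => phase ξ (horiz y) * (Complex.I * (ξ j : ℂ))) 0) y := by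
      have hlin : (fun x : E (d + 1) => Complex.I * (inner ℝ ξ (horiz x) : ℝ)) =
          fun x => jetDifferential (fun j => Complex.I * (ξ j : ℂ)) 0 x := by
        ext x
        rw [jetDifferential_apply, PiLp.inner_apply]
        simp only [RCLike.inner_apply, conj_trivial, Complex.ofReal_sum, Complex.ofReal_mul,
          Finset.mul_sum, mul_zero, add_zero]
        exact Finset.sum_congr rfl fun j _ => by ring
      have h1 : HasFDerivAt (fun x : E (d + 1) => Complex.I * (inner ℝ ξ (horiz x) : ℝ))
          (jetDifferential (fun j => Complex.I * (ξ j : ℂ)) 0) y := by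
        rw [hlin]; exact ContinuousLinearMap.hasFDerivAt _
      refine h1.cexp.congr_fderiv ?_
      ext v
      simp only [smul_apply, jetDifferential_apply, smul_eq_mul, mul_zero,
        add_zero, phase, Finset.mul_sum]
      exact Finset.sum_congr rfl fun j _ => by ring
    have hq : HasFDerivAt (fun x : E (d + 1) => h 0 ξ (height x))
        (jetDifferential (fun _ => 0) (h 1 ξ (height y))) y := by
      have h1 : HasFDerivAt (height : E (d + 1) → ℝ)
          (coordL (Fin.last d)) y :=
        (coordL (Fin.last d)).hasFDerivAt
      refine ((hh.hasDerivAt 0 ξ (height y)).hasFDerivAt.comp y h1).congr_fderiv ?_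
      ext v
      simp [jetDifferential_apply, height, coordL_apply]
    refine ((hp.mul hq).mul_const (c ξ)).congr_fderiv ?_
    ext v
    simp only [add_apply, smul_apply,
      jetDifferential_apply, smul_eq_mul, mul_zero, add_zero, Finset.mul_sum,
      Finset.sum_const_zero, zero_add, mul_add]
    rw [add_comm]
    congr 1
    · exact Finset.sum_congr rfl fun j _ => by ring
    · ring

/-- The partial derivatives of a jet integral are jet integrals, of the shifted jet or of another
rapidly integrable density, so that smoothness follows by induction. -/
theorem contDiff_jetIntegral {d : ℕ} {h : ℕ → E d → ℝ → ℂ} (hh : IsJet h) {c : E d → ℂ}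
    (hc : RapidlyIntegrable c) : ContDiff ℝ ∞ (jetIntegral h c) := by
  refine contDiff_infty.2 fun n => ?_
  induction n generalizing h c with
  | zero =>
    exact contDiff_zero.2 (continuous_iff_continuousAt.2 fun x =>
      (hasFDerivAt_jetIntegral hh hc x).continuousAt)
  | succ n ih =>
    refine (contDiff_succ_iff_hasFDerivAt (n := n)).2 ⟨_, ?_, hasFDerivAt_jetIntegral hh hc⟩
    unfold jetDifferential
    refine ContDiff.add (ContDiff.sum fun j _ => ?_) ?_
    · exact (contDiff_const (c := coordL (Fin.castSucc j))).smulRight (ih hh (hc.coord_mul j))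
    · exact (contDiff_const (c := coordL (Fin.last d))).smulRight (ih hh.shift hc)

/-! ### The symbol and its square root singularity -/

theorem Z_of_le {d : ℕ} {k : ℝ} {ξ : E d} (h : ‖ξ‖ ≤ k) :
    Z k ξ = (Real.sqrt (k ^ 2 - ‖ξ‖ ^ 2) : ℂ) := if_pos h

theorem Z_of_lt {d : ℕ} {k : ℝ} {ξ : E d} (h : k < ‖ξ‖) :
    Z k ξ = Complex.I * (Real.sqrt (‖ξ‖ ^ 2 - k ^ 2) : ℂ) := if_neg (not_le.2 h)

theorem measurable_Z {d : ℕ} (k : ℝ) : Measurable (Z k : E d → ℂ) := by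
  unfold Z
  exact Measurable.ite (measurableSet_le (by fun_prop) (by fun_prop)) (by fun_prop) (by fun_prop)

theorem norm_Z {d : ℕ} {k : ℝ} (hk : 0 < k) (ξ : E d) :
    ‖Z k ξ‖ = Real.sqrt |k ^ 2 - ‖ξ‖ ^ 2| := by
  rcases le_or_gt ‖ξ‖ k with h | h
  · rw [Z_of_le h, Complex.norm_real, Real.norm_of_nonneg (Real.sqrt_nonneg _), abs_of_nonneg]
    nlinarith [norm_nonneg ξ]
  · rw [Z_of_lt h, norm_mul, Complex.norm_I, one_mul, Complex.norm_real,
      Real.norm_of_nonneg (Real.sqrt_nonneg _), abs_of_nonpos (by nlinarith), neg_sub]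

theorem norm_Z_le {d : ℕ} {k : ℝ} (hk : 0 < k) (ξ : E d) :
    ‖Z k ξ‖ ≤ (1 + k) * (1 + ‖ξ‖) ^ 1 := by
  have h0 := norm_nonneg ξ
  rw [norm_Z hk, pow_one]
  refine Real.sqrt_le_iff.2 ⟨by positivity, abs_le.2 ⟨?_, ?_⟩⟩ <;>
    nlinarith [mul_nonneg hk.le h0, mul_nonneg (mul_nonneg hk.le h0) h0,
      mul_nonneg (mul_nonneg hk.le h0) hk.le]

theorem integrable_inv_sqrt_near (k : ℝ) :
    Integrable fun y : ℝ => (Metric.ball (0 : ℝ) 1).indicator (fun x => (Real.sqrt |x|)⁻¹) (y - k) := by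
  refine Integrable.comp_sub_right (f := (Metric.ball (0 : ℝ) 1).indicator
    fun x => (Real.sqrt |x|)⁻¹) ?_ k
  rw [integrable_indicator_iff Metric.isOpen_ball.measurableSet]
  refine integrableOn_ball_of_norm_le_rpow (C := 1) (α := 1 / 2) (by simp) (by norm_num) ?_ ?_
  · refine Eventually.of_forall fun x => ?_
    rw [Real.norm_of_nonneg (by positivity), one_mul, Real.rpow_neg (norm_nonneg x),
      ← Real.sqrt_eq_rpow, Real.norm_eq_abs]
  · exact Measurable.aestronglyMeasurable (by fun_prop)

/-- In polar coordinates the singularity of `1 / Z` is that of `|r - k|^{-1/2}` at `r = k`. The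
weight is needed because `1 / Z` decays only like `1 / |ξ|`. -/
theorem integrable_inv_Z {d : ℕ} (hd : 0 < d) {k : ℝ} (hk : 0 < k) :
    Integrable fun ξ : E d => ((1 + ‖ξ‖) ^ (d + 2))⁻¹ * ‖Z k ξ‖⁻¹ := by
  have : Nontrivial (E d) := Module.nontrivial_of_finrank_pos (R := ℝ) (by simpa using hd)
  simp_rw [norm_Z hk]
  rw [integrable_fun_norm_addHaar (μ := volume) (f := fun r : ℝ =>
    ((1 + r) ^ (d + 2))⁻¹ * (Real.sqrt |k ^ 2 - r ^ 2|)⁻¹)]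
  have hbig : Integrable fun y : ℝ => (Real.sqrt k)⁻¹ *
      ((Metric.ball (0 : ℝ) 1).indicator (fun x => (Real.sqrt |x|)⁻¹) (y - k) +
        (1 + ‖y‖) ^ (-2 : ℝ)) :=
    ((integrable_inv_sqrt_near k).add (integrable_one_add_norm (by norm_num))).const_mul _
  refine hbig.integrableOn.mono' (Measurable.aestronglyMeasurable (by fun_prop)) ?_
  refine (ae_restrict_iff' measurableSet_Ioi).2 (Eventually.of_forall fun y (hy : 0 < y) => ?_)
  have hfac : Real.sqrt |k ^ 2 - y ^ 2| = Real.sqrt (k + y) * Real.sqrt |y - k| := by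
    rw [← Real.sqrt_mul (by positivity), ← abs_of_pos (show 0 < k + y by positivity), ← abs_mul,
      ← abs_neg]
    congr 2; ring
  have hsk : (Real.sqrt (k + y))⁻¹ ≤ (Real.sqrt k)⁻¹ :=
    inv_anti₀ (Real.sqrt_pos.2 hk) (Real.sqrt_le_sqrt (by linarith))
  have hpow : y ^ (d - 1) * ((1 + y) ^ (d + 2))⁻¹ ≤ (1 + y) ^ (-2 : ℝ) := by
    have h1 : (1 + y) ^ (-2 : ℝ) = ((1 + y) ^ 2)⁻¹ := by
      rw [Real.rpow_neg (by positivity)]; norm_cast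
    rw [h1, pow_add, mul_inv, ← mul_assoc]
    refine mul_le_of_le_one_left (by positivity) ?_
    rw [← div_eq_mul_inv, div_le_one (by positivity)]
    calc y ^ (d - 1) ≤ (1 + y) ^ (d - 1) := by gcongr; linarith
      _ ≤ (1 + y) ^ d := pow_le_pow_right₀ (by linarith) (by omega)
  have hle1 : (1 + y) ^ (-2 : ℝ) ≤ 1 :=
    Real.rpow_le_one_of_one_le_of_nonpos (by linarith) (by norm_num)
  rw [finrank_euclideanSpace_fin, smul_eq_mul, Real.norm_of_nonneg (by positivity), hfac, mul_inv,
    Real.norm_of_nonneg hy.le]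
  have hrew : y ^ (d - 1) * (((1 + y) ^ (d + 2))⁻¹ * ((Real.sqrt (k + y))⁻¹ *
      (Real.sqrt |y - k|)⁻¹)) = (Real.sqrt (k + y))⁻¹ *
      ((y ^ (d - 1) * ((1 + y) ^ (d + 2))⁻¹) * (Real.sqrt |y - k|)⁻¹) := by ring
  rw [hrew]
  refine mul_le_mul hsk ?_ (by positivity) (by positivity)
  by_cases hb : y - k ∈ Metric.ball (0 : ℝ) 1
  · rw [indicator_of_mem hb]
    have h2 : 0 ≤ (1 + y) ^ (-2 : ℝ) := by positivity
    have := mul_le_of_le_one_left (inv_nonneg.2 (Real.sqrt_nonneg |y - k|)) (hpow.trans hle1)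
    linarith
  · rw [indicator_of_notMem hb, zero_add]
    have h1 : 1 ≤ |y - k| := by
      rw [mem_ball_zero_iff, not_lt] at hb; exact hb
    refine (mul_le_of_le_one_right (by positivity) (inv_le_one_of_one_le₀ ?_)).trans hpow
    exact Real.one_le_sqrt.2 h1

/-- Continuity together with decay faster than every power. -/
structure RapidlyDecreasing {d : ℕ} (c : E d → ℂ) : Prop where
  continuous : Continuous c
  decay : ∀ N : ℕ, ∃ C : ℝ, ∀ ξ, (1 + ‖ξ‖) ^ N * ‖c ξ‖ ≤ C

theorem RapidlyDecreasing.rapidlyIntegrable {d : ℕ} {c : E d → ℂ} (hc : RapidlyDecreasing c) :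
    RapidlyIntegrable c := by
  intro N
  obtain ⟨C, hC⟩ := hc.decay (N + (d + 1))
  have h1 : Integrable fun ξ : E d => (1 + ‖ξ‖) ^ (-((d + 1 : ℕ) : ℝ)) :=
    integrable_one_add_norm (by simp)
  refine (h1.const_mul C).mono' ?_ (Eventually.of_forall fun ξ => ?_)
  · have := hc.continuous
    exact Continuous.aestronglyMeasurable (by fun_prop)
  · have h0 : 0 < 1 + ‖ξ‖ := by positivity
    rw [norm_mul, Complex.norm_real, Real.norm_of_nonneg (by positivity), Real.rpow_neg h0.le,
      Real.rpow_natCast, ← div_eq_mul_inv, le_div_iff₀ (by positivity)]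
    refine le_trans (le_of_eq ?_) (hC ξ)
    rw [pow_add]; ring

theorem RapidlyDecreasing.div_Z {d : ℕ} (hd : 0 < d) {k : ℝ} (hk : 0 < k) {c : E d → ℂ}
    (hc : RapidlyDecreasing c) : RapidlyIntegrable fun ξ => c ξ / Z k ξ := by
  intro N
  obtain ⟨C, hC⟩ := hc.decay (N + (d + 2))
  refine ((integrable_inv_Z hd hk).const_mul C).mono' ?_ (Eventually.of_forall fun ξ => ?_)
  · have := hc.continuous.measurable
    have := measurable_Z (d := d) k
    exact Measurable.aestronglyMeasurable (by fun_prop)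
  · rw [norm_mul, Complex.norm_real, Real.norm_of_nonneg (by positivity), norm_div,
      div_eq_mul_inv, ← mul_assoc, ← mul_assoc]
    refine mul_le_mul_of_nonneg_right ?_ (inv_nonneg.2 (norm_nonneg _))
    rw [← div_eq_mul_inv, le_div_iff₀ (by positivity)]
    refine le_trans (le_of_eq ?_) (hC ξ)
    rw [pow_add]; ring

theorem hat_eq_fourier {d : ℕ} (φ : E d → ℂ) (ξ : E d) :
    hat φ ξ = 1 / (((2 * Real.pi) ^ ((d : ℝ) / 2) : ℝ) : ℂ) *
      FourierTransform.fourier φ ((2 * Real.pi)⁻¹ • ξ) := by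
  rw [hat, Real.fourier_eq']
  congr 2
  ext y
  rw [smul_eq_mul, real_inner_smul_right, real_inner_comm]
  congr 2
  have : (Real.pi : ℂ) ≠ 0 := by exact_mod_cast Real.pi_ne_zero
  push_cast
  field_simp

theorem rapidlyDecreasing_hat {d : ℕ} {φ : E d → ℂ} (hs : HasCompactSupport φ)
    (hφ : ContDiff ℝ ∞ φ) : RapidlyDecreasing (hat φ) := by
  set f : SchwartzMap (E d) ℂ := FourierTransform.fourier (hs.toSchwartzMap hφ) with hf
  have hval : hat φ = fun ξ => 1 / (((2 * Real.pi) ^ ((d : ℝ) / 2) : ℝ) : ℂ) *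
      f ((2 * Real.pi)⁻¹ • ξ) := by
    ext ξ
    rw [hat_eq_fourier, hf, SchwartzMap.fourier_coe]
    rfl
  refine ⟨?_, fun N => ?_⟩
  · rw [hval]
    have := f.continuous
    fun_prop
  · set S := 2 ^ N * (Finset.Iic (N, 0)).sup (fun m => SchwartzMap.seminorm ℝ m.1 m.2) f
    set A := ‖1 / (((2 * Real.pi) ^ ((d : ℝ) / 2) : ℝ) : ℂ)‖
    refine ⟨(2 * Real.pi) ^ N * (A * S), fun ξ => ?_⟩
    have h1 := SchwartzMap.one_add_le_sup_seminorm_apply (𝕜 := ℝ) (m := (N, 0)) (k := N) (n := 0)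
      le_rfl le_rfl f ((2 * Real.pi)⁻¹ • ξ)
    rw [norm_iteratedFDeriv_zero] at h1
    have h2 : (1 + ‖ξ‖) ^ N ≤ (2 * Real.pi) ^ N * (1 + ‖(2 * Real.pi)⁻¹ • ξ‖) ^ N := by
      rw [← mul_pow]
      gcongr
      have hpi := Real.pi_gt_three
      rw [norm_smul, norm_inv, Real.norm_of_nonneg (by positivity), mul_add, ← mul_assoc,
        mul_inv_cancel₀ (by positivity)]
      linarith
    rw [hval]
    simp only [norm_mul]
    calc (1 + ‖ξ‖) ^ N * (A * ‖f ((2 * Real.pi)⁻¹ • ξ)‖)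
        ≤ (2 * Real.pi) ^ N * (1 + ‖(2 * Real.pi)⁻¹ • ξ‖) ^ N *
          (A * ‖f ((2 * Real.pi)⁻¹ • ξ)‖) := by gcongr
      _ = (2 * Real.pi) ^ N * (A * ((1 + ‖(2 * Real.pi)⁻¹ • ξ‖) ^ N *
          ‖f ((2 * Real.pi)⁻¹ • ξ)‖)) := by ring
      _ ≤ _ := by gcongr

/-! ### Extending the propagator smoothly through the plane -/

/-- A smooth function with bounded derivatives, equal to `e^{-s}` for `s ≥ 0` and vanishing for
`s ≤ -1`. -/
def truncExp (s : ℝ) : ℂ := Complex.exp (-(s : ℂ)) * (Real.smoothTransition (s + 1) : ℂ)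

theorem contDiff_truncExp : ContDiff ℝ ∞ truncExp := by
  unfold truncExp
  refine ContDiff.mul ?_ ?_
  · exact (Complex.ofRealCLM.contDiff.neg).cexp
  · exact Complex.ofRealCLM.contDiff.comp
      (Real.smoothTransition.contDiff.comp (contDiff_id.add contDiff_const))

theorem truncExp_of_nonneg {s : ℝ} (hs : 0 ≤ s) : truncExp s = Complex.exp (-(s : ℂ)) := by
  rw [truncExp, Real.smoothTransition.one_of_one_le (by linarith)]; simp

theorem truncExp_of_le {s : ℝ} (hs : s ≤ -1) : truncExp s = 0 := by
  rw [truncExp, Real.smoothTransition.zero_of_nonpos (by linarith)]; simp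

theorem iteratedDeriv_cexp_neg (m : ℕ) :
    iteratedDeriv m (fun s : ℝ => Complex.exp (-(s : ℂ))) =
      fun s : ℝ => (-1) ^ m * Complex.exp (-(s : ℂ)) := by
  induction m with
  | zero => simp
  | succ m ih =>
    rw [iteratedDeriv_succ, ih]
    ext s
    have h1 : HasDerivAt (fun s : ℝ => Complex.exp (-(s : ℂ))) (-Complex.exp (-(s : ℂ))) s := by
      simpa using ((Complex.ofRealCLM.hasDerivAt (x := s)).neg).cexp
    rw [(h1.const_mul ((-1 : ℂ) ^ m)).deriv]
    ring

theorem exists_bound_iteratedDeriv_truncExp (m : ℕ) :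
    ∃ C : ℝ, 1 ≤ C ∧ ∀ s, ‖iteratedDeriv m truncExp s‖ ≤ C := by
  have hc : Continuous (iteratedDeriv m truncExp) :=
    contDiff_truncExp.continuous_iteratedDeriv m (by exact_mod_cast le_top)
  obtain ⟨C, hC⟩ := (isCompact_Icc (a := (-1 : ℝ)) (b := 0)).exists_bound_of_continuousOn
    hc.continuousOn
  refine ⟨max C 1, le_max_right _ _, fun s => ?_⟩
  rcases lt_or_ge s (-1) with h1 | h1
  · have : truncExp =ᶠ[𝓝 s] fun _ => 0 := by
      filter_upwards [gt_mem_nhds h1] with y hy using truncExp_of_le hy.le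
    rw [this.iteratedDeriv_eq m]
    have h0 : iteratedDeriv m (fun _ : ℝ => (0 : ℂ)) s = 0 := by
      rw [iteratedDeriv_const]; simp
    rw [h0, norm_zero]; positivity
  rcases le_or_gt s 0 with h2 | h2
  · exact (hC s ⟨h1, h2⟩).trans (le_max_left _ _)
  · have : truncExp =ᶠ[𝓝 s] fun s : ℝ => Complex.exp (-(s : ℂ)) := by
      filter_upwards [lt_mem_nhds h2] with y hy using truncExp_of_nonneg hy.le
    rw [this.iteratedDeriv_eq m, iteratedDeriv_cexp_neg]
    refine le_trans ?_ (le_max_right _ _)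
    rw [norm_mul, norm_pow, norm_neg, norm_one, one_pow, one_mul, Complex.norm_exp]
    simpa using h2.le

/-- The jet of a smooth extension to all `t ∈ ℝ` of the propagator `e^{i t Z(ξ)}`, `t ≥ 0`. On the
evanescent frequencies `|ξ| > k` the exponential is cut off at `t √(|ξ|² - k²) = -1`, because it
would grow without bound as `t → -∞`. -/
def propagatorJet {d : ℕ} (k : ℝ) (m : ℕ) (ξ : E d) (t : ℝ) : ℂ :=
  if ‖ξ‖ ≤ k then (Complex.I * Z k ξ) ^ m * Complex.exp (Complex.I * (t * Z k ξ))
  else ((Real.sqrt (‖ξ‖ ^ 2 - k ^ 2) ^ m : ℝ) : ℂ) *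
    iteratedDeriv m truncExp (t * Real.sqrt (‖ξ‖ ^ 2 - k ^ 2))

theorem isJet_propagatorJet {d : ℕ} {k : ℝ} (hk : 0 < k) :
    IsJet (propagatorJet k : ℕ → E d → ℝ → ℂ) := by
  refine ⟨fun m ξ t => ?_, fun m t => ?_, fun m => ?_⟩
  · unfold propagatorJet
    split_ifs with h
    · have h1 : HasDerivAt (fun t : ℝ => Complex.I * (t * Z k ξ)) (Complex.I * (1 * Z k ξ)) t :=
        ((Complex.ofRealCLM.hasDerivAt (x := t)).mul_const _).const_mul _
      refine (h1.cexp.const_mul ((Complex.I * Z k ξ) ^ m)).congr_deriv ?_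
      rw [pow_succ]; ring
    · set w := Real.sqrt (‖ξ‖ ^ 2 - k ^ 2)
      have h1 : HasDerivAt (iteratedDeriv m truncExp) (iteratedDeriv (m + 1) truncExp (t * w))
          (t * w) := by
        rw [iteratedDeriv_succ]
        exact (contDiff_truncExp.differentiable_iteratedDeriv m
          (by exact_mod_cast ENat.natCast_lt_top m) _).hasDerivAt
      have h2 : HasDerivAt (fun t : ℝ => t * w) w t := by
        simpa using (hasDerivAt_id t).mul_const w
      refine ((h1.scomp t h2).const_mul ((w ^ m : ℝ) : ℂ)).congr_deriv ?_
      rw [Complex.real_smul]; push_cast; ring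
  · unfold propagatorJet
    have hZ := measurable_Z (d := d) k
    have hc : Continuous (iteratedDeriv m truncExp) :=
      contDiff_truncExp.continuous_iteratedDeriv m (by exact_mod_cast le_top)
    refine Measurable.ite (measurableSet_le (by fun_prop) (by fun_prop)) (by fun_prop) ?_
    refine Measurable.mul (by fun_prop) (hc.measurable.comp (by fun_prop))
  · obtain ⟨C, hC1, hC⟩ := exists_bound_iteratedDeriv_truncExp m
    refine ⟨(1 + k) ^ m * C, m, fun ξ t => ?_⟩
    have hZ := norm_Z_le hk ξ
    rw [pow_one] at hZ
    have hZm : ‖Z k ξ‖ ^ m ≤ (1 + k) ^ m * (1 + ‖ξ‖) ^ m := by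
      rw [← mul_pow]; gcongr
    unfold propagatorJet
    split_ifs with h
    · have h1 : ‖Complex.exp (Complex.I * (t * Z k ξ))‖ = 1 := by
        rw [Z_of_le h, mul_comm, ← Complex.ofReal_mul]
        exact Complex.norm_exp_ofReal_mul_I _
      rw [norm_mul, h1, mul_one, norm_pow, norm_mul, Complex.norm_I, one_mul]
      refine hZm.trans ?_
      have : 0 ≤ (1 + k) ^ m * (1 + ‖ξ‖) ^ m := by positivity
      nlinarith
    · have h1 : ‖((Real.sqrt (‖ξ‖ ^ 2 - k ^ 2) ^ m : ℝ) : ℂ)‖ = ‖Z k ξ‖ ^ m := by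
        rw [Z_of_lt (not_le.1 h), norm_mul, Complex.norm_I, one_mul, Complex.norm_real,
          Complex.norm_real, norm_pow]
      rw [norm_mul, h1]
      calc ‖Z k ξ‖ ^ m * ‖iteratedDeriv m truncExp (t * Real.sqrt (‖ξ‖ ^ 2 - k ^ 2))‖
          ≤ (1 + k) ^ m * (1 + ‖ξ‖) ^ m * C := by gcongr; exact hC _
        _ = _ := by ring

theorem propagatorJet_zero {d : ℕ} (k : ℝ) (ξ : E d) {t : ℝ} (ht : 0 ≤ t) :
    propagatorJet k 0 ξ t = Complex.exp (Complex.I * (t * Z k ξ)) := by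
  unfold propagatorJet
  split_ifs with h
  · simp
  · rw [pow_zero, Complex.ofReal_one, one_mul, iteratedDeriv_zero,
      truncExp_of_nonneg (mul_nonneg ht (Real.sqrt_nonneg _)), Z_of_lt (not_le.1 h)]
    congr 1
    push_cast
    linear_combination (-(t : ℂ) * (Real.sqrt (‖ξ‖ ^ 2 - k ^ 2) : ℂ)) * Complex.I_mul_I

theorem propagatorJet_one {d : ℕ} {k : ℝ} (hk : 0 < k) (ξ : E d) {t : ℝ} (ht : 0 ≤ t) :
    propagatorJet k 1 ξ t = Complex.I * Z k ξ * propagatorJet k 0 ξ t := by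
  -- at `t = 0` only the derivative from the right is known, and it determines the derivative
  have h1 := ((isJet_propagatorJet hk).hasDerivAt 0 ξ t).hasDerivWithinAt (s := Ici t)
  have h2 : HasDerivAt (fun t : ℝ => Complex.exp (Complex.I * (t * Z k ξ)))
      (Complex.I * Z k ξ * propagatorJet k 0 ξ t) t := by
    have h3 : HasDerivAt (fun t : ℝ => Complex.I * (t * Z k ξ)) (Complex.I * (1 * Z k ξ)) t :=
      ((Complex.ofRealCLM.hasDerivAt (x := t)).mul_const _).const_mul _
    refine h3.cexp.congr_deriv ?_
    rw [propagatorJet_zero k ξ ht]; ring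
  have h4 : HasDerivWithinAt (propagatorJet k 0 ξ) (Complex.I * Z k ξ * propagatorJet k 0 ξ t)
      (Ici t) t :=
    h2.hasDerivWithinAt.congr (fun τ hτ => propagatorJet_zero k ξ (ht.trans hτ))
      (propagatorJet_zero k ξ ht)
  exact (uniqueDiffWithinAt_Ici t).eq_deriv _ h1 h4

/-! ### The heat kernel and its Laplace transform -/

/-- The substitution `s = c e^u`. -/
theorem integral_Ioi_eq_integral_mul_exp {c : ℝ} (hc : 0 < c) (g : ℝ → ℝ) :
    ∫ s in Ioi (0 : ℝ), g s = ∫ u : ℝ, c * Real.exp u * g (c * Real.exp u) := by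
  have himg : (fun u : ℝ => c * Real.exp u) '' univ = Ioi 0 := by
    ext s
    simp only [image_univ, mem_range, mem_Ioi]
    refine ⟨fun ⟨u, hu⟩ => hu ▸ by positivity, fun hs => ⟨Real.log (s / c), ?_⟩⟩
    rw [Real.exp_log (by positivity)]; field_simp
  rw [← himg, integral_image_eq_integral_abs_deriv_smul MeasurableSet.univ
    (fun u _ => ((Real.hasDerivAt_exp u).const_mul c).hasDerivWithinAt)
    (fun u _ v _ h => Real.exp_injective (mul_left_cancel₀ hc.ne' h)), setIntegral_univ]
  refine integral_congr_ae (Eventually.of_forall fun u => ?_)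
  simp only [smul_eq_mul]
  rw [abs_of_pos (by positivity)]

/-- The substitution `v = sinh (u / 2)` turns this integral into a Gaussian one, since
`cosh u = 1 + 2 sinh² (u / 2)`. -/
theorem integral_cosh_half {z : ℝ} (hz : 0 < z) :
    Integrable (fun u : ℝ => Real.cosh (u / 2) * Real.exp (-(z * Real.cosh u))) ∧
    ∫ u : ℝ, Real.cosh (u / 2) * Real.exp (-(z * Real.cosh u)) =
      2 * (Real.exp (-z) * Real.sqrt (Real.pi / (2 * z))) := by
  have hder : ∀ u ∈ (univ : Set ℝ), HasDerivWithinAt (fun u : ℝ => Real.sinh (u / 2))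
      (Real.cosh (u / 2) * (1 / 2)) univ u := fun u _ =>
    (((hasDerivAt_id u).div_const 2).sinh).hasDerivWithinAt
  have hinj : InjOn (fun u : ℝ => Real.sinh (u / 2)) univ := fun u _ v _ h => by
    have := Real.sinh_injective h; linarith
  have himg : (fun u : ℝ => Real.sinh (u / 2)) '' univ = univ := by
    rw [image_univ]
    exact Function.Surjective.range_eq fun v =>
      let ⟨u, hu⟩ := Real.sinh_surjective v
      ⟨2 * u, by simp only [mul_div_cancel_left₀ u (two_ne_zero' ℝ), hu]⟩
  set g : ℝ → ℝ := fun v => Real.exp (-z) * Real.exp (-(2 * z) * v ^ 2) with hg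
  have hcongr : ∀ u : ℝ, |Real.cosh (u / 2) * (1 / 2)| • g (Real.sinh (u / 2)) =
      (1 / 2) * (Real.cosh (u / 2) * Real.exp (-(z * Real.cosh u))) := by
    intro u
    have h1 : Real.cosh u = 1 + 2 * Real.sinh (u / 2) ^ 2 := by
      have h2 := Real.cosh_two_mul (u / 2)
      rw [mul_div_cancel₀ u (two_ne_zero' ℝ), Real.cosh_sq] at h2
      linarith
    have hpos := Real.cosh_pos (u / 2)
    rw [abs_of_pos (by positivity), hg]
    simp only [smul_eq_mul]
    rw [← Real.exp_add, h1]
    have : -z + -(2 * z) * Real.sinh (u / 2) ^ 2 = -(z * (1 + 2 * Real.sinh (u / 2) ^ 2)) := by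
      ring
    rw [this]; ring
  have hgi : Integrable g := (integrable_exp_neg_mul_sq (by positivity)).const_mul _
  have h1 := (integrableOn_image_iff_integrableOn_abs_deriv_smul MeasurableSet.univ hder hinj g).1
    (by rw [himg]; exact hgi.integrableOn)
  have h2 := integral_image_eq_integral_abs_deriv_smul MeasurableSet.univ hder hinj g
  rw [himg] at h2
  simp only [integrableOn_univ, setIntegral_univ, hcongr] at h1 h2
  refine ⟨?_, ?_⟩
  · have := h1.const_mul 2
    refine this.congr (Eventually.of_forall fun u => ?_)
    ring
  · rw [integral_const_mul, integral_const_mul, integral_gaussian] at h2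
    linarith

theorem integral_exp_half {z : ℝ} (hz : 0 < z) :
    ∫ u : ℝ, Real.exp (u / 2) * Real.exp (-(z * Real.cosh u)) =
      2 * (Real.exp (-z) * Real.sqrt (Real.pi / (2 * z))) ∧
    ∫ u : ℝ, Real.exp (-(u / 2)) * Real.exp (-(z * Real.cosh u)) =
      2 * (Real.exp (-z) * Real.sqrt (Real.pi / (2 * z))) := by
  obtain ⟨hi, hv⟩ := integral_cosh_half hz
  have hneg : ∫ u : ℝ, Real.exp (-(u / 2)) * Real.exp (-(z * Real.cosh u)) =
      ∫ u : ℝ, Real.exp (u / 2) * Real.exp (-(z * Real.cosh u)) := by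
    rw [← integral_neg_eq_self]
    simp only [Real.cosh_neg, neg_div, neg_neg]
  have hcosh : ∀ u : ℝ, Real.exp (u / 2) + Real.exp (-(u / 2)) = 2 * Real.cosh (u / 2) := by
    intro u; rw [Real.cosh_eq]; ring
  have hp : Integrable fun u : ℝ => Real.exp (u / 2) * Real.exp (-(z * Real.cosh u)) := by
    refine (hi.const_mul 2).mono' (Continuous.aestronglyMeasurable (by fun_prop))
      (Eventually.of_forall fun u => ?_)
    rw [Real.norm_of_nonneg (by positivity), ← mul_assoc, ← hcosh]
    gcongr
    linarith [Real.exp_pos (-(u / 2))]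
  have hm : Integrable fun u : ℝ => Real.exp (-(u / 2)) * Real.exp (-(z * Real.cosh u)) := by
    refine (hi.const_mul 2).mono' (Continuous.aestronglyMeasurable (by fun_prop))
      (Eventually.of_forall fun u => ?_)
    rw [Real.norm_of_nonneg (by positivity), ← mul_assoc, ← hcosh]
    gcongr
    linarith [Real.exp_pos (u / 2)]
  have hsum := integral_add hp hm
  have h3 : ∀ u : ℝ, Real.exp (u / 2) * Real.exp (-(z * Real.cosh u)) +
      Real.exp (-(u / 2)) * Real.exp (-(z * Real.cosh u)) =
      2 * (Real.cosh (u / 2) * Real.exp (-(z * Real.cosh u))) := by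
    intro u; rw [← add_mul, hcosh]; ring
  simp only [h3] at hsum
  rw [integral_const_mul, hv, hneg] at hsum
  exact ⟨by linarith, by linarith⟩

/-- The exponent of the heat kernel becomes a hyperbolic cosine under `s = (t / 2κ) e^u`. -/
theorem heat_exponent {κ t : ℝ} (hκ : 0 < κ) (ht : 0 < t) (u : ℝ) :
    -(κ ^ 2 * (t / (2 * κ) * Real.exp u)) - t ^ 2 / (4 * (t / (2 * κ) * Real.exp u)) =
      -(κ * t * Real.cosh u) := by
  rw [Real.cosh_eq, Real.exp_neg]
  have := Real.exp_pos u
  field_simp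
  ring

theorem sqrt_mul_exp {c : ℝ} (hc : 0 < c) (u : ℝ) :
    Real.sqrt (c * Real.exp u) = Real.sqrt c * Real.exp (u / 2) := by
  rw [Real.sqrt_mul hc.le, Real.exp_half]

theorem sqrt_aux {κ t : ℝ} (hκ : 0 < κ) (ht : 0 < t) :
    Real.sqrt (t / (2 * κ)) * (2 * Real.sqrt (Real.pi / (2 * (κ * t)))) = Real.sqrt Real.pi / κ := by
  rw [mul_left_comm, ← Real.sqrt_mul (by positivity)]
  have : t / (2 * κ) * (Real.pi / (2 * (κ * t))) = Real.pi / (2 * κ) ^ 2 := by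
    field_simp
  rw [this, Real.sqrt_div Real.pi_pos.le, Real.sqrt_sq (by positivity)]
  field_simp

theorem integral_heat_half {κ t : ℝ} (hκ : 0 < κ) (ht : 0 < t) :
    ∫ s in Ioi (0 : ℝ), (Real.sqrt s)⁻¹ * Real.exp (-(κ ^ 2 * s) - t ^ 2 / (4 * s)) =
      Real.sqrt Real.pi / κ * Real.exp (-(κ * t)) := by
  have hc : 0 < t / (2 * κ) := by positivity
  rw [integral_Ioi_eq_integral_mul_exp hc]
  have : ∀ u : ℝ, t / (2 * κ) * Real.exp u * ((Real.sqrt (t / (2 * κ) * Real.exp u))⁻¹ *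
      Real.exp (-(κ ^ 2 * (t / (2 * κ) * Real.exp u)) - t ^ 2 / (4 * (t / (2 * κ) * Real.exp u))))
      = Real.sqrt (t / (2 * κ)) * (Real.exp (u / 2) * Real.exp (-(κ * t * Real.cosh u))) := by
    intro u
    rw [heat_exponent hκ ht, sqrt_mul_exp hc]
    have h1 : Real.exp u = Real.exp (u / 2) * Real.exp (u / 2) := by
      rw [← Real.exp_add]; ring_nf
    have h2 : t / (2 * κ) = Real.sqrt (t / (2 * κ)) * Real.sqrt (t / (2 * κ)) :=
      (Real.mul_self_sqrt hc.le).symm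
    have h3 := Real.sqrt_pos.2 hc
    have h4 := Real.exp_pos (u / 2)
    generalize Real.sqrt (t / (2 * κ)) = q at *
    rw [h1, h2]
    field_simp
  simp only [this]
  rw [integral_const_mul, (integral_exp_half (mul_pos hκ ht)).1, ← sqrt_aux hκ ht]
  ring

theorem integral_heat_three_halves {κ t : ℝ} (hκ : 0 < κ) (ht : 0 < t) :
    ∫ s in Ioi (0 : ℝ), (Real.sqrt s)⁻¹ * s⁻¹ * Real.exp (-(κ ^ 2 * s) - t ^ 2 / (4 * s)) =
      2 * Real.sqrt Real.pi / t * Real.exp (-(κ * t)) := by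
  have hc : 0 < t / (2 * κ) := by positivity
  rw [integral_Ioi_eq_integral_mul_exp hc]
  have : ∀ u : ℝ, t / (2 * κ) * Real.exp u * ((Real.sqrt (t / (2 * κ) * Real.exp u))⁻¹ *
      (t / (2 * κ) * Real.exp u)⁻¹ *
      Real.exp (-(κ ^ 2 * (t / (2 * κ) * Real.exp u)) - t ^ 2 / (4 * (t / (2 * κ) * Real.exp u))))
      = (Real.sqrt (t / (2 * κ)))⁻¹ *
        (Real.exp (-(u / 2)) * Real.exp (-(κ * t * Real.cosh u))) := by
    intro u
    rw [heat_exponent hκ ht, sqrt_mul_exp hc, Real.exp_neg (u / 2)]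
    have h3 := Real.sqrt_pos.2 hc
    have h4 := Real.exp_pos (u / 2)
    have h5 := Real.exp_pos u
    field_simp
  simp only [this]
  rw [integral_const_mul, (integral_exp_half (mul_pos hκ ht)).2]
  have h1 := sqrt_aux hκ ht
  have h2 := Real.mul_self_sqrt hc.le
  have h3 := Real.sqrt_pos.2 hc
  have h6 : 2 * Real.sqrt (Real.pi / (2 * (κ * t))) =
      (Real.sqrt (t / (2 * κ)))⁻¹ * (Real.sqrt Real.pi / κ) := by
    rw [← h1]; field_simp
  calc (Real.sqrt (t / (2 * κ)))⁻¹ * (2 * (Real.exp (-(κ * t)) *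
        Real.sqrt (Real.pi / (2 * (κ * t)))))
      = (Real.sqrt (t / (2 * κ)))⁻¹ * (2 * Real.sqrt (Real.pi / (2 * (κ * t)))) *
        Real.exp (-(κ * t)) := by ring
    _ = (Real.sqrt (t / (2 * κ)) * Real.sqrt (t / (2 * κ)))⁻¹ * (Real.sqrt Real.pi / κ) *
        Real.exp (-(κ * t)) := by rw [h6, mul_inv]; ring
    _ = _ := by rw [h2]; field_simp

theorem integral_heat_one {κ t : ℝ} (hκ : 0 < κ) (ht : 0 < t) :
    ∫ s in Ioi (0 : ℝ), s⁻¹ * Real.exp (-(κ ^ 2 * s) - t ^ 2 / (4 * s)) =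
      2 * ∫ u in Ioi (0 : ℝ), Real.exp (-(κ * t * Real.cosh u)) := by
  have hc : 0 < t / (2 * κ) := by positivity
  rw [integral_Ioi_eq_integral_mul_exp hc]
  have : ∀ u : ℝ, t / (2 * κ) * Real.exp u * ((t / (2 * κ) * Real.exp u)⁻¹ *
      Real.exp (-(κ ^ 2 * (t / (2 * κ) * Real.exp u)) - t ^ 2 / (4 * (t / (2 * κ) * Real.exp u))))
      = Real.exp (-(κ * t * Real.cosh |u|)) := by
    intro u
    rw [heat_exponent hκ ht, Real.cosh_abs, ← mul_assoc, mul_inv_cancel₀ (by positivity), one_mul]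
  simp only [this]
  exact integral_comp_abs (f := fun u => Real.exp (-(κ * t * Real.cosh u)))

theorem integrable_heat_half {κ t : ℝ} (hκ : 0 < κ) (ht : 0 < t) :
    IntegrableOn (fun s => (Real.sqrt s)⁻¹ * Real.exp (-(κ ^ 2 * s) - t ^ 2 / (4 * s))) (Ioi 0) :=
  Integrable.of_integral_ne_zero (by rw [integral_heat_half hκ ht]; positivity)

theorem integrable_heat_three_halves {κ t : ℝ} (hκ : 0 < κ) (ht : 0 < t) :
    IntegrableOn (fun s => (Real.sqrt s)⁻¹ * s⁻¹ * Real.exp (-(κ ^ 2 * s) - t ^ 2 / (4 * s)))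
      (Ioi 0) :=
  Integrable.of_integral_ne_zero (by rw [integral_heat_three_halves hκ ht]; positivity)

theorem integrable_heat_one {κ t : ℝ} (hκ : 0 < κ) (ht : 0 < t) :
    IntegrableOn (fun s => s⁻¹ * Real.exp (-(κ ^ 2 * s) - t ^ 2 / (4 * s))) (Ioi 0) := by
  refine ((integrable_heat_half hκ ht).add (integrable_heat_three_halves hκ ht)).mono'
    (Measurable.aestronglyMeasurable (by fun_prop)) ?_
  refine (ae_restrict_iff' measurableSet_Ioi).2 (Eventually.of_forall fun s (hs : 0 < s) => ?_)
  rw [Real.norm_of_nonneg (by positivity), Pi.add_apply, ← add_mul]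
  gcongr
  have h1 : s⁻¹ = (Real.sqrt s)⁻¹ * (Real.sqrt s)⁻¹ := by
    rw [← mul_inv, Real.mul_self_sqrt hs.le]
  have h2 : 0 < (Real.sqrt s)⁻¹ := by positivity
  rw [h1]
  -- `q² ≤ q + q³` for `q = s^{-1/2}`
  nlinarith [sq_nonneg ((Real.sqrt s)⁻¹ - 1), mul_pos h2 h2,
    mul_nonneg h2.le (sq_nonneg ((Real.sqrt s)⁻¹ - 1))]

/-- The heat kernel at time `s` of `ℝᵐ` at distance `r`, damped by `e^{-κ² s}`. -/
def heat (m : ℕ) (κ r s : ℝ) : ℝ :=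
  (Real.sqrt (4 * Real.pi * s))⁻¹ ^ m * Real.exp (-(κ ^ 2 * s) - r ^ 2 / (4 * s))

theorem sqrt_four_pi_mul (s : ℝ) :
    Real.sqrt (4 * Real.pi * s) = 2 * Real.sqrt Real.pi * Real.sqrt s := by
  rw [Real.sqrt_mul (by positivity), Real.sqrt_mul (by norm_num),
    show (4 : ℝ) = 2 ^ 2 by norm_num, Real.sqrt_sq (by norm_num)]

/-- The damped one-dimensional heat kernel integrates in time to `e^{-κt} / (2κ)`. -/
theorem integral_heat_dim_one {κ t : ℝ} (hκ : 0 < κ) (ht : 0 < t) :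
    IntegrableOn (heat 1 κ t) (Ioi 0) ∧
    ∫ s in Ioi (0 : ℝ), heat 1 κ t s = Real.exp (-(t * κ)) / (2 * κ) := by
  have h : heat 1 κ t = fun s => (2 * Real.sqrt Real.pi)⁻¹ *
      ((Real.sqrt s)⁻¹ * Real.exp (-(κ ^ 2 * s) - t ^ 2 / (4 * s))) := by
    ext s; rw [heat, sqrt_four_pi_mul, pow_one, mul_inv]; ring
  rw [h]
  refine ⟨(integrable_heat_half hκ ht).const_mul _, ?_⟩
  have := Real.sqrt_pos.2 Real.pi_pos
  rw [integral_const_mul, integral_heat_half hκ ht, mul_comm t κ]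
  field_simp

/-- The two-dimensional damped heat kernel integrates in time to `K₀(κr) / (2π)`. -/
theorem integral_heat_dim_two {κ r : ℝ} (hκ : 0 < κ) (hr : 0 < r) :
    IntegrableOn (heat 2 κ r) (Ioi 0) ∧
    ∫ s in Ioi (0 : ℝ), heat 2 κ r s =
      (2 * Real.pi)⁻¹ * ∫ u in Ioi (0 : ℝ), Real.exp (-(κ * r * Real.cosh u)) := by
  have h : EqOn (heat 2 κ r) (fun s => (4 * Real.pi)⁻¹ *
      (s⁻¹ * Real.exp (-(κ ^ 2 * s) - r ^ 2 / (4 * s)))) (Ioi 0) := by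
    intro s hs
    have hs' : (0 : ℝ) < s := hs
    have hpi := Real.pi_pos
    simp only [heat]
    rw [inv_pow, Real.sq_sqrt (by positivity), mul_inv]
    ring
  refine ⟨(IntegrableOn.congr_fun ((integrable_heat_one hκ hr).const_mul _) h.symm
    measurableSet_Ioi), ?_⟩
  rw [setIntegral_congr_fun measurableSet_Ioi h, integral_const_mul, integral_heat_one hκ hr]
  have := Real.pi_pos
  field_simp
  ring

/-- The three-dimensional damped heat kernel integrates in time to `e^{-κr} / (4πr)`. -/
theorem integral_heat_dim_three {κ r : ℝ} (hκ : 0 < κ) (hr : 0 < r) :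
    IntegrableOn (heat 3 κ r) (Ioi 0) ∧
    ∫ s in Ioi (0 : ℝ), heat 3 κ r s = Real.exp (-(κ * r)) / (4 * Real.pi * r) := by
  have h : EqOn (heat 3 κ r) (fun s => (8 * Real.pi * Real.sqrt Real.pi)⁻¹ *
      ((Real.sqrt s)⁻¹ * s⁻¹ * Real.exp (-(κ ^ 2 * s) - r ^ 2 / (4 * s)))) (Ioi 0) := by
    intro s hs
    have hs' : (0 : ℝ) < s := hs
    have hpi := Real.pi_pos
    simp only [heat]
    rw [pow_succ, inv_pow, Real.sq_sqrt (by positivity), sqrt_four_pi_mul]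
    have := Real.sqrt_pos.2 hs'
    have := Real.sqrt_pos.2 hpi
    field_simp
    ring
  refine ⟨(IntegrableOn.congr_fun ((integrable_heat_three_halves hκ hr).const_mul _) h.symm
    measurableSet_Ioi), ?_⟩
  rw [setIntegral_congr_fun measurableSet_Ioi h, integral_const_mul,
    integral_heat_three_halves hκ hr]
  have := Real.pi_pos
  have := Real.sqrt_pos.2 Real.pi_pos
  field_simp
  ring

theorem integrableOn_heat {d : ℕ} (hd : d = 1 ∨ d = 2) {κ r : ℝ} (hκ : 0 < κ) (hr : 0 < r) :
    IntegrableOn (heat (d + 1) κ r) (Ioi 0) := by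
  rcases hd with rfl | rfl
  · exact (integral_heat_dim_two hκ hr).1
  · exact (integral_heat_dim_three hκ hr).1

/-! ### The spectral representation for exponentially decaying waves -/

theorem continuous_phase_left {d : ℕ} (x : E d) : Continuous fun ξ : E d => phase ξ x :=
  continuous_phase.comp (by fun_prop : Continuous fun ξ : E d => (ξ, x))

theorem phase_sub {d : ℕ} (ξ x y : E d) :
    phase ξ (x - y) = phase ξ x * Complex.exp (-(Complex.I * (inner ℝ ξ y : ℝ))) := by
  rw [phase, phase, ← Complex.exp_add, inner_sub_right]
  congr 1
  push_cast
  ring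

theorem two_pi_rpow_mul_self (d : ℕ) :
    (2 * Real.pi) ^ ((d : ℝ) / 2) * (2 * Real.pi) ^ ((d : ℝ) / 2) = (2 * Real.pi) ^ d := by
  rw [← Real.rpow_add (by positivity), add_halves, Real.rpow_natCast]

theorem integral_phase_mul_gaussian {d : ℕ} {s : ℝ} (hs : 0 < s) (z : E d) :
    ∫ ξ : E d, phase ξ z * (Real.exp (-(s * ‖ξ‖ ^ 2)) : ℂ) =
      (((2 * Real.pi) ^ d * ((Real.sqrt (4 * Real.pi * s))⁻¹ ^ d *
        Real.exp (-(‖z‖ ^ 2 / (4 * s)))) : ℝ) : ℂ) := by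
  have h := GaussianFourier.integral_cexp_neg_mul_sq_norm_add (V := E d) (b := s)
    (by simpa using hs) Complex.I z
  have hconst : ((Real.pi : ℂ) / s) ^ ((Module.finrank ℝ (E d) : ℂ) / 2) =
      (((2 * Real.pi) ^ d * (Real.sqrt (4 * Real.pi * s))⁻¹ ^ d : ℝ) : ℂ) := by
    have h1 : (2 * Real.pi) ^ d * (Real.sqrt (4 * Real.pi * s))⁻¹ ^ d =
        (Real.pi / s) ^ ((d : ℝ) / 2) := by
      have h2 : (Real.pi / s) ^ ((d : ℝ) / 2) = (Real.sqrt (Real.pi / s)) ^ d := by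
        rw [Real.sqrt_eq_rpow, ← Real.rpow_natCast, ← Real.rpow_mul (by positivity)]
        congr 1; ring
      rw [h2, ← mul_pow, sqrt_four_pi_mul, Real.sqrt_div Real.pi_pos.le]
      congr 1
      have h3 := Real.mul_self_sqrt Real.pi_pos.le
      have h4 := Real.sqrt_pos.2 Real.pi_pos
      have h5 := Real.sqrt_pos.2 hs
      field_simp
      linarith
    rw [h1, Complex.ofReal_cpow (by positivity)]
    simp
  rw [hconst] at h
  rw [← mul_assoc, Complex.ofReal_mul, ← (show Complex.exp (Complex.I ^ 2 * ‖z‖ ^ 2 / (4 * s)) =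
    (Real.exp (-(‖z‖ ^ 2 / (4 * s))) : ℂ) by
      rw [Complex.I_sq]; push_cast; congr 1; ring), ← h]
  refine integral_congr_ae (Eventually.of_forall fun ξ => ?_)
  simp only [phase]
  rw [Complex.ofReal_exp, ← Complex.exp_add, real_inner_comm]
  congr 1
  push_cast
  ring

theorem integrable_gaussian_norm {d : ℕ} {s : ℝ} (hs : 0 < s) :
    Integrable fun ξ : E d => (Real.exp (-(s * ‖ξ‖ ^ 2)) : ℂ) := by
  have := GaussianFourier.integrable_cexp_neg_mul_sq_norm_add (V := E d) (b := s)
    (by simpa using hs) 0 0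
  refine this.congr (Eventually.of_forall fun ξ => ?_)
  simp

/-- Convolution with the Gaussian at time `s`, on the Fourier side. -/
theorem integral_gaussian_mul_eq_fourier {d : ℕ} {s : ℝ} (hs : 0 < s) {φ : E d → ℂ}
    (hφ : Integrable φ) (x : E d) :
    ∫ y, (((Real.sqrt (4 * Real.pi * s))⁻¹ ^ d * Real.exp (-(‖x - y‖ ^ 2 / (4 * s))) : ℝ) : ℂ) *
        φ y =
      1 / (((2 * Real.pi) ^ ((d : ℝ) / 2) : ℝ) : ℂ) *
        ∫ ξ, phase ξ x * (Real.exp (-(s * ‖ξ‖ ^ 2)) : ℂ) * hat φ ξ := by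
  have h1 : Integrable (fun p : E d × E d => (Real.exp (-(s * ‖p.1‖ ^ 2)) : ℂ) * φ p.2)
      (volume.prod volume) := (integrable_gaussian_norm (d := d) hs).mul_prod hφ
  have hc : Continuous fun p : E d × E d => phase p.1 (x - p.2) :=
    continuous_phase.comp (by fun_prop : Continuous fun p : E d × E d => (p.1, x - p.2))
  have h2 : Integrable (fun p : E d × E d => phase p.1 (x - p.2) *
      ((Real.exp (-(s * ‖p.1‖ ^ 2)) : ℂ) * φ p.2)) (volume.prod volume) := by
    refine h1.mono (hc.aestronglyMeasurable.mul h1.1) (Eventually.of_forall fun p => ?_)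
    rw [norm_mul, norm_phase, one_mul]
  have hswap : ∫ ξ, ∫ y, phase ξ (x - y) * (Real.exp (-(s * ‖ξ‖ ^ 2)) : ℂ) * φ y =
      ∫ y, ∫ ξ, phase ξ (x - y) * (Real.exp (-(s * ‖ξ‖ ^ 2)) : ℂ) * φ y := by
    simp only [mul_assoc]
    exact integral_integral_swap h2
  have hL : ∀ y, ∫ ξ, phase ξ (x - y) * (Real.exp (-(s * ‖ξ‖ ^ 2)) : ℂ) * φ y =
      (((2 * Real.pi) ^ d : ℝ) : ℂ) * ((((Real.sqrt (4 * Real.pi * s))⁻¹ ^ d *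
        Real.exp (-(‖x - y‖ ^ 2 / (4 * s))) : ℝ) : ℂ) * φ y) := by
    intro y
    rw [integral_mul_const, integral_phase_mul_gaussian hs, Complex.ofReal_mul, mul_assoc]
  have hA : (((2 * Real.pi) ^ ((d : ℝ) / 2) : ℝ) : ℂ) ≠ 0 := by
    exact_mod_cast (by positivity : (2 * Real.pi) ^ ((d : ℝ) / 2) ≠ 0)
  have hR : ∀ ξ, ∫ y, phase ξ (x - y) * (Real.exp (-(s * ‖ξ‖ ^ 2)) : ℂ) * φ y =
      (((2 * Real.pi) ^ ((d : ℝ) / 2) : ℝ) : ℂ) *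
        (phase ξ x * (Real.exp (-(s * ‖ξ‖ ^ 2)) : ℂ) * hat φ ξ) := by
    intro ξ
    have h1 : ∀ y, phase ξ (x - y) * (Real.exp (-(s * ‖ξ‖ ^ 2)) : ℂ) * φ y =
        phase ξ x * (Real.exp (-(s * ‖ξ‖ ^ 2)) : ℂ) *
          (Complex.exp (-(Complex.I * (inner ℝ ξ y : ℝ))) * φ y) := by
      intro y; rw [phase_sub]; ring
    simp only [h1]
    rw [integral_const_mul, hat]
    field_simp
  simp only [hL, hR] at hswap
  rw [integral_const_mul, integral_const_mul, ← two_pi_rpow_mul_self, Complex.ofReal_mul] at hswap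
  rw [mul_assoc] at hswap
  rw [mul_left_cancel₀ hA hswap, one_div, inv_mul_cancel_left₀ hA]

/-- The heat kernel is the product of the kernels in the normal and tangential directions. -/
theorem heat_succ {d : ℕ} {κ t ρ r : ℝ} (hr : r ^ 2 = ρ ^ 2 + t ^ 2) (s : ℝ) :
    heat (d + 1) κ r s = heat 1 κ t s *
      ((Real.sqrt (4 * Real.pi * s))⁻¹ ^ d * Real.exp (-(ρ ^ 2 / (4 * s)))) := by
  have h : Real.exp (-(κ ^ 2 * s) - r ^ 2 / (4 * s)) =
      Real.exp (-(κ ^ 2 * s) - t ^ 2 / (4 * s)) * Real.exp (-(ρ ^ 2 / (4 * s))) := by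
    rw [← Real.exp_add, hr]
    congr 1
    ring
  rw [heat, heat, h, pow_succ, pow_one]
  ring

theorem heat_one_mul_exp {κ t ν : ℝ} (hν : 0 ≤ ν) (s : ℝ) :
    heat 1 κ t s * Real.exp (-(s * ν)) = heat 1 (Real.sqrt (κ ^ 2 + ν)) t s := by
  rw [heat, heat, mul_assoc, ← Real.exp_add, Real.sq_sqrt (by positivity)]
  congr 2
  ring

theorem heat_nonneg (m : ℕ) (κ r s : ℝ) : 0 ≤ heat m κ r s := by
  unfold heat; positivity

theorem measurable_heat (m : ℕ) (κ r : ℝ) : Measurable (heat m κ r) := by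
  unfold heat; fun_prop

theorem distance_sq {d : ℕ} (x y : E d) (t : ℝ) :
    Real.sqrt (‖x - y‖ ^ 2 + t ^ 2) ^ 2 = ‖x - y‖ ^ 2 + t ^ 2 := Real.sq_sqrt (by positivity)

/-- The spectral representation of the single layer potential of the exponentially decaying
fundamental solution of `-Δ + κ²`, `κ > 0`, the latter given as a Laplace transform of the heat
kernel. -/
theorem integral_heat_mul_eq_fourier {d : ℕ} (hd : d = 1 ∨ d = 2) {κ t : ℝ} (hκ : 0 < κ)
    (ht : 0 < t) {φ : E d → ℂ} (hφ : Integrable φ) (hφ' : Integrable (hat φ)) (x : E d) :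
    ∫ y, ((∫ s in Ioi (0 : ℝ), heat (d + 1) κ (Real.sqrt (‖x - y‖ ^ 2 + t ^ 2)) s : ℝ) : ℂ) *
        φ y =
      coeff d * ∫ ξ, phase ξ x * ((Real.exp (-(t * Real.sqrt (κ ^ 2 + ‖ξ‖ ^ 2))) /
        Real.sqrt (κ ^ 2 + ‖ξ‖ ^ 2) : ℝ) : ℂ) * hat φ ξ := by
  have h1i : Integrable (fun s => (heat 1 κ t s : ℂ)) (volume.restrict (Ioi 0)) :=
    (integral_heat_dim_one hκ ht).1.ofReal
  -- dominates the kernel at every `y`, because the distance is at least `t`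
  have hdi : Integrable (fun s => (heat (d + 1) κ t s : ℂ)) (volume.restrict (Ioi 0)) :=
    (integrableOn_heat hd hκ ht).ofReal
  have hmeas : Measurable fun p : E d × ℝ => (heat (d + 1) κ (Real.sqrt (‖x - p.1‖ ^ 2 + t ^ 2)) p.2 : ℂ) := by
    unfold heat; fun_prop
  have hswap1 := integral_integral_swap (μ := (volume : Measure (E d)))
    (ν := volume.restrict (Ioi (0 : ℝ)))
    (f := fun y s => (heat (d + 1) κ (Real.sqrt (‖x - y‖ ^ 2 + t ^ 2)) s : ℂ) * φ y) (by
    refine (hφ.mul_prod hdi).mono (hmeas.aestronglyMeasurable.mul hφ.1.comp_fst) ?_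
    rw [← Measure.restrict_univ (μ := (volume : Measure (E d))), Measure.prod_restrict]
    refine (ae_restrict_iff' (MeasurableSet.univ.prod measurableSet_Ioi)).2
      (Eventually.of_forall fun p hp => ?_)
    have hs : 0 < p.2 := hp.2
    simp only [Function.uncurry, norm_mul, Complex.norm_real]
    rw [mul_comm]
    refine mul_le_mul_of_nonneg_left ?_ (norm_nonneg _)
    rw [Real.norm_of_nonneg (heat_nonneg _ _ _ _), Real.norm_of_nonneg (heat_nonneg _ _ _ _),
      heat, heat, distance_sq]
    gcongr
    nlinarith [sq_nonneg ‖x - p.1‖])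
  have hmeas2 : Measurable fun p : ℝ × E d =>
      (heat 1 κ t p.1 : ℂ) * (phase p.2 x * (Real.exp (-(p.1 * ‖p.2‖ ^ 2)) : ℂ)) := by
    have h1 : Measurable fun p : ℝ × E d => phase p.2 x :=
      (continuous_phase_left x).measurable.comp measurable_snd
    have h2 : Measurable fun p : ℝ × E d => (heat 1 κ t p.1 : ℂ) :=
      Complex.measurable_ofReal.comp ((measurable_heat 1 κ t).comp measurable_fst)
    fun_prop
  have hswap2 := integral_integral_swap (μ := volume.restrict (Ioi (0 : ℝ)))
    (ν := (volume : Measure (E d)))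
    (f := fun s ξ => (heat 1 κ t s : ℂ) * (phase ξ x * (Real.exp (-(s * ‖ξ‖ ^ 2)) : ℂ)) *
      hat φ ξ) (by
    refine (h1i.mul_prod hφ').mono (hmeas2.aestronglyMeasurable.mul hφ'.1.comp_snd) ?_
    rw [← Measure.restrict_univ (μ := (volume : Measure (E d))), Measure.prod_restrict]
    refine (ae_restrict_iff' (measurableSet_Ioi.prod MeasurableSet.univ)).2
      (Eventually.of_forall fun p hp => ?_)
    have hs : 0 < p.1 := hp.1
    simp only [Function.uncurry, norm_mul, norm_phase, one_mul]
    refine mul_le_mul_of_nonneg_right ?_ (norm_nonneg _)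
    refine mul_le_of_le_one_right (norm_nonneg _) ?_
    rw [Complex.norm_real, Real.norm_of_nonneg (Real.exp_pos _).le, Real.exp_le_one_iff]
    have : 0 ≤ p.1 * ‖p.2‖ ^ 2 := by positivity
    linarith)
  have hA : ∀ y, ∫ s in Ioi (0 : ℝ), (heat (d + 1) κ (Real.sqrt (‖x - y‖ ^ 2 + t ^ 2)) s : ℂ) *
      φ y = ((∫ s in Ioi (0 : ℝ), heat (d + 1) κ (Real.sqrt (‖x - y‖ ^ 2 + t ^ 2)) s : ℝ) : ℂ) *
        φ y := by
    intro y
    rw [integral_mul_const, integral_complex_ofReal]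
  have hB : ∀ s ∈ Ioi (0 : ℝ),
      ∫ y, (heat (d + 1) κ (Real.sqrt (‖x - y‖ ^ 2 + t ^ 2)) s : ℂ) * φ y =
      1 / (((2 * Real.pi) ^ ((d : ℝ) / 2) : ℝ) : ℂ) *
        ∫ ξ, (heat 1 κ t s : ℂ) * (phase ξ x * (Real.exp (-(s * ‖ξ‖ ^ 2)) : ℂ)) * hat φ ξ := by
    intro s hs
    simp only [heat_succ (distance_sq x _ t), Complex.ofReal_mul (heat 1 κ t s), mul_assoc]
    rw [integral_const_mul, integral_const_mul]
    have := integral_gaussian_mul_eq_fourier hs hφ x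
    simp only [mul_assoc] at this
    rw [this]
    ring
  have hC : ∀ ξ, ∫ s in Ioi (0 : ℝ), (heat 1 κ t s : ℂ) *
      (phase ξ x * (Real.exp (-(s * ‖ξ‖ ^ 2)) : ℂ)) * hat φ ξ =
      1 / 2 * (phase ξ x * ((Real.exp (-(t * Real.sqrt (κ ^ 2 + ‖ξ‖ ^ 2))) /
        Real.sqrt (κ ^ 2 + ‖ξ‖ ^ 2) : ℝ) : ℂ) * hat φ ξ) := by
    intro ξ
    have h1 : ∀ s, (heat 1 κ t s : ℂ) * (phase ξ x * (Real.exp (-(s * ‖ξ‖ ^ 2)) : ℂ)) * hat φ ξ =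
        (phase ξ x * hat φ ξ) * (heat 1 (Real.sqrt (κ ^ 2 + ‖ξ‖ ^ 2)) t s : ℂ) := by
      intro s
      rw [← heat_one_mul_exp (by positivity), Complex.ofReal_mul]
      ring
    simp only [h1]
    rw [integral_const_mul, integral_complex_ofReal,
      (integral_heat_dim_one (Real.sqrt_pos.2 (by positivity)) ht).2]
    push_cast
    ring
  simp only [hA] at hswap1
  rw [hswap1, setIntegral_congr_fun measurableSet_Ioi hB, integral_const_mul, hswap2]
  simp only [hC]
  rw [integral_const_mul, coeff]
  ring

/-! ### Analytic continuation in the wave number -/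

/-- A branch of `√(κ² + ρ²)` that is holomorphic in `Re κ > 0` and continuous up to the imaginary
axis. Splitting the radicand into `κ + iρ` and `κ - iρ` keeps both principal square roots away from
their cut. -/
def root (κ : ℂ) (ρ : ℝ) : ℂ :=
  Complex.sqrt (κ + Complex.I * ρ) * Complex.sqrt (κ - Complex.I * ρ)

theorem sqrt_sq_complex (a : ℂ) : Complex.sqrt a ^ 2 = a := by
  simp [Complex.sqrt]

theorem root_sq (κ : ℂ) (ρ : ℝ) : root κ ρ ^ 2 = κ ^ 2 + (ρ : ℂ) ^ 2 := by
  rw [root, mul_pow, sqrt_sq_complex, sqrt_sq_complex]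
  linear_combination (-(ρ : ℂ) ^ 2) * Complex.I_sq

/-- Square roots of numbers in the right half plane lie in the sector `|arg| ≤ π/4`, so that a product
of two of them has nonnegative real part. -/
theorem abs_im_sqrt_le_re {a : ℂ} (ha : 0 ≤ a.re) :
    |(Complex.sqrt a).im| ≤ (Complex.sqrt a).re := by
  have him : (Complex.sqrt a).im =
      (if 0 ≤ a.im then 1 else -1) * Real.sqrt ((‖a‖ - a.re) / 2) := by
    rw [Complex.sqrt_eq_real_add_ite]; split_ifs <;> simp
  have hre : (Complex.sqrt a).re = Real.sqrt ((‖a‖ + a.re) / 2) := by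
    rw [Complex.sqrt_eq_real_add_ite]; split_ifs <;> simp
  rw [him, hre, abs_mul, abs_of_nonneg (Real.sqrt_nonneg _)]
  have : |(if 0 ≤ a.im then 1 else -1 : ℝ)| = 1 := by split_ifs <;> simp
  rw [this, one_mul]
  exact Real.sqrt_le_sqrt (by linarith)

theorem root_re_nonneg {κ : ℂ} (hκ : 0 ≤ κ.re) (ρ : ℝ) : 0 ≤ (root κ ρ).re := by
  have h1 := abs_im_sqrt_le_re (a := κ + Complex.I * ρ) (by simpa using hκ)
  have h2 := abs_im_sqrt_le_re (a := κ - Complex.I * ρ) (by simpa using hκ)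
  rw [root, Complex.mul_re, sub_nonneg]
  refine (le_abs_self _).trans ?_
  rw [abs_mul]
  exact mul_le_mul h1 h2 (abs_nonneg _) ((abs_nonneg _).trans h1)

/-- Both `κ + iρ` and `κ - iρ` have modulus at least `Re κ`. -/
theorem re_le_norm_root {κ : ℂ} (hκ : 0 < κ.re) (ρ : ℝ) : κ.re ≤ ‖root κ ρ‖ := by
  have h1 : κ.re ≤ ‖κ + Complex.I * ρ‖ := by
    simpa using Complex.re_le_norm (κ + Complex.I * ρ)
  have h2 : κ.re ≤ ‖κ - Complex.I * ρ‖ := by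
    simpa using Complex.re_le_norm (κ - Complex.I * ρ)
  have h3 : ‖root κ ρ‖ ^ 2 = ‖κ + Complex.I * ρ‖ * ‖κ - Complex.I * ρ‖ := by
    rw [← norm_pow, root, mul_pow, sqrt_sq_complex, sqrt_sq_complex, norm_mul]
  refine le_of_sq_le_sq ?_ (norm_nonneg _)
  rw [h3, sq]
  exact mul_le_mul h1 h2 hκ.le (norm_nonneg _)

theorem root_ne_zero {κ : ℂ} (hκ : 0 < κ.re) (ρ : ℝ) : root κ ρ ≠ 0 :=
  norm_pos_iff.1 (hκ.trans_le (re_le_norm_root hκ ρ))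

theorem differentiableAt_root {κ : ℂ} (hκ : 0 < κ.re) (ρ : ℝ) :
    DifferentiableAt ℂ (root · ρ) κ := by
  unfold root
  refine DifferentiableAt.mul ?_ ?_
  · exact (Complex.differentiableAt_sqrt (Or.inl (by simpa using hκ))).comp κ
      (differentiableAt_id.add_const _)
  · exact (Complex.differentiableAt_sqrt (Or.inl (by simpa using hκ))).comp κ
      (differentiableAt_id.sub_const _)

theorem continuousAt_root {p : ℂ × ℝ} (hp : 0 ≤ p.1.re) :
    ContinuousAt (fun p : ℂ × ℝ => root p.1 p.2) p := by
  unfold root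
  refine ContinuousAt.mul ?_ ?_
  · exact ContinuousAt.comp (f := fun p : ℂ × ℝ => p.1 + Complex.I * p.2)
      (Complex.continuousAt_sqrt (Or.inl (by simpa using hp)))
      (Continuous.continuousAt (by fun_prop))
  · exact ContinuousAt.comp (f := fun p : ℂ × ℝ => p.1 - Complex.I * p.2)
      (Complex.continuousAt_sqrt (Or.inl (by simpa using hp)))
      (Continuous.continuousAt (by fun_prop))

theorem continuous_root_right {κ : ℂ} (hκ : 0 ≤ κ.re) : Continuous (root κ) :=
  continuous_iff_continuousAt.2 fun ρ =>
    ContinuousAt.comp (f := fun ρ : ℝ => (κ, ρ)) (continuousAt_root (p := (κ, ρ)) hκ)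
      (Continuous.continuousAt (by fun_prop))

theorem eq_of_sq_eq_of_re {z : ℂ} {w : ℝ} (hw : 0 < w) (hz : 0 ≤ z.re) (h : z ^ 2 = (w : ℂ) ^ 2) :
    z = w := by
  rcases sq_eq_sq_iff_eq_or_eq_neg.1 h with h1 | h1
  · exact h1
  · rw [h1] at hz
    simp at hz
    linarith

theorem root_ofReal {κ : ℝ} (hκ : 0 < κ) (ρ : ℝ) :
    root κ ρ = (Real.sqrt (κ ^ 2 + ρ ^ 2) : ℂ) := by
  refine eq_of_sq_eq_of_re (Real.sqrt_pos.2 (by positivity))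
    (root_re_nonneg (by simpa using hκ.le) ρ) ?_
  rw [root_sq, ← Complex.ofReal_pow (Real.sqrt _), Real.sq_sqrt (by positivity)]
  push_cast; ring

theorem sqrt_neg_I_mul {a : ℝ} (ha : 0 ≤ a) :
    Complex.sqrt (-(Complex.I * a)) = (Real.sqrt (a / 2) : ℂ) * (1 - Complex.I) := by
  rcases ha.eq_or_lt with rfl | ha
  · simp
  rw [Complex.sqrt_eq_real_add_ite, if_neg (by simpa using ha)]
  simp [abs_of_pos ha]
  ring

/-- The limiting absorption principle for the symbol. -/
theorem root_neg_I_mul {d : ℕ} {k : ℝ} (hk : 0 < k) (ξ : E d) :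
    root (-(Complex.I * k)) ‖ξ‖ = -(Complex.I * Z k ξ) := by
  rcases le_or_gt ‖ξ‖ k with h | h
  · have h1 : -(Complex.I * (k : ℂ)) + Complex.I * (‖ξ‖ : ℂ) =
        -(Complex.I * ((k - ‖ξ‖ : ℝ) : ℂ)) := by push_cast; ring
    have h2 : -(Complex.I * (k : ℂ)) - Complex.I * (‖ξ‖ : ℂ) =
        -(Complex.I * ((k + ‖ξ‖ : ℝ) : ℂ)) := by push_cast; ring
    have h0 := norm_nonneg ξ
    have h3 : Real.sqrt (k ^ 2 - ‖ξ‖ ^ 2) =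
        2 * (Real.sqrt ((k - ‖ξ‖) / 2) * Real.sqrt ((k + ‖ξ‖) / 2)) := by
      rw [← Real.sqrt_mul (by linarith), ← Real.sqrt_sq (show (0 : ℝ) ≤ 2 by norm_num),
        ← Real.sqrt_mul (by positivity)]
      congr 1
      rw [Real.sqrt_sq (by norm_num)]
      ring
    rw [root, h1, h2, sqrt_neg_I_mul (by linarith), sqrt_neg_I_mul (by linarith), Z_of_le h, h3]
    push_cast
    linear_combination ((Real.sqrt ((k - ‖ξ‖) / 2) : ℂ) * (Real.sqrt ((k + ‖ξ‖) / 2) : ℂ)) *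
      Complex.I_sq
  · have hpos : 0 < Real.sqrt (‖ξ‖ ^ 2 - k ^ 2) := Real.sqrt_pos.2 (by nlinarith)
    rw [Z_of_lt h, ← mul_assoc, Complex.I_mul_I, neg_one_mul, neg_neg]
    refine eq_of_sq_eq_of_re hpos (root_re_nonneg (by simp) _) ?_
    rw [root_sq, ← Complex.ofReal_pow (Real.sqrt _), Real.sq_sqrt (by nlinarith)]
    push_cast
    linear_combination (k : ℂ) ^ 2 * Complex.I_sq

/-- The bound `1 / |Z|` dominates along the approach to the imaginary axis: the radicand
`|ξ|² - k² + ε² - 2iεk` has modulus at least `||ξ|² - k²|`. -/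
theorem norm_Z_le_norm_root {d : ℕ} {k : ℝ} (hk : 0 < k) (ε : ℝ) (ξ : E d) :
    ‖Z k ξ‖ ≤ ‖root (ε - Complex.I * k) ‖ξ‖‖ := by
  refine le_of_sq_le_sq ?_ (norm_nonneg _)
  rw [norm_Z hk, Real.sq_sqrt (abs_nonneg _), ← norm_pow, root_sq]
  refine abs_le_of_sq_le_sq ?_ (norm_nonneg _)
  rw [← Complex.normSq_eq_norm_sq, Complex.normSq_apply]
  have hre : ((ε - Complex.I * k) ^ 2 + (‖ξ‖ : ℂ) ^ 2).re = ε ^ 2 - k ^ 2 + ‖ξ‖ ^ 2 := by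
    simp [sq]
  have him : ((ε - Complex.I * k) ^ 2 + (‖ξ‖ : ℂ) ^ 2).im = -(2 * ε * k) := by
    simp [sq]; ring
  rw [hre, him]
  nlinarith [mul_nonneg (sq_nonneg ε) (sq_nonneg ‖ξ‖), mul_nonneg (sq_nonneg ε) (sq_nonneg k),
    sq_nonneg (ε ^ 2)]

/-- The right half plane of admissible complex wave numbers. -/
def rightHalfPlane : Set ℂ := {z | 0 < z.re}

theorem isOpen_rightHalfPlane : IsOpen rightHalfPlane :=
  isOpen_lt continuous_const Complex.continuous_re

theorem isPreconnected_rightHalfPlane : IsPreconnected rightHalfPlane :=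
  (convex_halfSpace_re_gt 0).isPreconnected

theorem norm_exp_neg_mul_root_le {κ : ℂ} (hκ : 0 ≤ κ.re) {t : ℝ} (ht : 0 ≤ t) (ρ : ℝ) :
    ‖Complex.exp (-(t * root κ ρ))‖ ≤ 1 := by
  rw [Complex.norm_exp, Real.exp_le_one_iff]
  have := mul_nonneg ht (root_re_nonneg hκ ρ)
  simpa using this

/-- The spectral integral is holomorphic in `κ`. -/
theorem differentiableOn_spectral {d : ℕ} {c : E d → ℂ} (hc : Integrable c) {t : ℝ} (ht : 0 ≤ t)
    (x : E d) :
    DifferentiableOn ℂ (fun κ => ∫ ξ, phase ξ x *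
      (Complex.exp (-(t * root κ ‖ξ‖)) / root κ ‖ξ‖) * c ξ) rightHalfPlane := by
  refine differentiableOn_integral_of_locally_dominated isOpen_rightHalfPlane
    (fun z hz => ?_) (Eventually.of_forall fun ξ z hz => ?_) fun z hz => ?_
  · have hr : Continuous fun ξ : E d => root z ‖ξ‖ :=
      (continuous_root_right (le_of_lt hz)).comp continuous_norm
    have hp := continuous_phase_left x
    refine AEStronglyMeasurable.mul (Continuous.aestronglyMeasurable ?_) hc.1
    exact hp.mul (Continuous.div (by fun_prop) hr fun ξ => root_ne_zero hz _)
  · have hr := differentiableAt_root hz ‖ξ‖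
    exact ((((hr.const_mul (t : ℂ)).neg.cexp.div hr (root_ne_zero hz _)).const_mul _).mul_const
      _).differentiableWithinAt
  · have hz' : 0 < z.re := hz
    refine ⟨{w | z.re / 2 < w.re}, (isOpen_lt continuous_const Complex.continuous_re).mem_nhds
      (show z.re / 2 < z.re by linarith), fun ξ => (z.re / 2)⁻¹ * ‖c ξ‖, hc.norm.const_mul _,
      Eventually.of_forall fun ξ w hw => ?_⟩
    have hw' : z.re / 2 < w.re := hw
    have hw0 : 0 < w.re := by linarith
    rw [norm_mul, norm_mul, norm_phase, one_mul, norm_div, div_eq_mul_inv]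
    refine mul_le_mul_of_nonneg_right ?_ (norm_nonneg _)
    refine (mul_le_of_le_one_left (inv_nonneg.2 (norm_nonneg _))
      (norm_exp_neg_mul_root_le hw0.le ht _)).trans ?_
    exact inv_anti₀ (by linarith) (hw'.le.trans (re_le_norm_root hw0 _))

theorem tendsto_sub_I_mul (k : ℝ) :
    Tendsto (fun ε : ℝ => (ε : ℂ) - Complex.I * k) (𝓝[>] 0) (𝓝 (-(Complex.I * k))) := by
  have h : Continuous fun ε : ℝ => (ε : ℂ) - Complex.I * k := by fun_prop
  have := h.tendsto 0
  rw [Complex.ofReal_zero, zero_sub] at this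
  exact this.mono_left nhdsWithin_le_nhds

theorem ae_norm_ne {d : ℕ} {k : ℝ} (hk : 0 < k) : ∀ᵐ ξ : E d, ‖ξ‖ ≠ k := by
  have : volume (Metric.sphere (0 : E d) k) = 0 := Measure.addHaar_sphere_of_ne_zero _ _ hk.ne'
  filter_upwards [compl_mem_ae_iff.2 this] with ξ hξ h
  exact hξ (by simpa using h)

theorem Z_ne_zero {d : ℕ} {k : ℝ} (hk : 0 < k) {ξ : E d} (h : ‖ξ‖ ≠ k) : Z k ξ ≠ 0 := by
  rw [← norm_pos_iff, norm_Z hk, Real.sqrt_pos, abs_pos, sub_ne_zero]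
  intro h1
  exact h ((sq_eq_sq₀ (norm_nonneg _) hk.le).1 h1.symm)

/-- The limiting absorption principle for the spectral integral. -/
theorem tendsto_spectral {d : ℕ} {k : ℝ} (hk : 0 < k) {c : E d → ℂ}
    (hm : AEStronglyMeasurable c volume) (hc : Integrable fun ξ => c ξ / Z k ξ) {t : ℝ}
    (ht : 0 ≤ t) (x : E d) :
    Tendsto (fun ε : ℝ => ∫ ξ, phase ξ x * (Complex.exp (-(t * root (ε - Complex.I * k) ‖ξ‖)) /
        root (ε - Complex.I * k) ‖ξ‖) * c ξ) (𝓝[>] 0)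
      (𝓝 (Complex.I * ∫ ξ, phase ξ x * (Complex.exp (Complex.I * (t * Z k ξ)) / Z k ξ) * c ξ)) := by
  rw [← integral_const_mul]
  refine tendsto_integral_filter_of_dominated_convergence (fun ξ => ‖c ξ / Z k ξ‖) ?_ ?_ hc.norm ?_
  · filter_upwards [self_mem_nhdsWithin] with ε hε
    have hz : 0 < ((ε : ℂ) - Complex.I * k).re := by simpa using hε
    have hr : Continuous fun ξ : E d => root (ε - Complex.I * k) ‖ξ‖ :=
      (continuous_root_right hz.le).comp continuous_norm
    have hp := continuous_phase_left x
    refine AEStronglyMeasurable.mul (Continuous.aestronglyMeasurable ?_) hm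
    exact hp.mul (Continuous.div (by fun_prop) hr fun ξ => root_ne_zero hz _)
  · filter_upwards [self_mem_nhdsWithin] with ε hε
    have hz : 0 < ((ε : ℂ) - Complex.I * k).re := by simpa using hε
    filter_upwards [ae_norm_ne hk] with ξ hξ
    rw [norm_mul, norm_mul, norm_phase, one_mul, norm_div, norm_div, div_eq_mul_inv, mul_comm,
      div_eq_mul_inv]
    refine mul_le_mul_of_nonneg_left ?_ (norm_nonneg _)
    refine (mul_le_of_le_one_left (inv_nonneg.2 (norm_nonneg _))
      (norm_exp_neg_mul_root_le hz.le ht _)).trans ?_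
    exact inv_anti₀ (norm_pos_iff.2 (Z_ne_zero hk hξ)) (norm_Z_le_norm_root hk ε ξ)
  · filter_upwards [ae_norm_ne hk] with ξ hξ
    have hZ := Z_ne_zero hk hξ
    have hcont : ContinuousAt (fun κ : ℂ => root κ ‖ξ‖) (-(Complex.I * k)) :=
      ContinuousAt.comp (f := fun κ : ℂ => (κ, ‖ξ‖))
        (continuousAt_root (p := (-(Complex.I * k), ‖ξ‖)) (by simp))
        (Continuous.continuousAt (by fun_prop))
    have hlim := hcont.tendsto.comp (tendsto_sub_I_mul k)
    rw [root_neg_I_mul hk] at hlim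
    have hne : -(Complex.I * Z k ξ) ≠ 0 := neg_ne_zero.2 (mul_ne_zero Complex.I_ne_zero hZ)
    have h1 := (((hlim.const_mul (t : ℂ)).neg.cexp.div hlim hne).const_mul (phase ξ x)).mul_const
      (c ξ)
    have h2 : phase ξ x * (Complex.exp (-(t * -(Complex.I * Z k ξ))) / -(Complex.I * Z k ξ)) *
        c ξ = Complex.I * (phase ξ x * (Complex.exp (Complex.I * (t * Z k ξ)) / Z k ξ) * c ξ) := by
      have h3 : -((t : ℂ) * -(Complex.I * Z k ξ)) = Complex.I * (t * Z k ξ) := by ring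
      have h4 : (-(Complex.I * Z k ξ))⁻¹ = Complex.I * (Z k ξ)⁻¹ := by
        rw [inv_neg, mul_inv, Complex.inv_I]; ring
      rw [h3, div_eq_mul_inv, h4, div_eq_mul_inv]
      ring
    rw [h2] at h1
    exact h1

/-- A kernel `g κ r` that is holomorphic in the wave number `κ` on the right half plane and is
locally bounded there, uniformly for `r` away from `0`; for `κ > 0` it is the exponentially decaying
fundamental solution, and it tends to `G` as `κ → -ik` along `κ = ε - ik`. -/
structure IsContinuedKernel (d : ℕ) (k : ℝ) (g : ℂ → ℝ → ℂ) (G : ℝ → ℂ) : Prop where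
  differentiableOn : ∀ r, 0 < r → DifferentiableOn ℂ (g · r) rightHalfPlane
  continuousOn : ∀ κ ∈ rightHalfPlane, ContinuousOn (g κ) (Ioi 0)
  bound : ∀ κ ∈ rightHalfPlane, ∀ r₀, 0 < r₀ →
    ∃ V ∈ 𝓝 κ, ∃ C, ∀ w ∈ V, ∀ r, r₀ ≤ r → ‖g w r‖ ≤ C
  eq_heat : ∀ κ r : ℝ, 0 < κ → 0 < r →
    g κ r = ((∫ s in Ioi (0 : ℝ), heat (d + 1) κ r s : ℝ) : ℂ)
  tendsto : ∀ r, 0 < r → Tendsto (fun ε : ℝ => g (ε - Complex.I * k) r) (𝓝[>] 0) (𝓝 (G r))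
  bound_limit : ∀ r₀, 0 < r₀ →
    ∃ C, ∀ ε : ℝ, 0 < ε → ∀ r, r₀ ≤ r → ‖g (ε - Complex.I * k) r‖ ≤ C

/-- The spectral representation of the single layer potential off the plane of the screen. -/
theorem integral_kernel_mul_eq_fourier {d : ℕ} (hd : d = 1 ∨ d = 2) {k : ℝ} (hk : 0 < k)
    {g : ℂ → ℝ → ℂ} {G : ℝ → ℂ} (hg : IsContinuedKernel d k g G) {t : ℝ} (ht : 0 < t)
    {φ : E d → ℂ} (hφ : Integrable φ) (hφ' : Integrable (hat φ))
    (hφZ : Integrable fun ξ => hat φ ξ / Z k ξ) (x : E d) :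
    ∫ y, G (Real.sqrt (‖x - y‖ ^ 2 + t ^ 2)) * φ y =
      Complex.I * coeff d * ∫ ξ, phase ξ x * (Complex.exp (Complex.I * (t * Z k ξ)) / Z k ξ) *
        hat φ ξ := by
  have hr : ∀ y, t ≤ Real.sqrt (‖x - y‖ ^ 2 + t ^ 2) := fun y =>
    Real.le_sqrt_of_sq_le (by nlinarith [sq_nonneg ‖x - y‖])
  have hcont : ∀ κ ∈ rightHalfPlane,
      Continuous fun y => g κ (Real.sqrt (‖x - y‖ ^ 2 + t ^ 2)) := fun κ hκ =>
    (hg.continuousOn κ hκ).comp_continuous (by fun_prop) fun y => ht.trans_le (hr y)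
  set L : ℂ → ℂ := fun κ => ∫ y, g κ (Real.sqrt (‖x - y‖ ^ 2 + t ^ 2)) * φ y with hL
  set R : ℂ → ℂ := fun κ => coeff d * ∫ ξ, phase ξ x *
    (Complex.exp (-(t * root κ ‖ξ‖)) / root κ ‖ξ‖) * hat φ ξ with hR
  have hLd : DifferentiableOn ℂ L rightHalfPlane := by
    refine differentiableOn_integral_of_locally_dominated isOpen_rightHalfPlane
      (fun z hz => (hcont z hz).aestronglyMeasurable.mul hφ.1)
      (Eventually.of_forall fun y => (hg.differentiableOn _ (ht.trans_le (hr y))).mul_const _)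
      fun z hz => ?_
    obtain ⟨V, hV, C, hC⟩ := hg.bound z hz t ht
    refine ⟨V, hV, fun y => C * ‖φ y‖, hφ.norm.const_mul _, Eventually.of_forall fun y w hw => ?_⟩
    rw [norm_mul]
    exact mul_le_mul_of_nonneg_right (hC w hw _ (hr y)) (norm_nonneg _)
  have hRd : DifferentiableOn ℂ R rightHalfPlane := (differentiableOn_spectral hφ' ht.le x).const_mul _
  have hreal : ∀ κ : ℝ, 0 < κ → L κ = R κ := by
    intro κ hκ
    simp only [hL, hR, hg.eq_heat κ _ hκ (ht.trans_le (hr _)), root_ofReal hκ]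
    rw [integral_heat_mul_eq_fourier hd hκ ht hφ hφ' x]
    push_cast
    rfl
  -- the two sides agree on the ray `κ > 0`, which accumulates at `κ = 1`
  have hfreq : ∃ᶠ z in 𝓝[≠] (1 : ℂ), L z = R z := by
    have h1 : Tendsto (fun τ : ℝ => (τ : ℂ)) (𝓝[>] 1) (𝓝[≠] 1) := by
      refine tendsto_nhdsWithin_iff.2 ⟨?_, ?_⟩
      · have := Complex.continuous_ofReal.tendsto 1
        rw [Complex.ofReal_one] at this
        exact this.mono_left nhdsWithin_le_nhds
      · filter_upwards [self_mem_nhdsWithin] with τ hτ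
        have hτ' : (1 : ℝ) < τ := hτ
        simpa using hτ'.ne'
    refine h1.frequently (Eventually.frequently ?_)
    filter_upwards [self_mem_nhdsWithin] with τ hτ
    exact hreal τ (zero_lt_one.trans hτ)
  have heq : EqOn L R rightHalfPlane :=
    (hLd.analyticOnNhd isOpen_rightHalfPlane).eqOn_of_preconnected_of_frequently_eq
      (hRd.analyticOnNhd isOpen_rightHalfPlane) isPreconnected_rightHalfPlane
      (show (1 : ℂ) ∈ rightHalfPlane by simp [rightHalfPlane]) hfreq
  have hlimR := (tendsto_spectral hk hφ'.1 hφZ ht.le x).const_mul (coeff d)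
  have hlimL : Tendsto (fun ε : ℝ => L (ε - Complex.I * k)) (𝓝[>] 0)
      (𝓝 (∫ y, G (Real.sqrt (‖x - y‖ ^ 2 + t ^ 2)) * φ y)) := by
    obtain ⟨C, hC⟩ := hg.bound_limit t ht
    refine tendsto_integral_filter_of_dominated_convergence (fun y => C * ‖φ y‖) ?_ ?_
      (hφ.norm.const_mul _) (Eventually.of_forall fun y => ?_)
    · filter_upwards [self_mem_nhdsWithin] with ε hε
      exact (hcont _ (show 0 < ((ε : ℂ) - Complex.I * k).re by
        simpa using hε)).aestronglyMeasurable.mul hφ.1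
    · filter_upwards [self_mem_nhdsWithin] with ε hε
      refine Eventually.of_forall fun y => ?_
      rw [norm_mul]
      exact mul_le_mul_of_nonneg_right (hC ε hε _ (hr y)) (norm_nonneg _)
    · exact (hg.tendsto _ (ht.trans_le (hr y))).mul_const _
  have hlimL' := hlimL.congr' (f₂ := fun ε : ℝ => R (ε - Complex.I * k)) (by
    filter_upwards [self_mem_nhdsWithin] with ε hε
    exact heq (show 0 < ((ε : ℂ) - Complex.I * k).re by simpa using hε))
  rw [tendsto_nhds_unique hlimL' hlimR]
  ring

/-! ### The Hankel function as a boundary value of the Macdonald function -/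

/-- The Macdonald function `K₀(z)`, `Re z > 0`. -/
def besselK0 (z : ℂ) : ℂ := ∫ u in Ioi (0 : ℝ), Complex.exp (-(z * Real.cosh u))

/-- The analytic continuation of `K₀` to `Im z < 0`, from the contour which runs from `0` to `iπ/2`
and then parallel to the real axis. -/
def besselK0Lower (z : ℂ) : ℂ :=
  Complex.I * (∫ θ in Ioc (0 : ℝ) (Real.pi / 2), Complex.exp (-(z * Real.cos θ))) +
    ∫ u in Ioi (0 : ℝ), Complex.exp (-(Complex.I * z * Real.sinh u))

theorem integrableOn_exp_neg_mul {b : ℝ} (hb : 0 < b) :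
    IntegrableOn (fun u => Real.exp (-(b * u))) (Ioi 0) := by
  simpa [neg_mul] using exp_neg_integrableOn_Ioi 0 hb

theorem norm_exp_cosh_le {z : ℂ} {b u : ℝ} (hb : 0 ≤ b) (hz : b ≤ z.re) (hu : 0 ≤ u) :
    ‖Complex.exp (-(z * Real.cosh u))‖ ≤ Real.exp (-(b * u)) := by
  rw [Complex.norm_exp, Real.exp_le_exp, Complex.neg_re, Complex.re_mul_ofReal, neg_le_neg_iff]
  have h1 : u ≤ Real.cosh u := (Real.self_le_sinh_iff.2 hu).trans (Real.sinh_lt_cosh u).le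
  exact mul_le_mul hz h1 hu (hb.trans hz)

theorem norm_exp_sinh_le {z : ℂ} {b u : ℝ} (hb : 0 ≤ b) (hz : z.im ≤ -b) (hu : 0 ≤ u) :
    ‖Complex.exp (-(Complex.I * z * Real.sinh u))‖ ≤ Real.exp (-(b * u)) := by
  rw [Complex.norm_exp, Real.exp_le_exp, Complex.neg_re, Complex.re_mul_ofReal, neg_le_neg_iff]
  have h1 : u ≤ Real.sinh u := Real.self_le_sinh_iff.2 hu
  have h2 : (Complex.I * z).re = -z.im := by simp
  rw [h2]
  exact mul_le_mul (by linarith) h1 hu (by linarith)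

theorem norm_exp_cos_le (z : ℂ) (θ : ℝ) :
    ‖Complex.exp (-(z * Real.cos θ))‖ ≤ Real.exp ‖z‖ := by
  rw [Complex.norm_exp, Real.exp_le_exp]
  refine (Complex.re_le_norm _).trans ?_
  rw [norm_neg, norm_mul, Complex.norm_real]
  exact mul_le_of_le_one_right (norm_nonneg _) (Real.abs_cos_le_one θ)

theorem norm_besselK0_le {z : ℂ} {b : ℝ} (hb : 0 < b) (hz : b ≤ z.re) :
    ‖besselK0 z‖ ≤ ∫ u in Ioi (0 : ℝ), Real.exp (-(b * u)) :=
  norm_integral_le_of_norm_le (integrableOn_exp_neg_mul hb)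
    ((ae_restrict_iff' measurableSet_Ioi).2 (Eventually.of_forall fun _ hu =>
      norm_exp_cosh_le hb.le hz (le_of_lt hu)))

theorem differentiableOn_besselK0 : DifferentiableOn ℂ besselK0 rightHalfPlane := by
  refine differentiableOn_integral_of_locally_dominated isOpen_rightHalfPlane
    (fun z _ => Continuous.aestronglyMeasurable (by fun_prop))
    (Eventually.of_forall fun u => Differentiable.differentiableOn (by fun_prop)) fun z hz => ?_
  have hz' : 0 < z.re := hz
  exact ⟨{w | z.re / 2 < w.re}, (isOpen_lt continuous_const Complex.continuous_re).mem_nhds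
    (show z.re / 2 < z.re by linarith), _, integrableOn_exp_neg_mul (half_pos hz'),
    (ae_restrict_iff' measurableSet_Ioi).2 (Eventually.of_forall fun u hu w hw =>
      norm_exp_cosh_le (half_pos hz').le (le_of_lt hw) (le_of_lt hu))⟩

theorem isOpen_lowerHalfPlane : IsOpen {z : ℂ | z.im < 0} :=
  isOpen_lt Complex.continuous_im continuous_const

theorem differentiableOn_besselK0Lower : DifferentiableOn ℂ besselK0Lower {z | z.im < 0} := by
  refine DifferentiableOn.add (DifferentiableOn.const_mul ?_ _) ?_
  · refine differentiableOn_integral_of_locally_dominated isOpen_lowerHalfPlane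
      (fun z _ => Continuous.aestronglyMeasurable (by fun_prop))
      (Eventually.of_forall fun u => Differentiable.differentiableOn (by fun_prop)) fun z _ => ?_
    refine ⟨Metric.ball z 1, Metric.ball_mem_nhds z one_pos, fun _ => Real.exp (‖z‖ + 1),
      integrable_const _, Eventually.of_forall fun θ w hw => (norm_exp_cos_le w θ).trans ?_⟩
    rw [Real.exp_le_exp]
    have := norm_sub_norm_le w z
    rw [Metric.mem_ball, dist_eq_norm] at hw
    linarith
  · refine differentiableOn_integral_of_locally_dominated isOpen_lowerHalfPlane
      (fun z _ => Continuous.aestronglyMeasurable (by fun_prop))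
      (Eventually.of_forall fun u => Differentiable.differentiableOn (by fun_prop)) fun z hz => ?_
    have hz' : z.im < 0 := hz
    exact ⟨{w | w.im < z.im / 2}, (isOpen_lt Complex.continuous_im continuous_const).mem_nhds
      (show z.im < z.im / 2 by linarith), _, integrableOn_exp_neg_mul (b := -(z.im / 2))
        (by linarith),
      (ae_restrict_iff' measurableSet_Ioi).2 (Eventually.of_forall fun u hu w hw =>
        norm_exp_sinh_le (b := -(z.im / 2)) (by linarith)
          (by rw [neg_neg]; exact le_of_lt hw) (le_of_lt hu))⟩

/-- On the quadrant `Re z > 0 > Im z`, Cauchy's theorem for the half strip `0 ≤ Im w ≤ π/2`,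
`Re w ≥ 0`, and the entire function `e^{-z cosh w}`. -/
theorem besselK0_eq_lower {z : ℂ} (hre : 0 < z.re) (him : z.im < 0) :
    besselK0 z = besselK0Lower z := by
  set f : ℂ → ℂ := fun w => Complex.exp (-(z * Complex.cosh w)) with hf
  have hrect : ∀ R : ℝ, (∫ x : ℝ in (0 : ℝ)..R, Complex.exp (-(z * Real.cosh x))) -
      (∫ x : ℝ in (0 : ℝ)..R, Complex.exp (-(Complex.I * z * Real.sinh x))) +
      Complex.I * (∫ y : ℝ in (0 : ℝ)..(Real.pi / 2), f (R + y * Complex.I)) -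
      Complex.I * (∫ y : ℝ in (0 : ℝ)..(Real.pi / 2), Complex.exp (-(z * Real.cos y))) = 0 := by
    intro R
    have h := Complex.integral_boundary_rect_eq_zero_of_differentiableOn f 0
      ((R : ℂ) + (Real.pi / 2 : ℝ) * Complex.I)
      (Differentiable.differentiableOn (by simp only [hf]; fun_prop))
    have hw : ((R : ℂ) + (Real.pi / 2 : ℝ) * Complex.I).re = R := by simp
    have hw' : ((R : ℂ) + (Real.pi / 2 : ℝ) * Complex.I).im = Real.pi / 2 := by simp
    rw [hw, hw', Complex.zero_re, Complex.zero_im] at h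
    have e1 : ∀ x : ℝ, f (x + (0 : ℝ) * Complex.I) = Complex.exp (-(z * Real.cosh x)) := by
      intro x; simp [hf]
    have e2 : ∀ x : ℝ, f (x + (Real.pi / 2 : ℝ) * Complex.I) =
        Complex.exp (-(Complex.I * z * Real.sinh x)) := by
      intro x
      simp only [hf, Complex.cosh_add, Complex.cosh_mul_I, Complex.sinh_mul_I,
        ← Complex.ofReal_cos, ← Complex.ofReal_sin, Real.cos_pi_div_two, Real.sin_pi_div_two]
      congr 1
      push_cast
      ring
    have e3 : ∀ y : ℝ, f ((0 : ℝ) + y * Complex.I) = Complex.exp (-(z * Real.cos y)) := by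
      intro y; simp [hf, Complex.cosh_mul_I]
    simp only [e1, e2, e3, smul_eq_mul] at h
    exact h
  have hK : IntegrableOn (fun u : ℝ => Complex.exp (-(z * Real.cosh u))) (Ioi 0) :=
    (integrableOn_exp_neg_mul hre).mono' (Continuous.aestronglyMeasurable (by fun_prop))
      ((ae_restrict_iff' measurableSet_Ioi).2 (Eventually.of_forall fun u hu =>
        norm_exp_cosh_le hre.le le_rfl (le_of_lt hu)))
  have hF : IntegrableOn (fun u : ℝ => Complex.exp (-(Complex.I * z * Real.sinh u))) (Ioi 0) :=
    (integrableOn_exp_neg_mul (b := -z.im) (by linarith)).mono'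
      (Continuous.aestronglyMeasurable (by fun_prop))
      ((ae_restrict_iff' measurableSet_Ioi).2 (Eventually.of_forall fun u hu =>
        norm_exp_sinh_le (by linarith) (by simp) (le_of_lt hu)))
  have hlim1 := intervalIntegral_tendsto_integral_Ioi 0 hK tendsto_id
  have hlim2 := intervalIntegral_tendsto_integral_Ioi 0 hF tendsto_id
  -- the contribution of the far side of the rectangle is at most `e^{-mR} π/2`
  set m := min z.re (-z.im) with hm
  have hm0 : 0 < m := lt_min hre (by linarith)
  have hlim3 : Tendsto (fun R : ℝ => ∫ y : ℝ in (0 : ℝ)..(Real.pi / 2), f (R + y * Complex.I))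
      atTop (𝓝 0) := by
    have hb : ∀ R : ℝ, 0 ≤ R → ‖∫ y : ℝ in (0 : ℝ)..(Real.pi / 2), f (R + y * Complex.I)‖ ≤
        Real.exp (-(m * R)) * |Real.pi / 2 - 0| := by
      intro R hR
      refine intervalIntegral.norm_integral_le_of_norm_le_const fun y hy => ?_
      rw [uIoc_of_le (by positivity)] at hy
      have hs : 0 ≤ Real.sin y := Real.sin_nonneg_of_nonneg_of_le_pi hy.1.le
        (by linarith [hy.2, Real.pi_pos])
      have hc : 0 ≤ Real.cos y := Real.cos_nonneg_of_neg_pi_div_two_le_of_le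
        (by linarith [hy.1, Real.pi_pos]) hy.2
      have hcs : 1 ≤ Real.cos y + Real.sin y := by
        nlinarith [Real.sin_sq_add_cos_sq y, mul_nonneg hs hc]
      have hsinh : R ≤ Real.sinh R := Real.self_le_sinh_iff.2 hR
      have hcosh : Real.sinh R ≤ Real.cosh R := (Real.sinh_lt_cosh R).le
      have h1 : m ≤ z.re := min_le_left _ _
      have h2 : m ≤ -z.im := min_le_right _ _
      have hcosh_eq : Complex.cosh (R + y * Complex.I) =
          ((Real.cosh R * Real.cos y : ℝ) : ℂ) + ((Real.sinh R * Real.sin y : ℝ) : ℂ) * Complex.I := by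
        rw [Complex.cosh_add, Complex.cosh_mul_I, Complex.sinh_mul_I]
        push_cast; ring
      simp only [hf]
      rw [Complex.norm_exp, Real.exp_le_exp, Complex.neg_re, neg_le_neg_iff, hcosh_eq,
        Complex.mul_re]
      simp only [Complex.add_re, Complex.add_im, Complex.ofReal_re, Complex.ofReal_im,
        Complex.mul_re, Complex.mul_im, Complex.I_re, Complex.I_im, mul_zero, mul_one, zero_add,
        sub_zero, add_zero]
      have h3 : m * (R * Real.cos y) ≤ z.re * (Real.cosh R * Real.cos y) :=
        mul_le_mul h1 (mul_le_mul_of_nonneg_right (hsinh.trans hcosh) hc) (by positivity) hre.le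
      have h4 : m * (R * Real.sin y) ≤ -z.im * (Real.sinh R * Real.sin y) :=
        mul_le_mul h2 (mul_le_mul_of_nonneg_right hsinh hs) (by positivity) (by linarith)
      have h5 : m * R * 1 ≤ m * R * (Real.cos y + Real.sin y) :=
        mul_le_mul_of_nonneg_left hcs (by positivity)
      linarith
    have hz : Tendsto (fun R : ℝ => Real.exp (-(m * R)) * |Real.pi / 2 - 0|) atTop (𝓝 0) := by
      have h1 : Tendsto (fun R : ℝ => Real.exp (-(m * R))) atTop (𝓝 0) :=
        Real.tendsto_exp_neg_atTop_nhds_zero.comp (tendsto_id.const_mul_atTop hm0)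
      simpa using h1.mul_const |Real.pi / 2 - 0|
    exact squeeze_zero_norm' (by filter_upwards [eventually_ge_atTop 0] with R hR using hb R hR) hz
  have hlim := ((hlim1.sub hlim2).add (hlim3.const_mul Complex.I)).sub
    (tendsto_const_nhds (x := Complex.I *
      (∫ y : ℝ in (0 : ℝ)..(Real.pi / 2), Complex.exp (-(z * Real.cos y)))))
  have hzero := tendsto_nhds_unique (hlim.congr fun R => hrect R) tendsto_const_nhds
  rw [intervalIntegral.integral_of_le (by positivity)] at hzero
  rw [besselK0, besselK0Lower]
  linear_combination hzero

/-- Transfers the integrals over `[0, π]` that define `J₀` and `Y₀` to `[0, π/2]`. -/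
theorem integral_comp_sin_eq {f : ℝ → ℝ} (hf : Continuous f) :
    ∫ θ in (0 : ℝ)..Real.pi, f (Real.sin θ) =
      2 * ∫ θ in (0 : ℝ)..(Real.pi / 2), f (Real.cos θ) := by
  have h1 := intervalIntegral.integral_comp_add_right (a := -(Real.pi / 2)) (b := Real.pi / 2)
    (fun θ => f (Real.sin θ)) (Real.pi / 2)
  simp only [Real.sin_add_pi_div_two, neg_add_cancel, add_halves] at h1
  have h2 := intervalIntegral.integral_comp_neg (a := 0) (b := Real.pi / 2)
    (fun θ => f (Real.cos θ))
  simp only [Real.cos_neg, neg_zero] at h2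
  have hi : ∀ a b : ℝ, IntervalIntegrable (fun θ => f (Real.cos θ)) volume a b := fun a b =>
    (hf.comp Real.continuous_cos).intervalIntegrable a b
  rw [← h1, ← intervalIntegral.integral_add_adjacent_intervals (hi _ 0) (hi 0 _), ← h2]
  ring

/-- The boundary value of `K₀` on the imaginary axis is `K₀(-ix) = (πi/2) H₀⁽¹⁾(x)`. -/
theorem besselK0Lower_neg_I_mul (x : ℝ) :
    besselK0Lower (-(Complex.I * x)) = Real.pi * Complex.I / 2 * hankel0 x := by
  have h1 : ∫ u in Ioi (0 : ℝ), Complex.exp (-(Complex.I * -(Complex.I * x) * Real.sinh u)) =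
      ((∫ u in Ioi (0 : ℝ), Real.exp (-(x * Real.sinh u)) : ℝ) : ℂ) := by
    rw [← integral_complex_ofReal]
    refine integral_congr_ae (Eventually.of_forall fun u => ?_)
    simp only
    rw [Complex.ofReal_exp]
    congr 1
    push_cast
    linear_combination (x * Complex.sinh u) * Complex.I_sq
  have h2 : ∫ θ in (0 : ℝ)..(Real.pi / 2), Complex.exp (-(-(Complex.I * x) * Real.cos θ)) =
      ((∫ θ in (0 : ℝ)..(Real.pi / 2), Real.cos (x * Real.cos θ) : ℝ) : ℂ) +
      Complex.I * ((∫ θ in (0 : ℝ)..(Real.pi / 2), Real.sin (x * Real.cos θ) : ℝ) : ℂ) := by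
    rw [← intervalIntegral.integral_ofReal, ← intervalIntegral.integral_ofReal,
      ← intervalIntegral.integral_const_mul, ← intervalIntegral.integral_add]
    · refine intervalIntegral.integral_congr fun θ _ => ?_
      have : -(-(Complex.I * (x : ℂ)) * (Real.cos θ : ℂ)) =
        ((x * Real.cos θ : ℝ) : ℂ) * Complex.I := by push_cast; ring
      rw [this, Complex.exp_mul_I, Complex.ofReal_cos, Complex.ofReal_sin]
      ring
    · exact Continuous.intervalIntegrable (by fun_prop) _ _
    · exact Continuous.intervalIntegrable (by fun_prop) _ _
  have h3 := integral_comp_sin_eq (f := fun s => Real.cos (x * s)) (by fun_prop)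
  have h4 := integral_comp_sin_eq (f := fun s => Real.sin (x * s)) (by fun_prop)
  rw [besselK0Lower, h1, ← intervalIntegral.integral_of_le (by positivity), h2, hankel0, besselJ0,
    besselY0, h3, h4]
  have hpi : (Real.pi : ℂ) ≠ 0 := by exact_mod_cast Real.pi_ne_zero
  push_cast
  generalize ((∫ θ in (0 : ℝ)..(Real.pi / 2), Real.cos (x * Real.cos θ) : ℝ) : ℂ) = A
  generalize ((∫ θ in (0 : ℝ)..(Real.pi / 2), Real.sin (x * Real.cos θ) : ℝ) : ℂ) = B
  generalize ((∫ u in Ioi (0 : ℝ), Real.exp (-(x * Real.sinh u)) : ℝ) : ℂ) = C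
  field_simp
  linear_combination C * Complex.I_sq

theorem norm_besselK0Lower_le {z : ℂ} {b : ℝ} (hb : 0 < b) (hre : 0 ≤ z.re) (him : z.im ≤ -b) :
    ‖besselK0Lower z‖ ≤ Real.pi / 2 + ∫ u in Ioi (0 : ℝ), Real.exp (-(b * u)) := by
  refine (norm_add_le _ _).trans (add_le_add ?_ ?_)
  · rw [norm_mul, Complex.norm_I, one_mul]
    refine (norm_setIntegral_le_of_norm_le_const (C := 1) measure_Ioc_lt_top fun θ hθ => ?_).trans ?_
    · rw [Complex.norm_exp, Real.exp_le_one_iff, Complex.neg_re, Complex.re_mul_ofReal]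
      have hc : 0 ≤ Real.cos θ := Real.cos_nonneg_of_neg_pi_div_two_le_of_le
        (by linarith [hθ.1, Real.pi_pos]) hθ.2
      have := mul_nonneg hre hc
      linarith
    · rw [Real.volume_real_Ioc_of_le (by positivity)]; simp
  · exact norm_integral_le_of_norm_le (integrableOn_exp_neg_mul hb)
      ((ae_restrict_iff' measurableSet_Ioi).2 (Eventually.of_forall fun _ hu =>
        norm_exp_sinh_le hb.le him (le_of_lt hu)))

/-! ### The fundamental solutions as continued kernels -/

/-- The fundamental solution as a function of the distance. -/
def radialSol (d : ℕ) (k r : ℝ) : ℂ :=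
  if d = 2 then Complex.exp (Complex.I * (k * r : ℝ)) / ((4 * Real.pi * r : ℝ) : ℂ)
  else Complex.I / 4 * hankel0 (k * r)

theorem fundSol_eq_radialSol {d : ℕ} (k : ℝ) (x y : E (d + 1)) :
    fundSol k x y = radialSol d k ‖x - y‖ := rfl

theorem isContinuedKernel_one {k : ℝ} (hk : 0 < k) :
    IsContinuedKernel 1 k (fun κ r => (2 * Real.pi : ℂ)⁻¹ * besselK0 (κ * r)) (radialSol 1 k) := by
  have hmem : ∀ κ ∈ rightHalfPlane, ∀ r : ℝ, 0 < r → κ * r ∈ rightHalfPlane := by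
    intro κ hκ r hr
    have hκ' : 0 < κ.re := hκ
    show 0 < (κ * r).re
    rw [Complex.re_mul_ofReal]; positivity
  have hlow : ∀ ε r : ℝ, 0 < ε → 0 < r → besselK0 ((ε - Complex.I * k) * r) =
      besselK0Lower ((ε - Complex.I * k) * r) := by
    intro ε r hε hr
    refine besselK0_eq_lower (hmem _ (show 0 < ((ε : ℂ) - Complex.I * k).re by simpa using hε) r hr)
      ?_
    rw [Complex.im_mul_ofReal]
    have : 0 < k * r := by positivity
    simpa using this
  refine ⟨fun r hr => ?_, fun κ hκ => ?_, fun κ hκ r₀ hr₀ => ?_, fun κ r hκ hr => ?_,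
    fun r hr => ?_, fun r₀ hr₀ => ?_⟩
  · exact (differentiableOn_besselK0.comp (Differentiable.differentiableOn (by fun_prop))
      fun κ hκ => hmem κ hκ r hr).const_mul _
  · exact (differentiableOn_besselK0.continuousOn.comp (f := fun r : ℝ => κ * r)
      (Continuous.continuousOn (by fun_prop)) fun r hr => hmem κ hκ r hr).const_mul _
  · have hκ' : 0 < κ.re := hκ
    refine ⟨{w | κ.re / 2 < w.re}, (isOpen_lt continuous_const Complex.continuous_re).mem_nhds
      (show κ.re / 2 < κ.re by linarith), ‖(2 * Real.pi : ℂ)⁻¹‖ *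
      ∫ u in Ioi (0 : ℝ), Real.exp (-((κ.re / 2 * r₀) * u)), fun w hw r hr => ?_⟩
    rw [norm_mul]
    refine mul_le_mul_of_nonneg_left (norm_besselK0_le (by positivity) ?_) (norm_nonneg _)
    rw [Complex.re_mul_ofReal]
    exact mul_le_mul (le_of_lt hw) hr hr₀.le (by linarith [show κ.re / 2 < w.re from hw])
  · have hrr : (1 : ℕ) + 1 = 2 := rfl
    rw [hrr, (integral_heat_dim_two hκ hr).2, besselK0]
    push_cast
    rw [← integral_complex_ofReal]
    congr 1
    refine integral_congr_ae (Eventually.of_forall fun u => ?_)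
    simp
  · have hd : ContinuousAt besselK0Lower (-(Complex.I * (k * r : ℝ))) := by
      refine (differentiableOn_besselK0Lower.differentiableAt
        (isOpen_lowerHalfPlane.mem_nhds ?_)).continuousAt
      have : 0 < k * r := by positivity
      simpa using this
    have h1 : Tendsto (fun ε : ℝ => ((ε : ℂ) - Complex.I * k) * r) (𝓝[>] 0)
        (𝓝 (-(Complex.I * (k * r : ℝ)))) := by
      have := (tendsto_sub_I_mul k).mul_const (r : ℂ)
      have h2 : -(Complex.I * (k : ℂ)) * (r : ℂ) = -(Complex.I * ((k * r : ℝ) : ℂ)) := by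
        push_cast; ring
      rwa [h2] at this
    have h3 := (hd.tendsto.comp h1).const_mul ((2 * Real.pi : ℂ)⁻¹)
    have h4 : (2 * Real.pi : ℂ)⁻¹ * besselK0Lower (-(Complex.I * (k * r : ℝ))) =
        radialSol 1 k r := by
      rw [besselK0Lower_neg_I_mul, radialSol, if_neg (by norm_num)]
      have hpi : (Real.pi : ℂ) ≠ 0 := by exact_mod_cast Real.pi_ne_zero
      field_simp
      ring
    rw [h4] at h3
    refine h3.congr' ?_
    filter_upwards [self_mem_nhdsWithin] with ε hε
    simp only [Function.comp_apply]
    rw [hlow ε r hε hr]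
  · refine ⟨‖(2 * Real.pi : ℂ)⁻¹‖ * (Real.pi / 2 + ∫ u in Ioi (0 : ℝ), Real.exp (-((k * r₀) * u))),
      fun ε hε r hr => ?_⟩
    have hr0 : 0 < r := hr₀.trans_le hr
    rw [hlow ε r hε hr0, norm_mul]
    refine mul_le_mul_of_nonneg_left (norm_besselK0Lower_le (by positivity) ?_ ?_) (norm_nonneg _)
    · rw [Complex.re_mul_ofReal]
      have : 0 ≤ ε * r := by positivity
      simpa using this
    · rw [Complex.im_mul_ofReal]
      have : k * r₀ ≤ k * r := by gcongr
      simpa using this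

theorem isContinuedKernel_two {k : ℝ} :
    IsContinuedKernel 2 k (fun κ r => Complex.exp (-(κ * r)) / ((4 * Real.pi * r : ℝ) : ℂ))
      (radialSol 2 k) := by
  have hne : ∀ r : ℝ, 0 < r → ((4 * Real.pi * r : ℝ) : ℂ) ≠ 0 := fun r hr => by
    have := Real.pi_pos
    exact_mod_cast (by positivity : 4 * Real.pi * r ≠ 0)
  have hb : ∀ (κ : ℂ) (r r₀ : ℝ), 0 ≤ κ.re → 0 < r₀ → r₀ ≤ r →
      ‖Complex.exp (-(κ * r)) / ((4 * Real.pi * r : ℝ) : ℂ)‖ ≤ (4 * Real.pi * r₀)⁻¹ := by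
    intro κ r r₀ hκ hr₀ hr
    have hpi := Real.pi_pos
    have hr0 : 0 < r := hr₀.trans_le hr
    rw [norm_div, div_eq_mul_inv, Complex.norm_real, Real.norm_of_nonneg (by positivity)]
    refine (mul_le_of_le_one_left (by positivity) ?_).trans
      (inv_anti₀ (by positivity) (by gcongr))
    rw [Complex.norm_exp, Real.exp_le_one_iff, Complex.neg_re, Complex.re_mul_ofReal]
    have := mul_nonneg hκ hr0.le
    linarith
  refine ⟨fun r hr => ?_, fun κ hκ => ?_, fun κ hκ r₀ hr₀ => ?_, fun κ r hκ hr => ?_,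
    fun r hr => ?_, fun r₀ hr₀ => ?_⟩
  · exact Differentiable.differentiableOn (by fun_prop)
  · exact ContinuousOn.div (Continuous.continuousOn (by fun_prop))
      (Continuous.continuousOn (by fun_prop)) fun r hr => hne r hr
  · exact ⟨rightHalfPlane, isOpen_rightHalfPlane.mem_nhds hκ, (4 * Real.pi * r₀)⁻¹,
      fun w hw r hr => hb w r r₀ (le_of_lt hw) hr₀ hr⟩
  · have hrr : (2 : ℕ) + 1 = 3 := rfl
    rw [hrr, (integral_heat_dim_three hκ hr).2]
    push_cast
    rfl
  · have h1 := ((tendsto_sub_I_mul k).mul_const (r : ℂ)).neg.cexp.div_const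
      ((4 * Real.pi * r : ℝ) : ℂ)
    have h2 : -(-(Complex.I * (k : ℂ)) * (r : ℂ)) = Complex.I * ((k * r : ℝ) : ℂ) := by
      push_cast; ring
    rw [h2] at h1
    rw [radialSol, if_pos rfl]
    exact h1
  · exact ⟨(4 * Real.pi * r₀)⁻¹, fun ε hε r hr =>
      hb _ r r₀ (by simpa using hε.le) hr₀ hr⟩

/-- The derivative of the fundamental solution with respect to the distance. -/
def radialSolDeriv (d : ℕ) (k r : ℝ) : ℂ := deriv (radialSol d k) r

/-- The fundamental solution is continuously differentiable in the distance; for `d = 1` because the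
Hankel function is a boundary value of the holomorphic function `besselK0Lower`. -/
theorem hasDerivAt_radialSol {d : ℕ} (hd : d = 1 ∨ d = 2) {k : ℝ} (hk : 0 < k) :
    (∀ r, 0 < r → HasDerivAt (radialSol d k) (radialSolDeriv d k r) r) ∧
    ContinuousOn (radialSolDeriv d k) (Ioi 0) := by
  have hC1 : ContDiffOn ℝ 1 (radialSol d k) (Ioi 0) := by
    rcases hd with rfl | rfl
    · have h1 : ∀ r : ℝ, radialSol 1 k r =
          (2 * Real.pi : ℂ)⁻¹ * besselK0Lower (-(Complex.I * k) * r) := by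
        intro r
        have h2 : -(Complex.I * (k : ℂ)) * (r : ℂ) = -(Complex.I * ((k * r : ℝ) : ℂ)) := by
          push_cast; ring
        rw [h2, besselK0Lower_neg_I_mul, radialSol, if_neg (by norm_num)]
        have hpi : (Real.pi : ℂ) ≠ 0 := by exact_mod_cast Real.pi_ne_zero
        field_simp
        ring
      have h3 : ContDiffOn ℝ 1 besselK0Lower {z : ℂ | z.im < 0} :=
        (differentiableOn_besselK0Lower.contDiffOn isOpen_lowerHalfPlane).restrict_scalars ℝ
      have h4 : ContDiff ℝ 1 fun r : ℝ => -(Complex.I * (k : ℂ)) * (r : ℂ) :=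
        contDiff_const.mul Complex.ofRealCLM.contDiff
      have h5 : radialSol 1 k = fun r : ℝ =>
          (2 * Real.pi : ℂ)⁻¹ * besselK0Lower (-(Complex.I * k) * r) := funext h1
      rw [h5]
      refine contDiffOn_const.mul (h3.comp h4.contDiffOn fun r hr => ?_)
      have : 0 < k * r := mul_pos hk hr
      simpa using this
    · have h1 : radialSol 2 k = fun r : ℝ =>
          Complex.exp (Complex.I * (k * r : ℝ)) / ((4 * Real.pi * r : ℝ) : ℂ) := by
        ext r; rw [radialSol, if_pos rfl]
      have h2 : ∀ a : ℝ, ContDiff ℝ 1 fun r : ℝ => ((a * r : ℝ) : ℂ) := fun a =>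
        Complex.ofRealCLM.contDiff.comp (contDiff_const.mul contDiff_id)
      rw [h1]
      simp only [div_eq_mul_inv]
      refine ((contDiff_const.mul (h2 k)).cexp).contDiffOn.mul ((h2 _).contDiffOn.inv ?_)
      intro r hr
      have hr' : 0 < r := hr
      have := Real.pi_pos
      exact_mod_cast (by positivity : 4 * Real.pi * r ≠ 0)
  refine ⟨fun r hr => ?_, hC1.continuousOn_deriv_of_isOpen isOpen_Ioi le_rfl⟩
  exact ((hC1.differentiableOn one_ne_zero).differentiableAt (isOpen_Ioi.mem_nhds hr)).hasDerivAt

/-! ### The layer potentials in the propagation domain -/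

theorem norm_sub_point {d : ℕ} (x : E (d + 1)) (y : E d) (τ : ℝ) :
    ‖x - point y τ‖ = Real.sqrt (‖horiz x - y‖ ^ 2 + (height x - τ) ^ 2) := by
  rw [EuclideanSpace.norm_eq, EuclideanSpace.norm_eq, Fin.sum_univ_castSucc,
    Real.sq_sqrt (Finset.sum_nonneg fun _ _ => sq_nonneg _)]
  simp [point, horiz, height]

theorem point_add_smul_normal {d : ℕ} (y : E d) (τ s : ℝ) :
    point y τ + s • normal d = point y (τ + s) := by
  ext i
  refine Fin.lastCases ?_ (fun j => ?_) i
  · simp [point, normal]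
  · simp [point, normal, (Fin.castSucc_lt_last j).ne]

theorem hasDerivAt_point {d : ℕ} (y : E d) (τ : ℝ) :
    HasDerivAt (fun s => point y s) (normal d) τ := by
  have h : (fun s => point y s) = fun s => point y 0 + s • normal d := by
    ext1 s; rw [point_add_smul_normal, zero_add]
  rw [h]
  simpa using ((hasDerivAt_id τ).smul_const (normal d)).const_add (point y 0)

theorem normalDeriv_eq_of_hasFDerivAt {d : ℕ} {u : E (d + 1) → ℂ} {u' : E (d + 1) →L[ℝ] ℂ}
    {x : E (d + 1)} (h : HasFDerivAt u u' x) : normalDeriv u x = u' (normal d) :=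
  h.hasLineDerivAt (normal d) |>.lineDeriv

theorem jetDifferential_normal {d : ℕ} (a : Fin d → ℂ) (b : ℂ) :
    jetDifferential a b (normal d) = b := by
  have h1 : height (normal d) = 1 := by simp [height, normal]
  have h2 : ∀ j, horiz (normal d) j = 0 := fun j => by
    simp [horiz, normal]
  rw [jetDifferential_apply, h1]
  simp [h2]

theorem hasDerivAt_jetIntegral {d : ℕ} {h : ℕ → E d → ℝ → ℂ} (hh : IsJet h) {c : E d → ℂ}
    (hc : RapidlyIntegrable c) (y : E d) (τ : ℝ) :
    HasDerivAt (fun τ => jetIntegral h c (point y τ))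
      (jetIntegral (fun m => h (m + 1)) c (point y τ)) τ := by
  have h1 := (hasFDerivAt_jetIntegral hh hc (point y τ)).comp_hasDerivAt τ (hasDerivAt_point y τ)
  rwa [jetDifferential_normal] at h1

theorem jetIntegral_point {d : ℕ} (h : ℕ → E d → ℝ → ℂ) (c : E d → ℂ) (y : E d) (t : ℝ) :
    jetIntegral h c (point y t) = ∫ ξ, phase ξ y * h 0 ξ t * c ξ := by
  rw [jetIntegral, horiz_point, height_point]

/-- For `t ≥ 0`, differentiating the propagator multiplies the density by `iZ`. -/
theorem jetIntegral_shift {d : ℕ} {k : ℝ} (hk : 0 < k) (c : E d → ℂ) (y : E d) {t : ℝ}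
    (ht : 0 ≤ t) :
    jetIntegral (fun m => propagatorJet k (m + 1)) c (point y t) =
      Complex.I * jetIntegral (propagatorJet k) (fun ξ => Z k ξ * c ξ) (point y t) := by
  rw [jetIntegral_point, jetIntegral_point, ← integral_const_mul]
  refine integral_congr_ae (Eventually.of_forall fun ξ => ?_)
  simp only [zero_add]
  rw [propagatorJet_one hk ξ ht]
  ring

theorem jetIntegral_congr_ae {d : ℕ} (h : ℕ → E d → ℝ → ℂ) {c c' : E d → ℂ}
    (hc : c =ᵐ[volume] c') : jetIntegral h c = jetIntegral h c' := by
  ext x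
  refine integral_congr_ae ?_
  filter_upwards [hc] with ξ hξ
  rw [hξ]

theorem Z_mul_div_ae {d : ℕ} {k : ℝ} (hk : 0 < k) (c : E d → ℂ) :
    (fun ξ => Z k ξ * (c ξ / Z k ξ)) =ᵐ[volume] c := by
  filter_upwards [ae_norm_ne hk] with ξ hξ
  exact mul_div_cancel₀ _ (Z_ne_zero hk hξ)

theorem spectral_integrand_eq {d : ℕ} (k : ℝ) (ξ y : E d) {t : ℝ} (ht : 0 ≤ t) :
    Complex.exp (Complex.I * ((inner ℝ ξ y : ℝ) + (t : ℝ) * Z k ξ)) =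
      phase ξ y * propagatorJet k 0 ξ t := by
  rw [propagatorJet_zero k ξ ht, phase, ← Complex.exp_add]
  congr 1
  ring

/-- A point of the domain has positive distance from the screen, which keeps the kernels away from
their singularity. -/
theorem exists_dist_le_of_mem_domain {d : ℕ} {Γ : Set (E d)} {x : E (d + 1)} (hx : x ∈ domain Γ) :
    ∃ δ, 0 < δ ∧ ∀ y ∈ Γ, δ ≤ ‖x - point y 0‖ := by
  obtain ⟨δ, hδ, h⟩ := Metric.isOpen_iff.1 isClosed_closure.isOpen_compl x hx
  refine ⟨δ, hδ, fun y hy => ?_⟩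
  by_contra hlt
  have : point y 0 ∈ Metric.ball x δ := by
    rw [Metric.mem_ball, dist_comm, dist_eq_norm]; exact not_le.1 hlt
  exact h this (subset_closure ⟨y, hy, rfl⟩)

theorem continuous_comp_max {f : ℝ → ℂ} (hf : ContinuousOn f (Ioi 0)) {δ : ℝ} (hδ : 0 < δ) :
    Continuous fun r => f (max δ r) :=
  hf.comp_continuous (by fun_prop) fun _ => hδ.trans_le (le_max_left _ _)

theorem testFunction_integrable {d : ℕ} {Γ : Opens (E d)} (φ : 𝓓(Γ, ℂ)) :
    Integrable (φ : E d → ℂ) :=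
  φ.continuous.integrable_of_hasCompactSupport φ.hasCompactSupport

theorem testFunction_eq_zero {d : ℕ} {Γ : Opens (E d)} (φ : 𝓓(Γ, ℂ)) {y : E d} (hy : y ∉ Γ) :
    φ y = 0 :=
  image_eq_zero_of_notMem_tsupport fun h => hy (φ.tsupport_subset h)

theorem rapidlyDecreasing_hat_testFunction {d : ℕ} {Γ : Opens (E d)} (φ : 𝓓(Γ, ℂ)) :
    RapidlyDecreasing (hat φ) :=
  rapidlyDecreasing_hat φ.hasCompactSupport (by simpa using φ.contDiff)

theorem continuousOn_radialSol {d : ℕ} (hd : d = 1 ∨ d = 2) {k : ℝ} (hk : 0 < k) :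
    ContinuousOn (radialSol d k) (Ioi 0) := fun r hr =>
  ((hasDerivAt_radialSol hd hk).1 r hr).continuousAt.continuousWithinAt

/-- Off the closure of the screen a radial kernel is integrable against a test function, whatever its
singularity at distance `0`. -/
theorem integrable_layer_kernel {d : ℕ} {Γ : Opens (E d)} (φ : 𝓓(Γ, ℂ)) {f : ℝ → ℂ}
    (hf : ContinuousOn f (Ioi 0)) {x : E (d + 1)} (hx : x ∈ domain (Γ : Set (E d))) :
    IntegrableOn (fun y => f ‖x - point y 0‖ * φ y) Γ := by
  obtain ⟨δ, hδ, h⟩ := exists_dist_le_of_mem_domain hx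
  have hc : Continuous fun y : E d => f (max δ ‖x - point y 0‖) * φ y := by
    refine Continuous.mul ((continuous_comp_max hf hδ).comp ?_) φ.continuous
    simp only [norm_sub_point]
    fun_prop
  refine (hc.integrable_of_hasCompactSupport φ.hasCompactSupport.mul_left).integrableOn.congr_fun
    (fun y hy => ?_) Γ.isOpen.measurableSet
  simp only
  rw [max_eq_right (h y hy)]

theorem singleLayer_eq_integral {d : ℕ} {Γ : Opens (E d)} (φ : 𝓓(Γ, ℂ)) (k : ℝ) (x : E (d + 1)) :
    singleLayer k Γ φ x =
      ∫ y, radialSol d k (Real.sqrt (‖horiz x - y‖ ^ 2 + height x ^ 2)) * φ y := by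
  rw [singleLayer, setIntegral_eq_integral_of_forall_compl_eq_zero fun y hy => by
    rw [testFunction_eq_zero φ hy, mul_zero]]
  simp only [fundSol_eq_radialSol, norm_sub_point, sub_zero]

/-- The spectral representation off the plane, written with the extended propagator. -/
theorem singleLayer_eq_of_pos {d : ℕ} (hd : d = 1 ∨ d = 2) {k : ℝ} (hk : 0 < k)
    {Γ : Opens (E d)} (φ : 𝓓(Γ, ℂ)) (y₀ : E d) {t : ℝ} (ht : 0 < t) :
    ∫ y, radialSol d k (Real.sqrt (‖y₀ - y‖ ^ 2 + t ^ 2)) * φ y =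
      Complex.I * coeff d *
        jetIntegral (propagatorJet k) (fun ξ => hat φ ξ / Z k ξ) (point y₀ t) := by
  have hd0 : 0 < d := by omega
  have hφ := rapidlyDecreasing_hat_testFunction φ
  have hg : ∃ g, IsContinuedKernel d k g (radialSol d k) := by
    rcases hd with rfl | rfl
    · exact ⟨_, isContinuedKernel_one hk⟩
    · exact ⟨_, isContinuedKernel_two⟩
  obtain ⟨g, hg⟩ := hg
  rw [integral_kernel_mul_eq_fourier hd hk hg ht (testFunction_integrable φ)
    hφ.rapidlyIntegrable.integrable (hφ.div_Z hd0 hk).integrable y₀, jetIntegral_point]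
  congr 1
  refine integral_congr_ae (Eventually.of_forall fun ξ => ?_)
  simp only
  rw [propagatorJet_zero k ξ ht.le]
  ring

/-- The spectral representation of the single layer potential; in the plane of the screen it is
the limit of the representation off the plane. -/
theorem singleLayer_eq {d : ℕ} (hd : d = 1 ∨ d = 2) {k : ℝ} (hk : 0 < k)
    {Γ : Opens (E d)} (φ : 𝓓(Γ, ℂ)) {x : E (d + 1)} (hx : x ∈ domain (Γ : Set (E d))) :
    singleLayer k Γ φ x = Complex.I * coeff d *
      jetIntegral (propagatorJet k) (fun ξ => hat φ ξ / Z k ξ)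
        (point (horiz x) |height x|) := by
  rcases eq_or_ne (height x) 0 with h0 | h0
  · have hd0 : 0 < d := by omega
    obtain ⟨δ, hδ, hdist⟩ := exists_dist_le_of_mem_domain hx
    have hle : ∀ y ∈ Γ, ∀ τ : ℝ, δ ≤ Real.sqrt (‖horiz x - y‖ ^ 2 + τ ^ 2) := by
      intro y hy τ
      refine (hdist y hy).trans ?_
      rw [norm_sub_point, h0]
      exact Real.sqrt_le_sqrt (by nlinarith [sq_nonneg τ])
    -- with the distance replaced by its maximum with `δ`, the integrand is continuous everywhere
    set f : ℝ → E d → ℂ := fun τ y =>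
      radialSol d k (max δ (Real.sqrt (‖horiz x - y‖ ^ 2 + τ ^ 2))) * φ y with hf
    have hfc : Continuous f.uncurry := by
      refine Continuous.mul ((continuous_comp_max (continuousOn_radialSol hd hk) hδ).comp
        (f := fun p : ℝ × E d => Real.sqrt (‖horiz x - p.2‖ ^ 2 + p.1 ^ 2)) (by fun_prop))
        (φ.continuous.comp continuous_snd)
    have hcont := continuous_parametric_integral_of_continuous
      (μ := (volume : Measure (E d))) hfc φ.hasCompactSupport.isCompact
    have heq : ∀ τ : ℝ, ∫ y in tsupport φ, f τ y =
        ∫ y, radialSol d k (Real.sqrt (‖horiz x - y‖ ^ 2 + τ ^ 2)) * φ y := by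
      intro τ
      rw [setIntegral_eq_integral_of_forall_compl_eq_zero fun y hy => by
        rw [hf]; simp only; rw [image_eq_zero_of_notMem_tsupport hy, mul_zero]]
      refine integral_congr_ae (Eventually.of_forall fun y => ?_)
      by_cases hy : y ∈ Γ
      · simp only [hf]; rw [max_eq_right (hle y hy τ)]
      · simp only [hf]; rw [testFunction_eq_zero φ hy, mul_zero, mul_zero]
    simp only [heq] at hcont
    have hjet : Continuous fun τ : ℝ => Complex.I * coeff d *
        jetIntegral (propagatorJet k) (fun ξ => hat φ ξ / Z k ξ) (point (horiz x) τ) := by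
      refine continuous_const.mul ((contDiff_jetIntegral (isJet_propagatorJet hk)
        ((rapidlyDecreasing_hat_testFunction φ).div_Z hd0 hk)).continuous.comp ?_)
      exact contDiff_point.continuous.comp (by fun_prop : Continuous fun τ : ℝ => (horiz x, τ))
    have h1 := (hcont.tendsto 0).mono_left (nhdsWithin_le_nhds (s := Ioi (0 : ℝ)))
    have h2 := (hjet.tendsto 0).mono_left (nhdsWithin_le_nhds (s := Ioi (0 : ℝ)))
    rw [singleLayer_eq_integral, h0, abs_zero]
    refine tendsto_nhds_unique (h1.congr' ?_) h2
    filter_upwards [self_mem_nhdsWithin] with τ hτ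
    exact singleLayer_eq_of_pos hd hk φ _ hτ
  · rw [singleLayer_eq_integral, ← sq_abs (height x)]
    exact singleLayer_eq_of_pos hd hk φ _ (abs_pos.2 h0)

theorem hasDerivAt_radialSol_sqrt {d : ℕ} (hd : d = 1 ∨ d = 2) {k : ℝ} (hk : 0 < k) {a τ : ℝ}
    (ha : 0 < a + τ ^ 2) :
    HasDerivAt (fun τ => radialSol d k (Real.sqrt (a + τ ^ 2)))
      (((τ / Real.sqrt (a + τ ^ 2) : ℝ) : ℂ) * radialSolDeriv d k (Real.sqrt (a + τ ^ 2))) τ := by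
  have h1 : HasDerivAt (fun τ : ℝ => Real.sqrt (a + τ ^ 2)) (τ / Real.sqrt (a + τ ^ 2)) τ := by
    have h2 : HasDerivAt (fun τ : ℝ => a + τ ^ 2) (2 * τ) τ := by
      simpa using (hasDerivAt_pow 2 τ).const_add a
    refine (h2.sqrt ha.ne').congr_deriv ?_
    rw [mul_div_mul_left _ _ two_ne_zero]
  refine (((hasDerivAt_radialSol hd hk).1 _ (Real.sqrt_pos.2 ha)).scomp τ h1).congr_deriv ?_
  rw [Complex.real_smul]

theorem normalDeriv_fundSol {d : ℕ} (hd : d = 1 ∨ d = 2) {k : ℝ} (hk : 0 < k) {x : E (d + 1)}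
    {y : E d} (hxy : 0 < ‖x - point y 0‖) :
    normalDeriv (fundSol k x) (point y 0) =
      -((height x / ‖x - point y 0‖ : ℝ) : ℂ) * radialSolDeriv d k ‖x - point y 0‖ := by
  have hr : ‖x - point y 0‖ = Real.sqrt (‖horiz x - y‖ ^ 2 + height x ^ 2) := by
    rw [norm_sub_point, sub_zero]
  have hpos : 0 < ‖horiz x - y‖ ^ 2 + height x ^ 2 := by
    rw [hr] at hxy; exact Real.sqrt_pos.1 hxy
  have h1 : HasDerivAt (fun τ : ℝ => height x - τ) (-1) 0 := by
    simpa using (hasDerivAt_id (0 : ℝ)).const_sub (height x)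
  have h2 := hasDerivAt_radialSol_sqrt hd hk (a := ‖horiz x - y‖ ^ 2) (τ := height x - 0)
    (by rwa [sub_zero])
  have h3 := h2.scomp (0 : ℝ) h1
  simp only [sub_zero] at h3
  rw [normalDeriv, lineDeriv]
  have h4 : (fun τ : ℝ => fundSol k x (point y 0 + τ • normal d)) =
      (fun τ => radialSol d k (Real.sqrt (‖horiz x - y‖ ^ 2 + τ ^ 2))) ∘
        fun τ => height x - τ := by
    ext τ
    rw [point_add_smul_normal, zero_add, fundSol_eq_radialSol, norm_sub_point]
    rfl
  rw [h4, h3.deriv, hr]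
  simp

/-- Differentiation of the single layer potential in the normal direction, under the integral. -/
theorem hasDerivAt_layer_integral {d : ℕ} (hd : d = 1 ∨ d = 2) {k : ℝ} (hk : 0 < k)
    {Γ : Opens (E d)} (φ : 𝓓(Γ, ℂ)) (y₀ : E d) {t : ℝ} (ht : 0 < t) :
    HasDerivAt (fun τ => ∫ y, radialSol d k (Real.sqrt (‖y₀ - y‖ ^ 2 + τ ^ 2)) * φ y)
      (∫ y, ((t / Real.sqrt (‖y₀ - y‖ ^ 2 + t ^ 2) : ℝ) : ℂ) *
        radialSolDeriv d k (Real.sqrt (‖y₀ - y‖ ^ 2 + t ^ 2)) * φ y) t := by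
  have hpos : ∀ (y : E d) {τ : ℝ}, 0 < τ → 0 < ‖y₀ - y‖ ^ 2 + τ ^ 2 := fun y τ hτ => by positivity
  have hcont : ∀ f : ℝ → ℂ, ContinuousOn f (Ioi 0) → ∀ τ : ℝ, 0 < τ →
      Continuous fun y => f (Real.sqrt (‖y₀ - y‖ ^ 2 + τ ^ 2)) := fun f hf τ hτ =>
    hf.comp_continuous (by fun_prop) fun y => Real.sqrt_pos.2 (hpos y hτ)
  set F' : ℝ → E d → ℂ := fun τ y => ((τ / Real.sqrt (‖y₀ - y‖ ^ 2 + τ ^ 2) : ℝ) : ℂ) *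
        radialSolDeriv d k (Real.sqrt (‖y₀ - y‖ ^ 2 + τ ^ 2)) with hF'
  have hF'c : ContinuousOn F'.uncurry (Icc (t / 2) (2 * t) ×ˢ tsupport φ) := by
    have hmem : ∀ p ∈ Icc (t / 2) (2 * t) ×ˢ tsupport φ,
        0 < Real.sqrt (‖y₀ - p.2‖ ^ 2 + p.1 ^ 2) := fun p hp =>
      Real.sqrt_pos.2 (hpos p.2 (lt_of_lt_of_le (by positivity) hp.1.1))
    refine ContinuousOn.mul ?_ ?_
    · refine Complex.continuous_ofReal.comp_continuousOn ?_
      exact ContinuousOn.div (by fun_prop) (by fun_prop) fun p hp => (hmem p hp).ne'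
    · exact (hasDerivAt_radialSol hd hk).2.comp (by fun_prop) fun p hp => hmem p hp
  obtain ⟨C, hC⟩ := (isCompact_Icc.prod φ.hasCompactSupport.isCompact).exists_bound_of_continuousOn
    hF'c
  refine (hasDerivAt_integral_of_dominated_loc_of_deriv_le (s := Ioo (t / 2) (2 * t))
    (F := fun τ y => radialSol d k (Real.sqrt (‖y₀ - y‖ ^ 2 + τ ^ 2)) * φ y)
    (F' := fun τ y => F' τ y * φ y) (bound := fun y => C * ‖φ y‖)
    (Ioo_mem_nhds (by linarith) (by linarith)) ?_ ?_ ?_ ?_ ?_ ?_).2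
  · filter_upwards [lt_mem_nhds ht] with τ hτ
    exact ((hcont _ (continuousOn_radialSol hd hk) τ hτ).mul φ.continuous).aestronglyMeasurable
  · exact ((hcont _ (continuousOn_radialSol hd hk) t ht).mul
      φ.continuous).integrable_of_hasCompactSupport φ.hasCompactSupport.mul_left
  · refine (Continuous.mul (Continuous.mul ?_ (hcont _ (hasDerivAt_radialSol hd hk).2 t ht))
      φ.continuous).aestronglyMeasurable
    refine Complex.continuous_ofReal.comp (Continuous.div (by fun_prop) (by fun_prop) fun y => ?_)
    exact (Real.sqrt_pos.2 (hpos y ht)).ne'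
  · refine Eventually.of_forall fun y τ hτ => ?_
    rw [norm_mul]
    by_cases hy : y ∈ tsupport φ
    · exact mul_le_mul_of_nonneg_right (hC (τ, y) ⟨Ioo_subset_Icc_self hτ, hy⟩) (norm_nonneg _)
    · rw [image_eq_zero_of_notMem_tsupport hy, norm_zero, mul_zero, mul_zero]
  · exact (testFunction_integrable φ).norm.const_mul C
  · exact Eventually.of_forall fun y τ hτ =>
      (hasDerivAt_radialSol_sqrt hd hk (hpos y (lt_trans (by positivity) hτ.1))).mul_const _

theorem doubleLayer_integrand {d : ℕ} (hd : d = 1 ∨ d = 2) {k : ℝ} (hk : 0 < k)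
    {Γ : Opens (E d)} (φ : 𝓓(Γ, ℂ)) {x : E (d + 1)} (hx : x ∈ domain (Γ : Set (E d))) :
    EqOn (fun y => normalDeriv (fundSol k x) (point y 0) * φ y)
      (fun y => (-((height x / ‖x - point y 0‖ : ℝ) : ℂ) * radialSolDeriv d k ‖x - point y 0‖) *
        φ y) Γ := by
  obtain ⟨δ, hδ, hdist⟩ := exists_dist_le_of_mem_domain hx
  intro y hy
  simp only
  rw [normalDeriv_fundSol hd hk (hδ.trans_le (hdist y hy))]

theorem integrable_doubleLayer {d : ℕ} (hd : d = 1 ∨ d = 2) {k : ℝ} (hk : 0 < k)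
    {Γ : Opens (E d)} (φ : 𝓓(Γ, ℂ)) {x : E (d + 1)} (hx : x ∈ domain (Γ : Set (E d))) :
    IntegrableOn (fun y => normalDeriv (fundSol k x) (point y 0) * φ y) Γ := by
  refine IntegrableOn.congr_fun (integrable_layer_kernel φ (f := fun r =>
    -((height x / r : ℝ) : ℂ) * radialSolDeriv d k r) ?_ hx)
    (doubleLayer_integrand hd hk φ hx).symm Γ.isOpen.measurableSet
  refine ContinuousOn.mul (ContinuousOn.neg (Complex.continuous_ofReal.comp_continuousOn ?_))
    (hasDerivAt_radialSol hd hk).2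
  exact continuousOn_const.div continuousOn_id fun r hr => ne_of_gt hr

/-- The spectral representation of the double layer potential, by differentiating that of the
single layer potential in the normal direction. -/
theorem doubleLayer_eq {d : ℕ} (hd : d = 1 ∨ d = 2) {k : ℝ} (hk : 0 < k)
    {Γ : Opens (E d)} (φ : 𝓓(Γ, ℂ)) {x : E (d + 1)} (hx : x ∈ domain (Γ : Set (E d))) :
    doubleLayer k Γ φ x = (Real.sign (height x) : ℂ) * coeff d *
      jetIntegral (propagatorJet k) (hat φ) (point (horiz x) |height x|) := by
  rw [doubleLayer, setIntegral_congr_fun Γ.isOpen.measurableSet (doubleLayer_integrand hd hk φ hx)]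
  rcases eq_or_ne (height x) 0 with h0 | h0
  · simp [h0]
  have hd0 : 0 < d := by omega
  have ht : 0 < |height x| := abs_pos.2 h0
  have hφ := (rapidlyDecreasing_hat_testFunction φ).div_Z hd0 hk
  have h1 := hasDerivAt_layer_integral hd hk φ (horiz x) ht
  have h2 : HasDerivAt (fun τ => ∫ y, radialSol d k (Real.sqrt (‖horiz x - y‖ ^ 2 + τ ^ 2)) * φ y)
      (Complex.I * coeff d * jetIntegral (fun m => propagatorJet k (m + 1))
        (fun ξ => hat φ ξ / Z k ξ) (point (horiz x) |height x|)) |height x| := by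
    refine ((hasDerivAt_jetIntegral (isJet_propagatorJet hk) hφ (horiz x)
      |height x|).const_mul (Complex.I * coeff d)).congr_of_eventuallyEq ?_
    filter_upwards [lt_mem_nhds ht] with τ hτ
    exact singleLayer_eq_of_pos hd hk φ _ hτ
  have h3 := h1.unique h2
  rw [jetIntegral_shift hk _ _ ht.le, jetIntegral_congr_ae _ (Z_mul_div_ae hk (hat φ))] at h3
  have h4 : ∀ y : E d, (-((height x / ‖x - point y 0‖ : ℝ) : ℂ) *
      radialSolDeriv d k ‖x - point y 0‖) * φ y = -(Real.sign (height x) : ℂ) *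
      (((|height x| / Real.sqrt (‖horiz x - y‖ ^ 2 + |height x| ^ 2) : ℝ) : ℂ) *
        radialSolDeriv d k (Real.sqrt (‖horiz x - y‖ ^ 2 + |height x| ^ 2)) * φ y) := by
    intro y
    have hs : (height x : ℂ) = (Real.sign (height x) : ℂ) * (|height x| : ℝ) := by
      rw [← Complex.ofReal_mul]
      congr 1
      rcases h0.lt_or_gt with h | h
      · rw [Real.sign_of_neg h, abs_of_neg h]; ring
      · rw [Real.sign_of_pos h, abs_of_pos h]; ring
    rw [norm_sub_point, sub_zero, sq_abs, Complex.ofReal_div, Complex.ofReal_div, hs]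
    ring
  rw [setIntegral_eq_integral_of_forall_compl_eq_zero fun y hy => by
    rw [testFunction_eq_zero φ hy, mul_zero]]
  simp only [h4]
  rw [integral_const_mul, h3]
  linear_combination (-(Real.sign (height x) : ℂ) * coeff d * jetIntegral (propagatorJet k) (hat φ)
    (point (horiz x) |height x|)) * Complex.I_sq

/-! ### Boundary values on the screen -/

theorem isOpen_halfSpace (d : ℕ) (s : ℤˣ) : IsOpen (halfSpace d s) :=
  isOpen_lt continuous_const (continuous_const.mul contDiff_height.continuous)

theorem sign_mul_self (s : ℤˣ) : ((s : ℤ) : ℝ) * ((s : ℤ) : ℝ) = 1 := by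
  rcases Int.units_eq_one_or s with rfl | rfl <;> norm_num

theorem continuous_point_right {d : ℕ} (y : E d) : Continuous fun t : ℝ => point y t :=
  contDiff_point.continuous.comp (by fun_prop : Continuous fun t : ℝ => (y, t))

theorem contDiff_point_left {d : ℕ} (t : ℝ) : ContDiff ℝ ∞ fun y : E d => point y t :=
  contDiff_point.comp (contDiff_id.prodMk contDiff_const)

theorem point_mem_closure_halfSpace {d : ℕ} (s : ℤˣ) (y : E d) :
    point y 0 ∈ closure (halfSpace d s) := by
  have hc : Continuous fun τ : ℝ => point y (((s : ℤ) : ℝ) * τ) :=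
    (continuous_point_right y).comp (by fun_prop)
  have h1 : Tendsto (fun τ : ℝ => point y (((s : ℤ) : ℝ) * τ)) (𝓝[>] 0) (𝓝 (point y 0)) := by
    have := hc.tendsto 0
    rw [mul_zero] at this
    exact this.mono_left nhdsWithin_le_nhds
  refine mem_closure_of_tendsto h1 ?_
  filter_upwards [self_mem_nhdsWithin] with τ hτ
  show 0 < ((s : ℤ) : ℝ) * height (point y (((s : ℤ) : ℝ) * τ))
  rw [height_point, ← mul_assoc, sign_mul_self, one_mul]
  exact hτ

theorem halfSpace_subset_domain {d : ℕ} (s : ℤˣ) (Γ : Set (E d)) :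
    halfSpace d s ⊆ domain Γ := by
  intro x hx hcl
  have h1 : closure (screen Γ) ⊆ {x : E (d + 1) | height x = 0} := by
    refine closure_minimal ?_ (isClosed_eq contDiff_height.continuous continuous_const)
    rintro _ ⟨y, _, rfl⟩
    exact height_point y 0
  have h2 : 0 < ((s : ℤ) : ℝ) * height x := hx
  rw [h1 hcl, mul_zero] at h2
  exact lt_irrefl _ h2

/-- The reflection taking the half space with sign `s` to the upper half space. -/
def flip {d : ℕ} (s : ℤˣ) (x : E (d + 1)) : E (d + 1) :=
  point (horiz x) (((s : ℤ) : ℝ) * height x)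

theorem contDiff_flip {d : ℕ} (s : ℤˣ) : ContDiff ℝ ∞ (flip s : E (d + 1) → E (d + 1)) :=
  contDiff_point.comp (contDiff_horiz.prodMk (contDiff_const.mul contDiff_height))

theorem flip_point {d : ℕ} (s : ℤˣ) (y : E d) (t : ℝ) :
    flip s (point y t) = point y (((s : ℤ) : ℝ) * t) := by
  rw [flip, horiz_point, height_point]

theorem abs_height_of_mem {d : ℕ} {s : ℤˣ} {x : E (d + 1)} (hx : x ∈ halfSpace d s) :
    |height x| = ((s : ℤ) : ℝ) * height x ∧ Real.sign (height x) = ((s : ℤ) : ℝ) := by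
  have hx' : 0 < ((s : ℤ) : ℝ) * height x := hx
  rcases Int.units_eq_one_or s with rfl | rfl
  · have h : 0 < height x := by simpa using hx'
    exact ⟨by rw [abs_of_pos h]; simp, by rw [Real.sign_of_pos h]; simp⟩
  · have h : height x < 0 := by simpa using hx'
    exact ⟨by rw [abs_of_neg h]; simp, by rw [Real.sign_of_neg h]; simp⟩

section Trace

variable {d : ℕ} {s : ℤˣ} {u W : E (d + 1) → ℂ} (χ : 𝓓((⊤ : Opens (E (d + 1))), ℂ))

/-- A function that agrees on the half space with a function `W` smooth on `ℝⁿ` is smooth up to the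
boundary after multiplication by a cut-off function. -/
theorem smoothUpToBoundary_mul (hW : ContDiff ℝ ∞ W) (h : EqOn u W (halfSpace d s)) :
    SmoothUpToBoundary s fun x => χ x * u x :=
  ⟨⟨fun x => χ x * W x, ContDiff.mul (by simpa using χ.contDiff) (by simpa using hW),
    χ.hasCompactSupport.mul_right, by simp⟩, fun x hx => by
      show χ x * u x = χ x * W x
      rw [h hx]⟩

theorem dirichletTrace_mul (hW : ContDiff ℝ ∞ W) (h : EqOn u W (halfSpace d s)) (y : E d) :
    dirichletTrace s (fun x => χ x * u x) y = χ (point y 0) * W (point y 0) := by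
  refine extendFrom_eq (point_mem_closure_halfSpace s y) ?_
  have h1 : Tendsto (fun x => χ x * W x) (𝓝[halfSpace d s] (point y 0))
      (𝓝 (χ (point y 0) * W (point y 0))) :=
    ((χ.continuous.mul hW.continuous).tendsto _).mono_left nhdsWithin_le_nhds
  refine h1.congr' ?_
  filter_upwards [self_mem_nhdsWithin] with x hx
  rw [h hx]

theorem normalDeriv_congr {u v : E (d + 1) → ℂ} {x : E (d + 1)} (h : u =ᶠ[𝓝 x] v) :
    normalDeriv u x = normalDeriv v x := h.lineDeriv_eq

theorem neumannTrace_mul (hW : ContDiff ℝ ∞ W) (h : EqOn u W (halfSpace d s)) {y : E d}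
    (hχ : ∀ᶠ x in 𝓝 (point y 0), χ x = 1) :
    neumannTrace s (fun x => χ x * u x) y = normalDeriv W (point y 0) := by
  refine extendFrom_eq (point_mem_closure_halfSpace s y) ?_
  have hcont : Continuous (normalDeriv W) := by
    have h1 : normalDeriv W = fun x => fderiv ℝ W x (normal d) := by
      ext x
      exact normalDeriv_eq_of_hasFDerivAt (hW.differentiable (by simp) x).hasFDerivAt
    rw [h1]
    exact (hW.continuous_fderiv (by simp)).clm_apply continuous_const
  refine ((hcont.tendsto _).mono_left nhdsWithin_le_nhds).congr' ?_
  filter_upwards [self_mem_nhdsWithin, nhdsWithin_le_nhds hχ.eventually_nhds] with x hx hx1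
  refine normalDeriv_congr ?_
  filter_upwards [(isOpen_halfSpace d s).mem_nhds hx, hx1] with z hz hz1
  rw [hz1, one_mul, h hz]

end Trace

theorem IsCutoff.eventually {d : ℕ} {Γ : Set (E d)} {χ : 𝓓((⊤ : Opens (E (d + 1))), ℂ)}
    (hχ : IsCutoff Γ χ) {y : E d} (hy : y ∈ Γ) : ∀ᶠ x in 𝓝 (point y 0), χ x = 1 :=
  Filter.Eventually.filter_mono
    (nhds_le_nhdsSet (show point y 0 ∈ screen Γ from ⟨y, hy, rfl⟩)) hχ

/-- A smooth function on the plane agrees on the screen with a test function. -/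
theorem exists_testFunction_eqOn {d : ℕ} {Γ : Set (E d)} {χ : 𝓓((⊤ : Opens (E (d + 1))), ℂ)}
    (hχ : IsCutoff Γ χ) {f : E d → ℂ} (hf : ContDiff ℝ ∞ f) :
    ∃ U : 𝓓((⊤ : Opens (E d)), ℂ), EqOn f U Γ := by
  have hc : ContDiff ℝ ∞ (χ : E (d + 1) → ℂ) := by simpa using χ.contDiff
  have hs : HasCompactSupport fun y : E d => χ (point y 0) := by
    refine HasCompactSupport.intro
      (χ.hasCompactSupport.isCompact.image contDiff_horiz.continuous) fun y hy => ?_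
    by_contra hne
    exact hy ⟨point y 0, subset_tsupport _ hne, horiz_point y 0⟩
  refine ⟨⟨fun y => χ (point y 0) * f y,
    by simpa using (hc.comp (contDiff_point_left 0)).mul hf, hs.mul_right, by simp⟩,
    fun y hy => ?_⟩
  show f y = χ (point y 0) * f y
  rw [(hχ.eventually hy).self_of_nhds, one_mul]

/-! ### The boundary operators -/

theorem RapidlyDecreasing.mul_Z {d : ℕ} {k : ℝ} (hk : 0 < k) {c : E d → ℂ}
    (hc : RapidlyDecreasing c) : RapidlyIntegrable fun ξ => Z k ξ * c ξ :=
  hc.rapidlyIntegrable.mul_of_le (measurable_Z k) (norm_Z_le hk)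

/-- At `t = 0` the propagator is `1`, and the jet integral is an inverse Fourier transform. -/
theorem jetIntegral_propagator_zero {d : ℕ} (k : ℝ) (c : E d → ℂ) (y : E d) :
    jetIntegral (propagatorJet k) c (point y 0) = ∫ ξ, phase ξ y * c ξ := by
  rw [jetIntegral_point]
  simp [propagatorJet_zero]

theorem RapidlyIntegrable.integrable_phase_mul {d : ℕ} {c : E d → ℂ} (hc : RapidlyIntegrable c)
    (y : E d) : Integrable fun ξ => phase ξ y * c ξ :=
  (hc.mul_of_le (continuous_phase_left y).measurable (C := 1) (N := 0)
    (by simp [norm_phase])).integrable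

theorem contDiff_integral_phase_mul {d : ℕ} {k : ℝ} (hk : 0 < k) {c : E d → ℂ}
    (hc : RapidlyIntegrable c) : ContDiff ℝ ∞ fun y => ∫ ξ, phase ξ y * c ξ := by
  simp only [← jetIntegral_propagator_zero k]
  exact (contDiff_jetIntegral (isJet_propagatorJet hk) hc).comp (contDiff_point_left 0)

theorem Sinf_eq {d : ℕ} (k : ℝ) (φ : E d → ℂ) (y : E d) :
    Sinf k φ y = Complex.I * coeff d * ∫ ξ, phase ξ y * (hat φ ξ / Z k ξ) := by
  rw [Sinf]
  congr 2
  ext ξ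
  ring

theorem Tinf_eq {d : ℕ} (k : ℝ) (φ : E d → ℂ) (y : E d) :
    Tinf k φ y = Complex.I * coeff d * ∫ ξ, phase ξ y * (Z k ξ * hat φ ξ) := by
  rw [Tinf]
  congr 2
  ext ξ
  ring

theorem contDiff_Sinf {d : ℕ} (hd : 0 < d) {k : ℝ} (hk : 0 < k) {φ : E d → ℂ}
    (hφ : RapidlyDecreasing (hat φ)) : ContDiff ℝ ∞ (Sinf k φ) := by
  simp only [funext (Sinf_eq k φ)]
  exact contDiff_const.mul (contDiff_integral_phase_mul hk (hφ.div_Z hd hk))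

theorem contDiff_Tinf {d : ℕ} {k : ℝ} (hk : 0 < k) {φ : E d → ℂ}
    (hφ : RapidlyDecreasing (hat φ)) : ContDiff ℝ ∞ (Tinf k φ) := by
  simp only [funext (Tinf_eq k φ)]
  exact contDiff_const.mul (contDiff_integral_phase_mul hk (hφ.mul_Z hk))

/-- The smooth extensions of the potentials from the half space with sign `s` to `ℝⁿ`. -/
theorem contDiff_jetIntegral_flip {d : ℕ} {k : ℝ} (hk : 0 < k) {c : E d → ℂ}
    (hc : RapidlyIntegrable c) (s : ℤˣ) (a : ℂ) :
    ContDiff ℝ ∞ fun x => a * jetIntegral (propagatorJet k) c (flip s x) :=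
  contDiff_const.mul ((contDiff_jetIntegral (isJet_propagatorJet hk) hc).comp (contDiff_flip s))

theorem singleLayer_eqOn {d : ℕ} (hd : d = 1 ∨ d = 2) {k : ℝ} (hk : 0 < k) {Γ : Opens (E d)}
    (φ : 𝓓(Γ, ℂ)) (s : ℤˣ) :
    EqOn (singleLayer k Γ φ) (fun x => Complex.I * coeff d *
      jetIntegral (propagatorJet k) (fun ξ => hat φ ξ / Z k ξ) (flip s x)) (halfSpace d s) := by
  intro x hx
  rw [singleLayer_eq hd hk φ (halfSpace_subset_domain s _ hx), (abs_height_of_mem hx).1]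
  rfl

theorem doubleLayer_eqOn {d : ℕ} (hd : d = 1 ∨ d = 2) {k : ℝ} (hk : 0 < k) {Γ : Opens (E d)}
    (φ : 𝓓(Γ, ℂ)) (s : ℤˣ) :
    EqOn (doubleLayer k Γ φ) (fun x => (((s : ℤ) : ℝ) : ℂ) * coeff d *
      jetIntegral (propagatorJet k) (hat φ) (flip s x)) (halfSpace d s) := by
  intro x hx
  rw [doubleLayer_eq hd hk φ (halfSpace_subset_domain s _ hx), (abs_height_of_mem hx).1,
    (abs_height_of_mem hx).2]
  rfl

/-- The sign of the double layer potential cancels the one from the chain rule for `flip`, so that the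
normal derivative is the same from both sides. -/
theorem normalDeriv_jetIntegral_flip {d : ℕ} {k : ℝ} (hk : 0 < k) {c : E d → ℂ}
    (hc : RapidlyIntegrable c) (s : ℤˣ) (y : E d) :
    normalDeriv (fun x => (((s : ℤ) : ℝ) : ℂ) * coeff d *
      jetIntegral (propagatorJet k) c (flip s x)) (point y 0) =
      Complex.I * coeff d * ∫ ξ, phase ξ y * (Z k ξ * c ξ) := by
  set σ : ℝ := ((s : ℤ) : ℝ) with hσ
  have h1 : HasDerivAt (fun τ : ℝ => σ * τ) σ 0 := by
    simpa using (hasDerivAt_id (0 : ℝ)).const_mul σ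
  have h2 := hasDerivAt_jetIntegral (isJet_propagatorJet hk) hc y (σ * 0)
  have h3 := (h2.scomp (0 : ℝ) h1).const_mul ((σ : ℂ) * coeff d)
  rw [mul_zero, jetIntegral_shift hk _ _ le_rfl, jetIntegral_propagator_zero] at h3
  rw [normalDeriv, lineDeriv]
  simp only [point_add_smul_normal, zero_add, flip_point]
  refine h3.deriv.trans ?_
  have hσ2 : (σ : ℂ) * σ = 1 := by rw [← Complex.ofReal_mul, hσ, sign_mul_self, Complex.ofReal_one]
  rw [Complex.real_smul]
  linear_combination (coeff d * (Complex.I * ∫ ξ, phase ξ y * (Z k ξ * c ξ))) * hσ2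

theorem singleLayerOp_eqOn {d : ℕ} (hd : d = 1 ∨ d = 2) {k : ℝ} (hk : 0 < k) {Γ : Opens (E d)}
    (φ : 𝓓(Γ, ℂ)) {χ : 𝓓((⊤ : Opens (E (d + 1))), ℂ)} (hχ : IsCutoff (Γ : Set (E d)) χ) (s : ℤˣ) :
    EqOn (singleLayerOp χ s k Γ φ) (Sinf k φ) Γ := by
  intro y hy
  have hd0 : 0 < d := by omega
  rw [singleLayerOp, dirichletTrace_mul χ (contDiff_jetIntegral_flip hk
    ((rapidlyDecreasing_hat_testFunction φ).div_Z hd0 hk) s _) (singleLayer_eqOn hd hk φ s),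
    (hχ.eventually hy).self_of_nhds, one_mul, flip_point, mul_zero, jetIntegral_propagator_zero,
    Sinf_eq]

theorem hypersingularOp_eqOn {d : ℕ} (hd : d = 1 ∨ d = 2) {k : ℝ} (hk : 0 < k) {Γ : Opens (E d)}
    (φ : 𝓓(Γ, ℂ)) {χ : 𝓓((⊤ : Opens (E (d + 1))), ℂ)} (hχ : IsCutoff (Γ : Set (E d)) χ) (s : ℤˣ) :
    EqOn (hypersingularOp χ s k Γ φ) (Tinf k φ) Γ := by
  intro y hy
  have hφ := (rapidlyDecreasing_hat_testFunction φ).rapidlyIntegrable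
  rw [hypersingularOp, neumannTrace_mul χ (contDiff_jetIntegral_flip hk hφ s _)
    (doubleLayer_eqOn hd hk φ s) (hχ.eventually hy), normalDeriv_jetIntegral_flip hk hφ, Tinf_eq]

/-! ### The sesquilinear forms -/

theorem conj_hat {d : ℕ} (ψ : E d → ℂ) (ξ : E d) :
    starRingEnd ℂ (hat ψ ξ) = 1 / (((2 * Real.pi) ^ ((d : ℝ) / 2) : ℝ) : ℂ) *
      ∫ y, phase ξ y * starRingEnd ℂ (ψ y) := by
  rw [hat, map_mul, ← integral_conj, map_div₀, map_one, Complex.conj_ofReal]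
  congr 2
  ext y
  rw [map_mul, ← Complex.exp_conj, phase]
  congr 2
  simp

theorem integrable_mul_conj_hat {d : ℕ} {c ψ : E d → ℂ} (hc : RapidlyIntegrable c)
    (hψ : RapidlyDecreasing (hat ψ)) : Integrable fun ξ => c ξ * starRingEnd ℂ (hat ψ ξ) := by
  obtain ⟨C, hC⟩ := hψ.decay 0
  have := hc.mul_of_le (g := fun ξ => starRingEnd ℂ (hat ψ ξ)) (C := C) (N := 0)
    (Complex.continuous_conj.comp hψ.continuous).measurable fun ξ => by
      simpa using hC ξ
  refine this.integrable.congr (Eventually.of_forall fun ξ => mul_comm _ _)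

/-- Parseval's identity for a Fourier multiplier paired with a test function. -/
theorem sesquilinear_form_eq {d : ℕ} {k : ℝ} (hk : 0 < k) {Γ : Opens (E d)} (ψ : 𝓓(Γ, ℂ))
    {c : E d → ℂ} (hc : RapidlyIntegrable c) {u : E d → ℂ}
    (hu : EqOn u (fun y => Complex.I * coeff d * ∫ ξ, phase ξ y * c ξ) Γ) :
    IntegrableOn (fun y => u y * starRingEnd ℂ (ψ y)) Γ ∧
    ∫ y in (Γ : Set (E d)), u y * starRingEnd ℂ (ψ y) =
      Complex.I / 2 * ∫ ξ, c ξ * starRingEnd ℂ (hat ψ ξ) := by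
  have hψc : Continuous fun y => starRingEnd ℂ (ψ y) := Complex.continuous_conj.comp ψ.continuous
  have hψs : HasCompactSupport fun y => starRingEnd ℂ (ψ y) :=
    ψ.hasCompactSupport.comp_left (map_zero _)
  have heq : EqOn (fun y => u y * starRingEnd ℂ (ψ y)) (fun y => Complex.I * coeff d *
      ((∫ ξ, phase ξ y * c ξ) * starRingEnd ℂ (ψ y))) Γ := by
    intro y hy
    simp only
    rw [hu hy, mul_assoc]
  have hcont : Continuous fun y => (∫ ξ, phase ξ y * c ξ) * starRingEnd ℂ (ψ y) :=
    (contDiff_integral_phase_mul hk hc).continuous.mul hψc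
  refine ⟨IntegrableOn.congr_fun ((hcont.integrable_of_hasCompactSupport
    hψs.mul_left).integrableOn.const_mul _) heq.symm Γ.isOpen.measurableSet, ?_⟩
  rw [setIntegral_congr_fun Γ.isOpen.measurableSet heq, integral_const_mul,
    setIntegral_eq_integral_of_forall_compl_eq_zero fun y hy => by
      rw [testFunction_eq_zero ψ hy, map_zero, mul_zero]]
  have h1 : Integrable (fun p : E d × E d => starRingEnd ℂ (ψ p.1) * c p.2)
      (volume.prod volume) := (hψc.integrable_of_hasCompactSupport hψs).mul_prod hc.integrable
  have h2 : Integrable (fun p : E d × E d => phase p.2 p.1 * (starRingEnd ℂ (ψ p.1) * c p.2))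
      (volume.prod volume) := by
    have hp : Continuous fun p : E d × E d => phase p.2 p.1 :=
      continuous_phase.comp (by fun_prop : Continuous fun p : E d × E d => (p.2, p.1))
    refine h1.mono (hp.aestronglyMeasurable.mul h1.1) (Eventually.of_forall fun p => ?_)
    rw [norm_mul, norm_phase, one_mul]
  have hswap : ∫ y, ∫ ξ, phase ξ y * (starRingEnd ℂ (ψ y) * c ξ) =
      ∫ ξ, ∫ y, phase ξ y * (starRingEnd ℂ (ψ y) * c ξ) := integral_integral_swap h2
  have hA : (((2 * Real.pi) ^ ((d : ℝ) / 2) : ℝ) : ℂ) ≠ 0 := by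
    exact_mod_cast (by positivity : (2 * Real.pi) ^ ((d : ℝ) / 2) ≠ 0)
  have hL : ∀ y, ∫ ξ, phase ξ y * (starRingEnd ℂ (ψ y) * c ξ) =
      (∫ ξ, phase ξ y * c ξ) * starRingEnd ℂ (ψ y) := by
    intro y
    rw [← integral_mul_const]
    congr 1; ext ξ; ring
  have hR : ∀ ξ, ∫ y, phase ξ y * (starRingEnd ℂ (ψ y) * c ξ) =
      (((2 * Real.pi) ^ ((d : ℝ) / 2) : ℝ) : ℂ) * (c ξ * starRingEnd ℂ (hat ψ ξ)) := by
    intro ξ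
    have h3 : ∀ y, phase ξ y * (starRingEnd ℂ (ψ y) * c ξ) =
        c ξ * (phase ξ y * starRingEnd ℂ (ψ y)) := fun y => by ring
    simp only [h3]
    rw [integral_const_mul, conj_hat, mul_left_comm, one_div, mul_inv_cancel_left₀ hA]
  simp only [hL, hR] at hswap
  rw [hswap, integral_const_mul, coeff]
  field_simp

end Screen

end

theorem theorem4p1 {d : ℕ} (hd : d = 1 ∨ d = 2) (k : ℝ) (hk : 0 < k)
    (Γ : TopologicalSpace.Opens (Screen.E d)) (hne : (Γ : Set (Screen.E d)).Nonempty)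
    (hbdd : Bornology.IsBounded (Γ : Set (Screen.E d))) :
    -- the operators `S_k^∞, T_k^∞ : 𝒟(ℝⁿ⁻¹) → C^∞(ℝⁿ⁻¹)` are well defined
    (∀ φ : 𝓓((⊤ : TopologicalSpace.Opens (Screen.E d)), ℂ),
      (∀ x, Integrable (fun ξ => Screen.phase ξ x / Screen.Z k ξ * Screen.hat φ ξ)) ∧
      (∀ x, Integrable (fun ξ => Screen.Z k ξ * Screen.phase ξ x * Screen.hat φ ξ)) ∧
      ContDiff ℝ ∞ (Screen.Sinf k φ) ∧ ContDiff ℝ ∞ (Screen.Tinf k φ)) ∧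
    (∀ φ : 𝓓(Γ, ℂ),
      -- the single layer potential
      (∀ x ∈ Screen.domain (Γ : Set (Screen.E d)),
        IntegrableOn (fun y => Screen.fundSol k x (Screen.point y 0) * φ y) Γ ∧
        Integrable (fun ξ => Complex.exp (Complex.I * ((inner ℝ ξ (Screen.horiz x) : ℝ)
            + (|Screen.height x| : ℝ) * Screen.Z k ξ)) / Screen.Z k ξ * Screen.hat φ ξ) ∧
        Screen.singleLayer k Γ φ x = Complex.I * Screen.coeff d *
          ∫ ξ, Complex.exp (Complex.I * ((inner ℝ ξ (Screen.horiz x) : ℝ)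
            + (|Screen.height x| : ℝ) * Screen.Z k ξ)) / Screen.Z k ξ * Screen.hat φ ξ) ∧
      -- the double layer potential
      (∀ x ∈ Screen.domain (Γ : Set (Screen.E d)),
        IntegrableOn
          (fun y => Screen.normalDeriv (Screen.fundSol k x) (Screen.point y 0) * φ y) Γ ∧
        Integrable (fun ξ => Complex.exp (Complex.I * ((inner ℝ ξ (Screen.horiz x) : ℝ)
            + (|Screen.height x| : ℝ) * Screen.Z k ξ)) * Screen.hat φ ξ) ∧
        Screen.doubleLayer k Γ φ x = (Real.sign (Screen.height x) : ℂ) * Screen.coeff d *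
          ∫ ξ, Complex.exp (Complex.I * ((inner ℝ ξ (Screen.horiz x) : ℝ)
            + (|Screen.height x| : ℝ) * Screen.Z k ξ)) * Screen.hat φ ξ) ∧
      -- the boundary operators, for every admissible cut-off function and either side
      (∀ χ : 𝓓((⊤ : TopologicalSpace.Opens (Screen.E (d + 1))), ℂ), Screen.IsCutoff Γ χ →
        ∀ s : ℤˣ,
        Screen.SmoothUpToBoundary s (fun x => χ x * Screen.singleLayer k Γ φ x) ∧
        Screen.SmoothUpToBoundary s (fun x => χ x * Screen.doubleLayer k Γ φ x) ∧
        -- they map `𝒟(Γ)` into `𝒟(closure of Γ)`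
        (∃ U : 𝓓((⊤ : TopologicalSpace.Opens (Screen.E d)), ℂ),
          Set.EqOn (Screen.singleLayerOp χ s k Γ φ) U Γ) ∧
        (∃ U : 𝓓((⊤ : TopologicalSpace.Opens (Screen.E d)), ℂ),
          Set.EqOn (Screen.hypersingularOp χ s k Γ φ) U Γ) ∧
        Set.EqOn (Screen.singleLayerOp χ s k Γ φ) (Screen.Sinf k φ) Γ ∧
        Set.EqOn (Screen.hypersingularOp χ s k Γ φ) (Screen.Tinf k φ) Γ ∧
        -- the sesquilinear forms
        (∀ ψ : 𝓓(Γ, ℂ),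
          IntegrableOn
            (fun y => Screen.singleLayerOp χ s k Γ φ y * starRingEnd ℂ (ψ y)) Γ ∧
          Integrable (fun ξ => 1 / Screen.Z k ξ * Screen.hat φ ξ
            * starRingEnd ℂ (Screen.hat ψ ξ)) ∧
          ∫ y in (Γ : Set (Screen.E d)),
              Screen.singleLayerOp χ s k Γ φ y * starRingEnd ℂ (ψ y)
            = Complex.I / 2 * ∫ ξ, 1 / Screen.Z k ξ * Screen.hat φ ξ
                * starRingEnd ℂ (Screen.hat ψ ξ) ∧
          IntegrableOn
            (fun y => Screen.hypersingularOp χ s k Γ φ y * starRingEnd ℂ (ψ y)) Γ ∧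
          Integrable (fun ξ => Screen.Z k ξ * Screen.hat φ ξ
            * starRingEnd ℂ (Screen.hat ψ ξ)) ∧
          ∫ y in (Γ : Set (Screen.E d)),
              Screen.hypersingularOp χ s k Γ φ y * starRingEnd ℂ (ψ y)
            = Complex.I / 2 * ∫ ξ, Screen.Z k ξ * Screen.hat φ ξ
                * starRingEnd ℂ (Screen.hat ψ ξ)))) := by
  have hd0 : 0 < d := by omega
  refine ⟨fun φ => ?_, fun φ => ⟨fun x hx => ?_, fun x hx => ?_, fun χ hχ s => ?_⟩⟩
  · have hφ := Screen.rapidlyDecreasing_hat_testFunction φ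
    refine ⟨fun x => ?_, fun x => ?_, Screen.contDiff_Sinf hd0 hk hφ, Screen.contDiff_Tinf hk hφ⟩
    · refine ((hφ.div_Z hd0 hk).integrable_phase_mul x).congr (.of_forall fun ξ => ?_)
      simp only
      ring
    · refine ((hφ.mul_Z hk).integrable_phase_mul x).congr (.of_forall fun ξ => ?_)
      simp only
      ring
  · have hφ := (Screen.rapidlyDecreasing_hat_testFunction φ).div_Z hd0 hk
    have hint := (Screen.isJet_propagatorJet hk).integrable hφ
      (Screen.point (Screen.horiz x) |Screen.height x|)
    have heq := Screen.singleLayer_eq hd hk φ hx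
    rw [Screen.jetIntegral_point] at heq
    rw [Screen.horiz_point, Screen.height_point] at hint
    have hpt : ∀ ξ, Complex.exp (Complex.I * ((inner ℝ ξ (Screen.horiz x) : ℝ)
        + (|Screen.height x| : ℝ) * Screen.Z k ξ)) / Screen.Z k ξ * Screen.hat φ ξ =
        Screen.phase ξ (Screen.horiz x) * Screen.propagatorJet k 0 ξ |Screen.height x| *
          (Screen.hat φ ξ / Screen.Z k ξ) := fun ξ => by
      rw [Screen.spectral_integrand_eq k ξ _ (abs_nonneg _)]; ring
    simp only [hpt]
    exact ⟨Screen.integrable_layer_kernel φ (Screen.continuousOn_radialSol hd hk) hx, hint, heq⟩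
  · have hφ := (Screen.rapidlyDecreasing_hat_testFunction φ).rapidlyIntegrable
    have hint := (Screen.isJet_propagatorJet hk).integrable hφ
      (Screen.point (Screen.horiz x) |Screen.height x|)
    have heq := Screen.doubleLayer_eq hd hk φ hx
    rw [Screen.jetIntegral_point] at heq
    rw [Screen.horiz_point, Screen.height_point] at hint
    have hpt := fun ξ => Screen.spectral_integrand_eq k ξ (Screen.horiz x)
      (abs_nonneg (Screen.height x))
    simp only [hpt]
    exact ⟨Screen.integrable_doubleLayer hd hk φ hx, hint, heq⟩
  · have hφ := Screen.rapidlyDecreasing_hat_testFunction φ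
    have hS := Screen.singleLayerOp_eqOn hd hk φ hχ s
    have hT := Screen.hypersingularOp_eqOn hd hk φ hχ s
    obtain ⟨U, hU⟩ := Screen.exists_testFunction_eqOn hχ (Screen.contDiff_Sinf hd0 hk hφ)
    obtain ⟨V, hV⟩ := Screen.exists_testFunction_eqOn hχ (Screen.contDiff_Tinf hk hφ)
    refine ⟨Screen.smoothUpToBoundary_mul χ (Screen.contDiff_jetIntegral_flip hk
        (hφ.div_Z hd0 hk) s _) (Screen.singleLayer_eqOn hd hk φ s),
      Screen.smoothUpToBoundary_mul χ (Screen.contDiff_jetIntegral_flip hk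
        hφ.rapidlyIntegrable s _) (Screen.doubleLayer_eqOn hd hk φ s),
      ⟨U, hS.trans hU⟩, ⟨V, hT.trans hV⟩, hS, hT, fun ψ => ?_⟩
    have hψ := Screen.rapidlyDecreasing_hat_testFunction ψ
    have h1 := Screen.sesquilinear_form_eq hk ψ (hφ.div_Z hd0 hk)
      (hS.trans fun y _ => Screen.Sinf_eq k φ y)
    have h2 := Screen.sesquilinear_form_eq hk ψ (hφ.mul_Z hk)
      (hT.trans fun y _ => Screen.Tinf_eq k φ y)
    have hdiv : ∀ ξ, 1 / Screen.Z k ξ * Screen.hat φ ξ = Screen.hat φ ξ / Screen.Z k ξ :=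
      fun ξ => by ring
    simp only [hdiv]
    exact ⟨h1.1, Screen.integrable_mul_conj_hat (hφ.div_Z hd0 hk) hψ, h1.2, h2.1,
      Screen.integrable_mul_conj_hat (hφ.mul_Z hk) hψ, h2.2⟩
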